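/- **Theorem 2 (estimating the regressors, arbitrary noise).** *Setting.* Let $\beta_1^*,\beta_2^*\in\mathbb{R}^p$, let $[n]=\mathcal I_1\sqcup\mathcal I_2$ be a fixed partition with $n_b=|\mathcal I_b|$, and let $y_i=\langle x_i,\beta_b^*\rangle+e_i$ for $i\in\mathcal I_b$, $b=1,2$. The entries $x_i(l)$, $i\in[n]$, $l\in[p]$, are i.i.d. with mean $0$, $\mathbb E[x_i(l)^2]=1$, $\mathbb E[x_i(l)^4]=\mu$ and sub-Gaussian norm $\sup_{q\ge1}q^{-1/2}(\mathbb E|x_i(l)|^q)^{1/q}\le L$. The noise $e\in\mathbb{R}^n$ is arbitrary; it may depend on the $x_i$ and on $\beta_1^*,\beta_2^*$. Put $\alpha=\|\beta_1^*-\beta_2^*\|_2^2/(\|\beta_1^*\|_2^2+\|\beta_2^*\|_2^2)$ (and $\alpha=0$ if $\beta_1^*=\beta_2^*=0$), and, for $\theta=(\beta_1,\beta_2)$ and $\theta'=(\beta_1',\beta_2')$, $$\rho(\theta,\theta')=\min\{\|\beta_1-\beta_1'\|_2+\|\beta_2-\beta_2'\|_2,\ \|\beta_1-\beta_2'\|_2+\|\beta_2-\beta_1'\|_2\}.$$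 *Method.* Take an optimal solution $(\hat K,\hat g)$ with $\hat K$ symmetric of the program $$\min_{K\in\mathbb{R}^{p\times p},\,g\in\mathbb{R}^p}\|K\|_*\quad\text{s.t.}\quad\sum_{i=1}^n\bigl|-\langle x_ix_i^\top,K\rangle+2y_i\langle x_i,g\rangle-y_i^2\bigr|\le\eta ,$$ where $\|\cdot\|_*$ is the nuclear norm. Let $\hat\lambda$ be the largest eigenvalue of $\hat J=\hat g\hat g^\top-\hat K$, let $\hat v$ be any unit eigenvector for $\hat\lambda$, and output $\hat\theta=(\hat\beta_1,\hat\beta_2)$ with $\hat\beta_{1},\hat\beta_2=\hat g\pm\sqrt{\hat\lambda}\,\hat v$ (where $\sqrt{\hat\lambda}$ is read as $0$ if $\hat\lambda<0$). *Claim.* For all $\mu>1$, $L$ and $\kappa$ there are constants $c_1,\dots,c_5>0$, depending only on $\mu,L,\kappa$, and for every $C$ there is a constant $c_6>0$, depending only on $\mu,L,\kappa,C$, such that the following holds for all $n$, $p$, $\beta_1^*,\beta_2^*$, all partitions and all distributions of the $x_i$ as above. Suppose that $n_1\le\kappa n_2$ and $n_2\le\kappa n_1$, that $\alpha>0$, and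 that $\min\{n_1,n_2\}\ge c_3\,p/\alpha$. Then with probability at least $1-c_1e^{-c_2n}$ over $x_1,\dots,x_n$, simultaneously for all $e\in\mathbb{R}^n$ and all $\eta$ with $$c_4\sqrt n\,\|e\|_2\|\beta_2^*-\beta_1^*\|_2\le\eta\le C\sqrt n\,\|e\|_2\|\beta_2^*-\beta_1^*\|_2,\qquad \|e\|_2\le\frac{\sqrt\alpha}{c_5}\sqrt n\,(\|\beta_1^*\|_2+\|\beta_2^*\|_2),$$ the method has an output, and every output $\hat\theta$ satisfies, with $\theta^*=(\beta_1^*,\beta_2^*)$, $$\rho(\hat\theta,\theta^*)\le\frac{c_6}{\sqrt\alpha}\,\frac{\|e\|_2}{\sqrt n}.$$ -/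

import Mathlib

open MeasureTheory ProbabilityTheory
open scoped ENNReal

noncomputable section

namespace MixedRegression

/-- The sub-Gaussian norm `sup_{q ≥ 1} q^{-1/2} (E|X|^q)^{1/q}`, with values in `[0, ∞]`. -/
def subGaussianNorm {Ω : Type*} [MeasurableSpace Ω] (P : Measure Ω) (X : Ω → ℝ) : ℝ≥0∞ :=
  ⨆ (q : ℝ) (_ : 1 ≤ q), eLpNorm X (ENNReal.ofReal q) P / ENNReal.ofReal (√q)

/-- The random covariates `x 0, …, x (n-1)` in `ℝ^p` have i.i.d. entries (over all samples and all
coordinates) with mean `0`, variance `1`, fourth moment `μ` and sub-Gaussian norm at most `L`. -/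
structure IsDesign {Ω : Type*} [MeasurableSpace Ω] (P : Measure Ω) (μ L : ℝ) {n p : ℕ}
    (x : Fin n → Ω → EuclideanSpace ℝ (Fin p)) : Prop where
  measurable : ∀ i, Measurable (x i)
  indep : iIndepFun (fun (k : Fin n × Fin p) (ω : Ω) => x k.1 ω k.2) P
  identDistrib : ∀ k k' : Fin n × Fin p,
    IdentDistrib (fun ω => x k.1 ω k.2) (fun ω => x k'.1 ω k'.2) P P
  mean : ∀ i l, ∫ ω, x i ω l ∂P = 0
  variance : ∀ i l, ∫ ω, (x i ω l) ^ 2 ∂P = 1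
  fourth : ∀ i l, ∫ ω, (x i ω l) ^ 4 ∂P = μ
  subGaussian : ∀ i l, subGaussianNorm P (fun ω => x i ω l) ≤ ENNReal.ofReal L

/-- The number of samples with label `b`. -/
def classSize {n : ℕ} (z : Fin n → Fin 2) (b : Fin 2) : ℕ :=
  (Finset.univ.filter fun i => z i = b).card

/-- The responses `y_i = ⟨x_i, β_{z i}⟩ + e_i`. -/
def response {n p : ℕ} (x : Fin n → EuclideanSpace ℝ (Fin p)) (z : Fin n → Fin 2)
    (β : Fin 2 → EuclideanSpace ℝ (Fin p)) (e : EuclideanSpace ℝ (Fin n)) (i : Fin n) : ℝ :=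
  inner ℝ (x i) (β (z i)) + e i

/-- The separation `‖β₁ - β₂‖² / (‖β₁‖² + ‖β₂‖²)` (equal to `0` if `β₁ = β₂ = 0`). -/
def separation {p : ℕ} (β : Fin 2 → EuclideanSpace ℝ (Fin p)) : ℝ :=
  ‖β 0 - β 1‖ ^ 2 / (‖β 0‖ ^ 2 + ‖β 1‖ ^ 2)

/-- The total error of a pair of regressors, up to permutation. -/
def pairDist {p : ℕ} (θ θ' : Fin 2 → EuclideanSpace ℝ (Fin p)) : ℝ :=
  min (‖θ 0 - θ' 0‖ + ‖θ 1 - θ' 1‖) (‖θ 0 - θ' 1‖ + ‖θ 1 - θ' 0‖)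

/-- The nuclear norm: the sum of the singular values. -/
def nuclearNorm {p : ℕ} (K : Matrix (Fin p) (Fin p) ℝ) : ℝ :=
  ∑ i ∈ Finset.range p, (Matrix.toEuclideanLin K).singularValues i

/-- The rank-one matrix `v vᵀ`. -/
def outer {p : ℕ} (v : EuclideanSpace ℝ (Fin p)) : Matrix (Fin p) (Fin p) ℝ :=
  Matrix.of fun i j => v i * v j

/-- The entrywise inner product of matrices. -/
def matInner {p : ℕ} (A B : Matrix (Fin p) (Fin p) ℝ) : ℝ :=
  ∑ i, ∑ j, A i j * B i j

/-- `(K, g)` satisfies `∑ᵢ |-⟨xᵢ xᵢᵀ, K⟩ + 2 yᵢ ⟨xᵢ, g⟩ - yᵢ²| ≤ η`. -/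
def IsFeasible {n p : ℕ} (x : Fin n → EuclideanSpace ℝ (Fin p)) (y : Fin n → ℝ) (η : ℝ)
    (K : Matrix (Fin p) (Fin p) ℝ) (g : EuclideanSpace ℝ (Fin p)) : Prop :=
  ∑ i, |-matInner (outer (x i)) K + 2 * y i * inner ℝ (x i) g - y i ^ 2| ≤ η

/-- `(K, g)` minimizes the nuclear norm of `K` over all feasible pairs in `ℝ^{p×p} × ℝ^p`. -/
def IsOptimal {n p : ℕ} (x : Fin n → EuclideanSpace ℝ (Fin p)) (y : Fin n → ℝ) (η : ℝ)
    (K : Matrix (Fin p) (Fin p) ℝ) (g : EuclideanSpace ℝ (Fin p)) : Prop :=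
  IsFeasible x y η K g ∧ ∀ K' g', IsFeasible x y η K' g' → nuclearNorm K ≤ nuclearNorm K'

/-- `lam` is the largest eigenvalue of `J`, and `v` a unit eigenvector for it. -/
def IsFirstEigenpair {p : ℕ} (J : Matrix (Fin p) (Fin p) ℝ) (lam : ℝ)
    (v : EuclideanSpace ℝ (Fin p)) : Prop :=
  ‖v‖ = 1 ∧ Module.End.HasEigenvector (Matrix.toEuclideanLin J) lam v ∧
    ∀ lam', Module.End.HasEigenvalue (Matrix.toEuclideanLin J) lam' → lam' ≤ lam

/-- `θ` is an output of the spectral procedure on `(K, g)`: for some first eigenpair `(lam, v)` of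
`J = g gᵀ - K`, it is the pair `g ± √lam v`. Here `√lam = 0` if `lam < 0`. -/
def IsSpectralOutput {p : ℕ} (K : Matrix (Fin p) (Fin p) ℝ) (g : EuclideanSpace ℝ (Fin p))
    (θ : Fin 2 → EuclideanSpace ℝ (Fin p)) : Prop :=
  ∃ (lam : ℝ) (v : EuclideanSpace ℝ (Fin p)), IsFirstEigenpair (outer g - K) lam v ∧
    θ 0 = g + √lam • v ∧ θ 1 = g - √lam • v

/-- `θ` is an output of the whole method on the data `(x, y)` with parameter `η`: an output of the
spectral procedure on some optimal solution `(K, g)` of the program with `K` symmetric. -/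
def IsEstimate {n p : ℕ} (x : Fin n → EuclideanSpace ℝ (Fin p)) (y : Fin n → ℝ) (η : ℝ)
    (θ : Fin 2 → EuclideanSpace ℝ (Fin p)) : Prop :=
  ∃ (K : Matrix (Fin p) (Fin p) ℝ) (g : EuclideanSpace ℝ (Fin p)),
    IsOptimal x y η K g ∧ K.IsSymm ∧ IsSpectralOutput K g θ

end MixedRegression

end

open MixedRegression

/-! Lifting. Write `K*` for `symmProd β`, `g*` for `midpt β`, `Δ = ‖β₁ - β₂‖`, `d = (β₁ - β₂)/2`.
Without noise the residual at `(K*, g*)` of a sample with response `y` is `-(y - ⟨x,β₁⟩)(y - ⟨x,β₂⟩)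
= 0`, so the mixture turns into equations linear in `(K, g)`; and `g* g*ᵀ - K* = d dᵀ`, so a first
eigenpair recovers `±d`, hence both regressors up to order. A displacement `(H, h)` of the truth
adds `⟨x xᵀ, Z_b⟩` to the noiseless residual on class `b`, where `Z_b = β_b hᵀ + h β_bᵀ - H`
(`residual_eq`). The quantity to bound is `S = ‖Z_1‖_F + ‖Z_2‖_F`, since `Δ‖h‖ ≤ S` and `√α ‖H‖_F ≤
4 S`.

Deterministic part. By Cauchy-Schwarz the noise contributes at most a multiple of `√n ‖e‖ Δ` at the
truth, so the truth is feasible and an optimal `K` has nuclear norm at most that of `K*`. As `K*`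
lives on the span of `β₁, β₂`, the usual cone argument controls the part of `H` orthogonal to that
span and gives `√α ‖Z_b‖_* ≤ 17 S` (`nuclearNorm_residualForm_le`). The probabilistic input is the
lower bound `∑_{i ∈ class b} |⟨x_i x_iᵀ, Z⟩| ≥ c n_b (‖Z‖_F - ‖Z‖_* / (τ √(n_b/p)))` for all
symmetric `Z`. The sample size `n_b ≥ c₃ p/α` makes the nuclear norm negligible, so `n S` is at most
a multiple of `η + √n ‖e‖ ‖h‖`; the last term is absorbed through `Δ‖h‖ ≤ S` and the bound on `‖e‖`
(`residualSize_le`). Then `S` is of order `Δ‖e‖/√n`, and perturbation of the eigenpair of `d dᵀ`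
(`exists_sign_norm_sub_le`) finishes (`pairDist_le`).

Probabilistic part. The lower bound is a small-ball argument. A comparison of fourth and second
moments of quadratic forms (`moments_quadratic_form`), which needs `μ > 1`, bounds `E min(|⟨x xᵀ,
Z⟩|, A)` below. The uniform deviation of the truncated sums is handled by symmetrization,
contraction and an exponential moment bound (`measure_exists_sum_le`). The resulting Rademacher
process is at most the nuclear norm times the operator norm of `∑ ε_i x_i x_iᵀ`, which is estimated
on a net of at most `25^p` points (`iterate_avgSignShift_le`). This is done for finite families of
`Z`, with a bound independent of their size, and extended by a fine Frobenius net. -/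

namespace MixedRegression

/-! ### Symmetrization, contraction and concentration for i.i.d. sums -/

section SupLike

variable {𝒳 : Type*} [MeasurableSpace 𝒳] {κ : Type*} [Fintype κ]

/-- Functionals on `ℝ^κ` that share with `a ↦ maxₖ aₖ` the properties which make symmetrization
and contraction work. -/
structure IsSupLike (Ψ : (κ → ℝ) → ℝ) : Prop where
  convex : ConvexOn ℝ Set.univ Ψ
  lipschitz : ∀ a b, |Ψ a - Ψ b| ≤ ‖a - b‖
  contraction : ∀ a s t : κ → ℝ, (∀ k l, |s k - s l| ≤ |t k - t l|) →
    Ψ (a + s) + Ψ (a - s) ≤ Ψ (a + t) + Ψ (a - t)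

/-- The average of `Ψ` over the random shift `g x`, `x ∼ ν`. -/
noncomputable def avgShift (ν : Measure 𝒳) (g : 𝒳 → κ → ℝ) (Ψ : (κ → ℝ) → ℝ) (a : κ → ℝ) : ℝ :=
  ∫ x, Ψ (a + g x) ∂ν

/-- The average of `Ψ` over the random shift `±g x`, `x ∼ ν`, with an independent fair sign. -/
noncomputable def avgSignShift (ν : Measure 𝒳) (g : 𝒳 → κ → ℝ) (Ψ : (κ → ℝ) → ℝ)
    (a : κ → ℝ) : ℝ :=
  (avgShift ν g Ψ a + avgShift ν (-g) Ψ a) / 2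

/-- For the contraction property, let the two maxima on the left be attained at `k` and `l`. Their
sum is `a k + a l + (s k - s l)`, at most `a k + a l + |t k - t l|`, and according to the sign of `t
k - t l` this is a value of `a + t` at one of the two indices plus a value of `a - t` at the other.
-/
theorem isSupLike_iSup [Nonempty κ] : IsSupLike (fun a : κ → ℝ => ⨆ k, a k) := by
  have hb : ∀ a : κ → ℝ, BddAbove (Set.range a) := fun a => Set.Finite.bddAbove (Set.finite_range a)
  have hatt : ∀ a : κ → ℝ, ∃ k, a k = ⨆ k, a k := fun a => exists_eq_ciSup_of_finite
  have hlip : ∀ a b : κ → ℝ, (⨆ k, a k) - (⨆ k, b k) ≤ ‖a - b‖ := by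
    intro a b
    obtain ⟨k, hk⟩ := hatt a
    have h1 := le_ciSup (hb b) k
    have h2 := norm_le_pi_norm (a - b) k
    have h3 := le_abs_self (a k - b k)
    simp only [Pi.sub_apply, Real.norm_eq_abs] at h2
    linarith
  refine ⟨⟨convex_univ, ?_⟩, ?_, ?_⟩
  · intro a _ b _ r s hr hs _
    refine ciSup_le fun k => ?_
    simp only [Pi.add_apply, Pi.smul_apply, smul_eq_mul]
    exact add_le_add (mul_le_mul_of_nonneg_left (le_ciSup (hb a) k) hr)
      (mul_le_mul_of_nonneg_left (le_ciSup (hb b) k) hs)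
  · intro a b
    refine abs_sub_le_iff.2 ⟨hlip a b, ?_⟩
    rw [norm_sub_rev]
    exact hlip b a
  · intro a s t h
    obtain ⟨k, hk⟩ := hatt (a + s)
    obtain ⟨l, hl⟩ := hatt (a - s)
    have hsum : (⨆ j, (a + s) j) + (⨆ j, (a - s) j) = a k + s k + (a l - s l) := by
      rw [← hk, ← hl]; rfl
    refine hsum.trans_le ?_
    have h1 := le_ciSup (hb (a + t)) k
    have h2 := le_ciSup (hb (a - t)) k
    have h3 := le_ciSup (hb (a + t)) l
    have h4 := le_ciSup (hb (a - t)) l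
    rw [Pi.add_apply] at h1 h3
    rw [Pi.sub_apply] at h2 h4
    have h5 := (le_abs_self _).trans (h k l)
    rcases abs_cases (t k - t l) with h6 | h6 <;> linarith [h6.1]

namespace IsSupLike

variable {ν : Measure 𝒳} [IsProbabilityMeasure ν] {Ψ : (κ → ℝ) → ℝ}

theorem continuous (h : IsSupLike Ψ) : Continuous Ψ := by
  have : LipschitzWith 1 Ψ := LipschitzWith.of_dist_le_mul fun a b => by
    simpa [Real.dist_eq, dist_eq_norm] using h.lipschitz a b
  exact this.continuous

theorem integrable (h : IsSupLike Ψ) {g : 𝒳 → κ → ℝ} (hg : Integrable g ν) (a : κ → ℝ) :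
    Integrable (fun x => Ψ (a + g x)) ν := by
  refine Integrable.mono' ((integrable_const |Ψ a|).add hg.norm)
    (h.continuous.comp_aestronglyMeasurable (aestronglyMeasurable_const.add hg.1)) ?_
  refine Filter.Eventually.of_forall fun x => ?_
  have := h.lipschitz (a + g x) a
  rw [add_sub_cancel_left] at this
  have h2 := abs_sub_abs_le_abs_sub (Ψ (a + g x)) (Ψ a)
  simp only [Real.norm_eq_abs, Pi.add_apply]
  linarith

/-- Closure under averaging allows the variables to be treated one at a time: once some of them are
integrated out, what remains is again such a functional. -/
theorem avgShift (h : IsSupLike Ψ) {g : 𝒳 → κ → ℝ} (hg : Integrable g ν) :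
    IsSupLike (avgShift ν g Ψ) := by
  refine ⟨⟨convex_univ, ?_⟩, ?_, ?_⟩
  · intro a _ b _ r s hr hs hrs
    simp only [MixedRegression.avgShift, smul_eq_mul]
    rw [← integral_const_mul, ← integral_const_mul,
      ← integral_add ((h.integrable hg a).const_mul r) ((h.integrable hg b).const_mul s)]
    refine integral_mono (h.integrable hg _)
      (((h.integrable hg a).const_mul r).add ((h.integrable hg b).const_mul s)) fun x => ?_
    have := h.convex.2 (Set.mem_univ (a + g x)) (Set.mem_univ (b + g x)) hr hs hrs
    have e : r • (a + g x) + s • (b + g x) = r • a + s • b + g x := by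
      have : r • g x + s • g x = g x := by rw [← add_smul, hrs, one_smul]
      rw [smul_add, smul_add, add_add_add_comm, this]
    rw [e] at this
    simpa using this
  · intro a b
    simp only [MixedRegression.avgShift]
    rw [← integral_sub (h.integrable hg a) (h.integrable hg b)]
    refine (abs_integral_le_integral_abs).trans ?_
    have : ∀ x, |Ψ (a + g x) - Ψ (b + g x)| ≤ ‖a - b‖ := fun x => by
      simpa using h.lipschitz (a + g x) (b + g x)
    refine (integral_mono ((h.integrable hg a).sub (h.integrable hg b)).abs
      (integrable_const _) this).trans ?_
    simp
  · intro a s t hst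
    simp only [MixedRegression.avgShift]
    rw [← integral_add (h.integrable hg _) (h.integrable hg _),
      ← integral_add (h.integrable hg _) (h.integrable hg _)]
    refine integral_mono ((h.integrable hg _).add (h.integrable hg _))
      ((h.integrable hg _).add (h.integrable hg _)) fun x => ?_
    have := h.contraction (a + g x) s t hst
    simp only [add_right_comm a _ (g x), sub_add_eq_add_sub]
    exact this

theorem avgSignShift (h : IsSupLike Ψ) {g : 𝒳 → κ → ℝ} (hg : Integrable g ν) :
    IsSupLike (avgSignShift ν g Ψ) := by
  have h1 := h.avgShift hg
  have h2 := h.avgShift hg.neg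
  refine ⟨⟨convex_univ, ?_⟩, ?_, ?_⟩
  · intro a _ b _ r s hr hs hrs
    have e1 := h1.convex.2 (Set.mem_univ a) (Set.mem_univ b) hr hs hrs
    have e2 := h2.convex.2 (Set.mem_univ a) (Set.mem_univ b) hr hs hrs
    simp only [MixedRegression.avgSignShift, smul_eq_mul] at *
    linarith
  · intro a b
    have e1 := h1.lipschitz a b
    have e2 := h2.lipschitz a b
    simp only [MixedRegression.avgSignShift]
    rw [abs_le] at *
    constructor <;> linarith [e1.1, e1.2, e2.1, e2.2]
  · intro a s t hst
    have e1 := h1.contraction a s t hst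
    have e2 := h2.contraction a s t hst
    simp only [MixedRegression.avgSignShift]
    linarith

/-- One step of symmetrization and contraction. -/
theorem avgShift_le_avgSignShift (h : IsSupLike Ψ) {f u : 𝒳 → κ → ℝ} (hf : Integrable f ν)
    (hu : Integrable u ν) (hfu : ∀ x k l, |u x k - u x l| ≤ |f x k - f x l|) (a : κ → ℝ) :
    MixedRegression.avgShift ν (fun x => (∫ y, u y ∂ν) - u x) Ψ a ≤
      MixedRegression.avgSignShift ν (fun x => (2 : ℝ) • f x) Ψ a := by
  have hc : Continuous fun s : κ → ℝ => a + (2 : ℝ) • s := by fun_prop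
  have hf2 : Integrable (fun x => (2 : ℝ) • f x) ν := hf.smul (2 : ℝ)
  have hu2 : Integrable (fun x => (2 : ℝ) • u x) ν := hu.smul (2 : ℝ)
  set m := ∫ y, u y ∂ν
  have hm : Ψ (a + (2 : ℝ) • m) ≤ ∫ x, Ψ (a + (2 : ℝ) • u x) ∂ν := by
    have hconv : ConvexOn ℝ Set.univ (fun s : κ → ℝ => Ψ (a + (2 : ℝ) • s)) := by
      refine ⟨convex_univ, fun x _ y _ r s hr hs hrs => ?_⟩
      have := h.convex.2 (Set.mem_univ (a + (2 : ℝ) • x)) (Set.mem_univ (a + (2 : ℝ) • y)) hr hs hrs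
      convert this using 2
      have : r • a + s • a = a := by rw [← add_smul, hrs, one_smul]
      rw [smul_add r a, smul_add s a, add_add_add_comm, this, smul_add, smul_comm r, smul_comm s]
    exact hconv.map_integral_le (h.continuous.comp hc).continuousOn isClosed_univ
      (Filter.Eventually.of_forall fun _ => Set.mem_univ _) hu (h.integrable hu2 a)
  -- The point `a + (m - u x)` is the midpoint of `a + 2m` and `a - 2u x`. Convexity here and
  -- Jensen's inequality for `m` replace the usual independent copy, at the price of the factor `2`.
  have hpt : ∀ x, Ψ (a + (m - u x)) ≤
      (∫ x, Ψ (a + (2 : ℝ) • u x) ∂ν) / 2 + Ψ (a + -((2 : ℝ) • u x)) / 2 := by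
    intro x
    have := h.convex.2 (Set.mem_univ (a + (2 : ℝ) • m)) (Set.mem_univ (a + -((2 : ℝ) • u x)))
      (by norm_num : (0 : ℝ) ≤ 1 / 2) (by norm_num : (0 : ℝ) ≤ 1 / 2) (by norm_num)
    have e : (1 / 2 : ℝ) • (a + (2 : ℝ) • m) + (1 / 2 : ℝ) • (a + -((2 : ℝ) • u x)) =
        a + (m - u x) := by
      ext k
      simp only [Pi.add_apply, Pi.smul_apply, Pi.neg_apply, Pi.sub_apply, smul_eq_mul]
      ring
    rw [e] at this
    simp only [smul_eq_mul] at this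
    linarith
  have hgi : Integrable (fun x => m - u x) ν := (integrable_const m).sub hu
  have hu2' : Integrable (fun x => -((2 : ℝ) • u x)) ν := hu2.neg
  have hf2' : Integrable (fun x => -((2 : ℝ) • f x)) ν := hf2.neg
  calc MixedRegression.avgShift ν (fun x => m - u x) Ψ a
      ≤ ∫ x, ((∫ x, Ψ (a + (2 : ℝ) • u x) ∂ν) / 2 + Ψ (a + -((2 : ℝ) • u x)) / 2) ∂ν :=
        integral_mono (h.integrable hgi a)
          ((integrable_const _).add ((h.integrable hu2' a).div_const 2)) hpt
    _ = (∫ x, Ψ (a + (2 : ℝ) • u x) + Ψ (a + -((2 : ℝ) • u x)) ∂ν) / 2 := by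
        rw [integral_add (integrable_const _) ((h.integrable hu2' a).div_const 2),
          integral_add (h.integrable hu2 a) (h.integrable hu2' a), integral_const,
          integral_div, probReal_univ, one_smul, add_div]
    _ ≤ (∫ x, Ψ (a + (2 : ℝ) • f x) + Ψ (a + -((2 : ℝ) • f x)) ∂ν) / 2 := by
        refine div_le_div_of_nonneg_right ?_ (by norm_num)
        refine integral_mono ((h.integrable hu2 a).add (h.integrable hu2' a))
          ((h.integrable hf2 a).add (h.integrable hf2' a)) fun x => ?_
        simp only [← sub_eq_add_neg]
        refine h.contraction a _ _ fun k l => ?_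
        have := hfu x k l
        simp only [Pi.smul_apply, smul_eq_mul, ← mul_sub, abs_mul]
        gcongr
    _ = _ := by
        rw [integral_add (h.integrable hf2 a) (h.integrable hf2' a)]
        rfl

theorem iterate_avgShift (h : IsSupLike Ψ) {g : 𝒳 → κ → ℝ} (hg : Integrable g ν) (N : ℕ) :
    IsSupLike ((MixedRegression.avgShift ν g)^[N] Ψ) := by
  induction N with
  | zero => exact h
  | succ N ih =>
    rw [Function.iterate_succ_apply']
    exact ih.avgShift hg

theorem iterate_avgSignShift (h : IsSupLike Ψ) {g : 𝒳 → κ → ℝ} (hg : Integrable g ν) (N : ℕ) :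
    IsSupLike ((MixedRegression.avgSignShift ν g)^[N] Ψ) := by
  induction N with
  | zero => exact h
  | succ N ih =>
    rw [Function.iterate_succ_apply']
    exact ih.avgSignShift hg

/-- The outermost variable is symmetrized against the functional obtained by averaging over the
other variables; the induction hypothesis then applies under the integral, averages being monotone.
-/
theorem iterate_avgShift_le (h : IsSupLike Ψ) {f u : 𝒳 → κ → ℝ} (hf : Integrable f ν)
    (hu : Integrable u ν) (hfu : ∀ x k l, |u x k - u x l| ≤ |f x k - f x l|) (N : ℕ) (a : κ → ℝ) :
    (MixedRegression.avgShift ν (fun x => (∫ y, u y ∂ν) - u x))^[N] Ψ a ≤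
      (MixedRegression.avgSignShift ν (fun x => (2 : ℝ) • f x))^[N] Ψ a := by
  have hf2 : Integrable (fun x => (2 : ℝ) • f x) ν := hf.smul (2 : ℝ)
  have hf2' : Integrable (-fun x => (2 : ℝ) • f x) ν := hf2.neg
  have hgi : Integrable (fun x => (∫ y, u y ∂ν) - u x) ν := (integrable_const _).sub hu
  induction N generalizing a with
  | zero => exact le_rfl
  | succ N ih =>
    rw [Function.iterate_succ_apply', Function.iterate_succ_apply']
    have h1 := h.iterate_avgShift hgi N
    have h2 := h.iterate_avgSignShift hf2 N
    refine (h1.avgShift_le_avgSignShift hf hu hfu a).trans ?_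
    unfold MixedRegression.avgSignShift
    refine div_le_div_of_nonneg_right (add_le_add ?_ ?_) (by norm_num)
    · exact integral_mono (h1.integrable hf2 a) (h2.integrable hf2 a) fun x => ih _
    · exact integral_mono (h1.integrable hf2' a) (h2.integrable hf2' a) fun x => ih _

/-- Hoeffding's lemma for the shift `g x`. -/
theorem lintegral_exp_le (h : IsSupLike Ψ) {g : 𝒳 → κ → ℝ} (hg : Measurable g) {A : ℝ}
    (hA : ∀ x, ‖g x‖ ≤ A) (r : ℝ) (a : κ → ℝ) :
    ∫⁻ x, ENNReal.ofReal (Real.exp (r * Ψ (a + g x))) ∂ν ≤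
      ENNReal.ofReal (Real.exp (r * MixedRegression.avgShift ν g Ψ a + A ^ 2 * r ^ 2 / 2)) := by
  have hm : AEMeasurable (fun x => Ψ (a + g x)) ν :=
    (h.continuous.measurable.comp (measurable_const.add hg)).aemeasurable
  have hI : ∀ᵐ x ∂ν, Ψ (a + g x) ∈ Set.Icc (Ψ a - A) (Ψ a + A) := by
    refine Filter.Eventually.of_forall fun x => ?_
    have := h.lipschitz (a + g x) a
    rw [add_sub_cancel_left] at this
    have := abs_le.1 (this.trans (hA x))
    constructor <;> linarith [this.1, this.2]
  have hA0 : 0 ≤ A := by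
    obtain ⟨x⟩ : Nonempty 𝒳 := nonempty_of_isProbabilityMeasure ν
    exact (norm_nonneg _).trans (hA x)
  have hs := hasSubgaussianMGF_of_mem_Icc hm hI
  have h1 := hs.mgf_le r
  have h2 := hs.integrable_exp_mul r
  set I := ∫ x, Ψ (a + g x) ∂ν with hIdef
  have e : ∀ x, Real.exp (r * Ψ (a + g x)) = Real.exp (r * I) * Real.exp (r * (Ψ (a + g x) - I)) := by
    intro x
    rw [← Real.exp_add]
    ring_nf
  have hint : Integrable (fun x => Real.exp (r * Ψ (a + g x))) ν := by
    simp_rw [e]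
    exact h2.const_mul _
  rw [← ofReal_integral_eq_lintegral_ofReal hint (Filter.Eventually.of_forall fun _ => by positivity)]
  refine ENNReal.ofReal_le_ofReal ?_
  simp_rw [e]
  rw [integral_const_mul, Real.exp_add]
  refine mul_le_mul_of_nonneg_left ?_ (by positivity)
  refine h1.trans (le_of_eq ?_)
  congr 1
  have : ‖Ψ a + A - (Ψ a - A)‖ = 2 * A := by
    rw [Real.norm_eq_abs, abs_of_nonneg] <;> linarith
  push_cast
  rw [this]
  ring

end IsSupLike

/-- The average of `F` over the random shift `g x`, `x ∼ ν`, for `[0, ∞]`-valued functions. -/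
noncomputable def lavgShift (ν : Measure 𝒳) (g : 𝒳 → κ → ℝ) (F : (κ → ℝ) → ℝ≥0∞)
    (a : κ → ℝ) : ℝ≥0∞ :=
  ∫⁻ x, F (a + g x) ∂ν

/-- A bounded-differences inequality: each variable, integrated by Hoeffding's lemma, moves the
average inside the exponential at the cost of `A ^ 2 * r ^ 2 / 2` in the exponent. -/
theorem iterate_lavgShift_exp_le {ν : Measure 𝒳} [IsProbabilityMeasure ν] {Ψ : (κ → ℝ) → ℝ}
    (h : IsSupLike Ψ) {g : 𝒳 → κ → ℝ} (hg : Measurable g) {A : ℝ} (hA : ∀ x, ‖g x‖ ≤ A)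
    (r : ℝ) (N : ℕ) (a : κ → ℝ) :
    (lavgShift ν g)^[N] (fun b => ENNReal.ofReal (Real.exp (r * Ψ b))) a ≤
      ENNReal.ofReal (Real.exp (r * (avgShift ν g)^[N] Ψ a + N * (A ^ 2 * r ^ 2 / 2))) := by
  have hgi : Integrable g ν := Integrable.of_bound hg.aestronglyMeasurable A
    (Filter.Eventually.of_forall hA)
  induction N generalizing a with
  | zero => simp
  | succ N ih =>
    rw [Function.iterate_succ_apply', Function.iterate_succ_apply']
    refine (lintegral_mono fun x => ih (a + g x)).trans ?_
    simp_rw [Real.exp_add, ENNReal.ofReal_mul (Real.exp_pos _).le]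
    rw [lintegral_mul_const' _ _ ENNReal.ofReal_ne_top]
    refine (mul_le_mul_left ((h.iterate_avgShift hgi N).lintegral_exp_le hg hA r a) _).trans ?_
    rw [← ENNReal.ofReal_mul (Real.exp_pos _).le, ← ENNReal.ofReal_mul (Real.exp_pos _).le,
      ← Real.exp_add, ← Real.exp_add]
    refine le_of_eq ?_
    congr 2
    push_cast
    ring

/-- Independence enters only here: Fubini's theorem peels off one summand at a time, and from then
on only the common law `ν` matters. -/
theorem lintegral_sum_eq_iterate {κ Ω : Type*} [MeasurableSpace Ω] {P : Measure Ω}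
    {ι : Type*} {X : ι → Ω → 𝒳} (hX : ∀ i, Measurable (X i)) (hind : iIndepFun X P)
    {ν : Measure 𝒳} (hν : ∀ i, P.map (X i) = ν) {g : 𝒳 → κ → ℝ}
    (hg : Measurable g) {F : (κ → ℝ) → ℝ≥0∞} (hF : Measurable F) (S : Finset ι) (a : κ → ℝ) :
    ∫⁻ ω, F (a + ∑ i ∈ S, g (X i ω)) ∂P = (lavgShift ν g)^[S.card] F a := by
  classical
  have := hind.isProbabilityMeasure
  induction S using Finset.induction_on generalizing a with
  | empty => simp
  | insert j S hj ih =>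
    rw [Finset.card_insert_of_notMem hj, Function.iterate_succ_apply']
    have hh : iIndepFun (fun i ω => g (X i ω)) P := hind.comp (fun _ => g) fun _ => hg
    have hhm : ∀ i, Measurable fun ω => g (X i ω) := fun i => hg.comp (hX i)
    have hi := (hh.indepFun_finsetSum_of_notMem hhm hj).symm
    have hSm : Measurable (∑ i ∈ S, fun ω => g (X i ω)) := by
      have := Finset.measurable_sum S fun i (_ : i ∈ S) => hhm i
      convert this using 1
      ext; simp
    have hmap := (indepFun_iff_map_prod_eq_prod_map_map (hhm j).aemeasurable
      hSm.aemeasurable).1 hi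
    have hFm : Measurable fun q : (κ → ℝ) × (κ → ℝ) => F (a + q.1 + q.2) := by fun_prop
    have : IsProbabilityMeasure (P.map (∑ i ∈ S, fun ω => g (X i ω))) :=
      Measure.isProbabilityMeasure_map hSm.aemeasurable
    calc ∫⁻ ω, F (a + ∑ i ∈ insert j S, g (X i ω)) ∂P
        = ∫⁻ ω, (fun q : (κ → ℝ) × (κ → ℝ) => F (a + q.1 + q.2))
            (g (X j ω), (∑ i ∈ S, fun ω => g (X i ω)) ω) ∂P := by
          refine lintegral_congr fun ω => ?_
          simp [Finset.sum_insert hj, add_assoc]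
      _ = ∫⁻ q, F (a + q.1 + q.2) ∂((P.map fun ω => g (X j ω)).prod
            (P.map (∑ i ∈ S, fun ω => g (X i ω)))) := by
          rw [← hmap, lintegral_map hFm ((hhm j).prodMk hSm)]
      _ = ∫⁻ b, ∫⁻ c, F (a + b + c) ∂(P.map (∑ i ∈ S, fun ω => g (X i ω)))
            ∂(P.map fun ω => g (X j ω)) := lintegral_prod _ hFm.aemeasurable
      _ = ∫⁻ b, (lavgShift ν g)^[S.card] F (a + b) ∂(P.map fun ω => g (X j ω)) := by
          refine lintegral_congr fun b => ?_
          rw [lintegral_map (by fun_prop) hSm, ← ih (a + b)]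
          simp
      _ = _ := by
          have hcomp : (P.map fun ω => g (X j ω)) = ν.map g := by
            rw [← hν j, Measure.map_map hg (hX j)]
            rfl
          have hmeas : Measurable fun b => (lavgShift ν g)^[S.card] F (a + b) := by
            simp_rw [← ih]
            exact Measurable.lintegral_prod_right' (f := fun q : (κ → ℝ) × Ω =>
              F (a + q.1 + ∑ i ∈ S, g (X i q.2))) (by fun_prop)
          rw [hcomp, lintegral_map hmeas hg]
          rfl

/-- A uniform lower bound for sums of bounded functions of i.i.d. variables. -/
theorem measure_exists_sum_le [Nonempty κ] {Ω : Type*} [MeasurableSpace Ω] {P : Measure Ω}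
    {ι : Type*} {X : ι → Ω → 𝒳} (hX : ∀ i, Measurable (X i)) (hind : iIndepFun X P)
    {ν : Measure 𝒳} [IsProbabilityMeasure ν] (hν : ∀ i, P.map (X i) = ν)
    {f u : 𝒳 → κ → ℝ} (hf : Integrable f ν) (hu : Measurable u) {A : ℝ} (hA : ∀ x k, |u x k| ≤ A)
    (hfu : ∀ x k l, |u x k - u x l| ≤ |f x k - f x l|) (S : Finset ι) {r t V : ℝ} (hr : 0 ≤ r)
    (hV : (avgSignShift ν (fun x => (2 : ℝ) • f x))^[S.card] (fun a => ⨆ k, a k) 0 ≤ V) :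
    P {ω | ∃ k, ∑ i ∈ S, u (X i ω) k ≤ S.card * (∫ y, u y k ∂ν) - t} ≤
      ENNReal.ofReal (Real.exp (-(r * t) + r * V + S.card * (2 * A ^ 2 * r ^ 2))) := by
  have hA0 : 0 ≤ A := by
    obtain ⟨x⟩ : Nonempty 𝒳 := nonempty_of_isProbabilityMeasure ν
    obtain ⟨k⟩ := ‹Nonempty κ›
    exact (abs_nonneg _).trans (hA x k)
  have hun : ∀ x, ‖u x‖ ≤ A := fun x => (pi_norm_le_iff_of_nonneg hA0).2 fun k => hA x k
  have hui : Integrable u ν := Integrable.of_bound hu.aestronglyMeasurable A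
    (Filter.Eventually.of_forall hun)
  set m := ∫ y, u y ∂ν with hmdef
  have hmk : ∀ k, m k = ∫ y, u y k ∂ν := fun k =>
    ((ContinuousLinearMap.proj (R := ℝ) (φ := fun _ : κ => ℝ) k).integral_comp_comm hui).symm
  have hmn : ‖m‖ ≤ A := by
    refine (norm_integral_le_integral_norm _).trans ?_
    refine (integral_mono hui.norm (integrable_const A) hun).trans ?_
    simp
  have hg : Measurable fun x => m - u x := measurable_const.sub hu
  -- Centring doubles the range, so each variable costs `(2A)² r² / 2 = 2 A² r²` in the exponent.
  have hgA : ∀ x, ‖m - u x‖ ≤ 2 * A := fun x => by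
    linarith [norm_sub_le m (u x), hun x]
  have hsup := isSupLike_iSup (κ := κ)
  have hFm : Measurable fun b : κ → ℝ => ENNReal.ofReal (Real.exp (r * ⨆ k, b k)) := by
    have := hsup.continuous.measurable
    fun_prop
  have h1 := lintegral_sum_eq_iterate hX hind hν hg hFm S 0
  have h2 := iterate_lavgShift_exp_le (ν := ν) hsup hg hgA r S.card 0
  have h3 := (hsup.iterate_avgShift_le hf hui hfu S.card 0).trans hV
  rw [← h1] at h2
  -- If the bound fails for some `k`, the supremum of the centred sums is at least `t`; Markov's
  -- inequality for the exponential of `r` times that supremum then applies.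
  have hsub : {ω | ∃ k, ∑ i ∈ S, u (X i ω) k ≤ S.card * (∫ y, u y k ∂ν) - t} ⊆
      {ω | ENNReal.ofReal (Real.exp (r * t)) ≤
        ENNReal.ofReal (Real.exp (r * ⨆ k, ((0 : κ → ℝ) + ∑ i ∈ S, (m - u (X i ω))) k))} := by
    rintro ω ⟨k, hk⟩
    refine ENNReal.ofReal_le_ofReal (Real.exp_le_exp.2 (mul_le_mul_of_nonneg_left ?_ hr))
    refine le_trans ?_ (le_ciSup (Set.Finite.bddAbove (Set.finite_range _)) k)
    simp only [zero_add, Finset.sum_apply, Pi.sub_apply]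
    rw [Finset.sum_sub_distrib, Finset.sum_const, nsmul_eq_mul, hmk]
    linarith
  refine (measure_mono hsub).trans ?_
  have hmk := meas_ge_le_lintegral_div (μ := P) (f := fun ω => ENNReal.ofReal (Real.exp (r * ⨆ k,
      ((0 : κ → ℝ) + ∑ i ∈ S, (m - u (X i ω))) k)))
    (by
      refine (hFm.comp (measurable_const.add ?_)).aemeasurable
      exact Finset.measurable_fun_sum _ fun i _ => hg.comp (hX i))
    (ε := ENNReal.ofReal (Real.exp (r * t))) (by simp [Real.exp_pos]) ENNReal.ofReal_ne_top
  refine hmk.trans ?_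
  refine (ENNReal.div_le_div_right h2 _).trans ?_
  rw [← ENNReal.ofReal_div_of_pos (Real.exp_pos _), ← Real.exp_sub]
  refine ENNReal.ofReal_le_ofReal (Real.exp_le_exp.2 ?_)
  have := mul_le_mul_of_nonneg_left h3 hr
  linarith

end SupLike

end MixedRegression

/-! ### Rademacher processes and logarithmic moment generating functions -/

namespace MixedRegression

/-- The tangent to the logarithm at `z`. It makes the bound linear in `y`, so that it can be
averaged. -/
theorem log_le_log_add_div_sub_one {y z : ℝ} (hy : 0 < y) (hz : 0 < z) :
    Real.log y ≤ Real.log z + y / z - 1 := by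
  have := Real.log_le_sub_one_of_pos (div_pos hy hz)
  rw [Real.log_div hy.ne' hz.ne'] at this
  linarith

theorem cosh_add_add_cosh_sub (a b : ℝ) :
    Real.cosh (a + b) + Real.cosh (a - b) = 2 * (Real.cosh a * Real.cosh b) := by
  rw [Real.cosh_add, Real.cosh_sub]
  ring

/-- Comparison of a Rademacher process, indexed by `κ` and dominated by the one indexed by `ι`,
with the logarithmic moment generating function of the latter. -/
theorem iterate_avgSignShift_le {𝒳 : Type*} [MeasurableSpace 𝒳] {ν : Measure 𝒳}
    [IsProbabilityMeasure ν] {κ ι : Type*} [Fintype κ] [Nonempty κ] [Fintype ι] [Nonempty ι]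
    {V : Type*} [AddCommGroup V] [Module ℝ V] (D : V →ₗ[ℝ] κ → ℝ) (B : V →ₗ[ℝ] ι → ℝ)
    {q : 𝒳 → V} {c r γ : ℝ} (hc : 0 ≤ c) (hr : 0 < r)
    (hDB : ∀ M k, ∃ u, D M k ≤ c * |B M u|) (hD : Integrable (fun x => D (q x)) ν)
    (hint : ∀ u, Integrable (fun x => Real.cosh (r * B (q x) u)) ν)
    (hcosh : ∀ u, ∫ x, Real.cosh (r * B (q x) u) ∂ν ≤ Real.exp γ) (N : ℕ) (M : V) :
    (avgSignShift ν (fun x => D (q x)))^[N] (fun a => ⨆ k, a k) (D M) ≤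
      c / r * (Real.log (∑ u, 2 * Real.cosh (r * B M u)) + N * γ) := by
  set F : V → ℝ := fun M => ∑ u, 2 * Real.cosh (r * B M u) with hF
  have hFpos : ∀ M, 0 < F M := fun M =>
    Finset.sum_pos (fun u _ => by positivity) Finset.univ_nonempty
  have hcr : 0 ≤ c / r := div_nonneg hc hr.le
  have hsup := isSupLike_iSup (κ := κ)
  induction N generalizing M with
  | zero =>
    simp only [Function.iterate_zero, id_eq, Nat.cast_zero, zero_mul, add_zero]
    refine ciSup_le fun k => ?_
    obtain ⟨u, hu⟩ := hDB M k
    refine hu.trans ?_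
    rw [div_mul_eq_mul_div, mul_div_assoc]
    refine mul_le_mul_of_nonneg_left ?_ hc
    rw [le_div_iff₀ hr, Real.le_log_iff_exp_le (hFpos M)]
    -- The sum of `2 cosh` is a smooth substitute for the maximum of `exp |r * B M u|` over `u`.
    have h1 : Real.exp (|B M u| * r) ≤ 2 * Real.cosh (r * B M u) := by
      have h2 : |B M u| * r = |r * B M u| := by rw [abs_mul, abs_of_pos hr, mul_comm]
      rw [h2, ← Real.cosh_abs (r * B M u), Real.cosh_eq]
      have := Real.exp_pos (-|r * B M u|)
      linarith
    exact h1.trans (Finset.single_le_sum (f := fun u => 2 * Real.cosh (r * B M u))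
      (fun u _ => by positivity) (Finset.mem_univ u))
  | succ N ih =>
    rw [Function.iterate_succ_apply']
    have hs := hsup.iterate_avgSignShift hD N
    set Ψ := (avgSignShift ν (fun x => D (q x)))^[N] (fun a => ⨆ k, a k) with hΨ
    -- The point at which the tangent to the logarithm is taken. By the addition formula for `cosh`,
    -- `F (M + q x) + F (M - q x)` has mean at most `2 * y`, so the averaged tangent returns exactly
    -- `log y = log (F M) + γ`.
    set y := F M * Real.exp γ with hy
    have hypos : 0 < y := mul_pos (hFpos M) (Real.exp_pos γ)
    have hD' : Integrable (fun x => -D (q x)) ν := hD.neg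
    have hpt : ∀ x, Ψ (D M + D (q x)) + Ψ (D M + -D (q x)) ≤
        c / r * (2 * (Real.log y + N * γ - 1) +
          (∑ u, 4 * Real.cosh (r * B M u) * Real.cosh (r * B (q x) u)) / y) := by
      intro x
      have h1 := ih (M + q x)
      have h2 := ih (M - q x)
      rw [map_add] at h1
      rw [map_sub, sub_eq_add_neg] at h2
      have h3 := mul_le_mul_of_nonneg_left
        (log_le_log_add_div_sub_one (hFpos (M + q x)) hypos) hcr
      have h4 := mul_le_mul_of_nonneg_left
        (log_le_log_add_div_sub_one (hFpos (M - q x)) hypos) hcr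
      have h5 : F (M + q x) + F (M - q x) =
          ∑ u, 4 * Real.cosh (r * B M u) * Real.cosh (r * B (q x) u) := by
        simp only [hF, ← Finset.sum_add_distrib]
        refine Finset.sum_congr rfl fun u _ => ?_
        have := cosh_add_add_cosh_sub (r * B M u) (r * B (q x) u)
        simp only [map_add, map_sub, Pi.add_apply, Pi.sub_apply, mul_add, mul_sub]
        linarith
      rw [← h5]
      have h6 : c / r * (2 * (Real.log y + N * γ - 1) + (F (M + q x) + F (M - q x)) / y) =
        c / r * (Real.log y + F (M + q x) / y - 1) + c / r * (Real.log y + F (M - q x) / y - 1) +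
          2 * (c / r * (N * γ)) := by ring
      rw [h6]
      have h7 : ∀ z : ℝ, c / r * (z + N * γ) = c / r * z + c / r * (N * γ) := fun z => mul_add _ _ _
      rw [h7] at h1 h2
      linarith
    have hgi : ∀ u, Integrable
        (fun x => 4 * Real.cosh (r * B M u) * Real.cosh (r * B (q x) u)) ν :=
      fun u => (hint u).const_mul _
    have hsum := integrable_finsetSum Finset.univ fun u _ => hgi u
    have hval : ∫ x, ∑ u, 4 * Real.cosh (r * B M u) * Real.cosh (r * B (q x) u) ∂ν ≤ 2 * y := by
      rw [integral_finsetSum _ fun u _ => hgi u, hy, hF, Finset.sum_mul, Finset.mul_sum]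
      refine Finset.sum_le_sum fun u _ => ?_
      rw [integral_const_mul]
      have := mul_le_mul_of_nonneg_left (hcosh u)
        (by positivity : 0 ≤ 4 * Real.cosh (r * B M u))
      linarith
    calc avgSignShift ν (fun x => D (q x)) Ψ (D M)
        = (∫ x, (Ψ (D M + D (q x)) + Ψ (D M + -D (q x))) ∂ν) / 2 := by
          rw [integral_add (hs.integrable hD _) (hs.integrable hD' _)]
          rfl
      _ ≤ (∫ x, c / r * (2 * (Real.log y + N * γ - 1) +
          (∑ u, 4 * Real.cosh (r * B M u) * Real.cosh (r * B (q x) u)) / y) ∂ν) / 2 := by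
          refine div_le_div_of_nonneg_right (integral_mono
            ((hs.integrable hD _).add (hs.integrable hD' _))
            (((integrable_const _).add (hsum.div_const y)).const_mul _) hpt) (by norm_num)
      _ = c / r * (Real.log y + N * γ - 1 +
          (∫ x, ∑ u, 4 * Real.cosh (r * B M u) * Real.cosh (r * B (q x) u) ∂ν) / y / 2) := by
          rw [integral_const_mul, integral_add (integrable_const _) (hsum.div_const y),
            integral_const, integral_div, probReal_univ, one_smul]
          ring
      _ ≤ c / r * (Real.log y + N * γ - 1 + 1) := by
          refine mul_le_mul_of_nonneg_left (add_le_add le_rfl ?_) hcr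
          rw [div_div, div_le_one (by positivity)]
          linarith
      _ = _ := by
          rw [hy, Real.log_mul (hFpos M).ne' (Real.exp_pos γ).ne', Real.log_exp]
          push_cast
          ring

end MixedRegression

namespace MixedRegression

/-! ### Frobenius and nuclear norms, and their duality with contractions -/

section LinearAlgebra

variable {p : ℕ}

theorem matInner_eq_trace (A B : Matrix (Fin p) (Fin p) ℝ) : matInner A B = (A.transpose * B).trace := by
  simp only [matInner, Matrix.trace, Matrix.diag_apply, Matrix.mul_apply, Matrix.transpose_apply]
  exact Finset.sum_comm

theorem matInner_comm (A B : Matrix (Fin p) (Fin p) ℝ) : matInner A B = matInner B A := by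
  simp only [matInner, mul_comm]

theorem matInner_add_right (A B C : Matrix (Fin p) (Fin p) ℝ) :
    matInner A (B + C) = matInner A B + matInner A C := by
  simp only [matInner, Matrix.add_apply, mul_add, Finset.sum_add_distrib]

theorem matInner_smul_right (A B : Matrix (Fin p) (Fin p) ℝ) (c : ℝ) :
    matInner A (c • B) = c * matInner A B := by
  simp only [matInner, Matrix.smul_apply, smul_eq_mul, Finset.mul_sum, mul_left_comm]

theorem matInner_neg_right (A B : Matrix (Fin p) (Fin p) ℝ) :
    matInner A (-B) = -matInner A B := by
  simpa using matInner_smul_right A B (-1)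

theorem matInner_sub_right (A B C : Matrix (Fin p) (Fin p) ℝ) :
    matInner A (B - C) = matInner A B - matInner A C := by
  rw [sub_eq_add_neg, matInner_add_right, matInner_neg_right, sub_eq_add_neg]

theorem matInner_add_left (A B C : Matrix (Fin p) (Fin p) ℝ) :
    matInner (A + B) C = matInner A C + matInner B C := by
  simp only [matInner_comm _ C, matInner_add_right]

theorem matInner_smul_left (A B : Matrix (Fin p) (Fin p) ℝ) (c : ℝ) :
    matInner (c • A) B = c * matInner A B := by
  rw [matInner_comm, matInner_smul_right, matInner_comm]

theorem matInner_transpose (A B : Matrix (Fin p) (Fin p) ℝ) :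
    matInner A.transpose B = matInner A B.transpose := by
  simp only [matInner, Matrix.transpose_apply]
  exact Finset.sum_comm

theorem matInner_mul_left (W A B : Matrix (Fin p) (Fin p) ℝ) :
    matInner (W * A) B = matInner A (W.transpose * B) := by
  rw [matInner_eq_trace, matInner_eq_trace, Matrix.transpose_mul, Matrix.mul_assoc]

theorem matInner_mul_right (A W B : Matrix (Fin p) (Fin p) ℝ) :
    matInner (A * W) B = matInner A (B * W.transpose) := by
  rw [matInner_eq_trace, matInner_eq_trace, Matrix.transpose_mul, Matrix.trace_mul_cycle,
    Matrix.trace_mul_cycle, Matrix.mul_assoc, Matrix.trace_mul_comm, Matrix.mul_assoc,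
    Matrix.trace_mul_comm, Matrix.mul_assoc]

/-- A matrix as a vector of the Euclidean space of its entries. -/
def matVec (A : Matrix (Fin p) (Fin p) ℝ) : EuclideanSpace ℝ (Fin p × Fin p) :=
  WithLp.toLp 2 fun k => A k.1 k.2

/-- The Frobenius norm. -/
noncomputable def frobNorm (A : Matrix (Fin p) (Fin p) ℝ) : ℝ := ‖matVec A‖

theorem inner_matVec (A B : Matrix (Fin p) (Fin p) ℝ) :
    inner ℝ (matVec A) (matVec B) = matInner A B := by
  simp only [matVec, PiLp.inner_apply, matInner, RCLike.inner_apply, conj_trivial,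
    Fintype.sum_prod_type, mul_comm]

theorem frobNorm_sq (A : Matrix (Fin p) (Fin p) ℝ) : frobNorm A ^ 2 = matInner A A := by
  rw [frobNorm, ← real_inner_self_eq_norm_sq, inner_matVec]

theorem frobNorm_nonneg (A : Matrix (Fin p) (Fin p) ℝ) : 0 ≤ frobNorm A := norm_nonneg _

theorem matInner_le (A B : Matrix (Fin p) (Fin p) ℝ) :
    matInner A B ≤ frobNorm A * frobNorm B := by
  rw [← inner_matVec]
  exact real_inner_le_norm _ _

theorem abs_matInner_le (A B : Matrix (Fin p) (Fin p) ℝ) :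
    |matInner A B| ≤ frobNorm A * frobNorm B := by
  rw [← inner_matVec]
  exact abs_real_inner_le_norm _ _

theorem frobNorm_add_le (A B : Matrix (Fin p) (Fin p) ℝ) :
    frobNorm (A + B) ≤ frobNorm A + frobNorm B :=
  norm_add_le (matVec A) (matVec B)

theorem frobNorm_sub_le (A B : Matrix (Fin p) (Fin p) ℝ) :
    frobNorm (A - B) ≤ frobNorm A + frobNorm B :=
  norm_sub_le (matVec A) (matVec B)

theorem frobNorm_smul (c : ℝ) (A : Matrix (Fin p) (Fin p) ℝ) :
    frobNorm (c • A) = |c| * frobNorm A :=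
  norm_smul c (matVec A)

theorem frobNorm_transpose (A : Matrix (Fin p) (Fin p) ℝ) :
    frobNorm A.transpose = frobNorm A := by
  rw [← sq_eq_sq₀ (frobNorm_nonneg _) (frobNorm_nonneg _), frobNorm_sq, frobNorm_sq,
    matInner_transpose, Matrix.transpose_transpose]

/-- The matrix `u vᵀ`. -/
def dyad (u v : EuclideanSpace ℝ (Fin p)) : Matrix (Fin p) (Fin p) ℝ :=
  Matrix.of fun i j => u i * v j

theorem outer_eq_dyad (v : EuclideanSpace ℝ (Fin p)) : outer v = dyad v v := rfl

theorem dyad_transpose (u v : EuclideanSpace ℝ (Fin p)) : (dyad u v).transpose = dyad v u := by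
  ext i j
  simp [dyad, mul_comm]

theorem inner_eq_sum (u v : EuclideanSpace ℝ (Fin p)) : inner ℝ u v = ∑ i, u i * v i := by
  simp [PiLp.inner_apply, mul_comm]

theorem matInner_dyad (u v : EuclideanSpace ℝ (Fin p)) (M : Matrix (Fin p) (Fin p) ℝ) :
    matInner (dyad u v) M = inner ℝ u (Matrix.toEuclideanLin M v) := by
  rw [inner_eq_sum]
  simp only [matInner, dyad, Matrix.of_apply, Matrix.ofLp_toLpLin, Matrix.toLin'_apply, Matrix.mulVec,
    dotProduct, Finset.mul_sum]
  exact Finset.sum_congr rfl fun i _ => Finset.sum_congr rfl fun j _ => by ring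

theorem toEuclideanLin_dyad (u v w : EuclideanSpace ℝ (Fin p)) :
    Matrix.toEuclideanLin (dyad u v) w = (inner ℝ v w : ℝ) • u := by
  ext i
  rw [Matrix.ofLp_toLpLin, Matrix.toLin'_apply, inner_eq_sum]
  simp only [Matrix.mulVec, dotProduct, dyad, Matrix.of_apply, PiLp.smul_apply, smul_eq_mul,
    Finset.sum_mul]
  exact Finset.sum_congr rfl fun j _ => by ring

theorem matInner_dyad_dyad (a b u v : EuclideanSpace ℝ (Fin p)) :
    matInner (dyad a b) (dyad u v) = inner ℝ a u * inner ℝ b v := by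
  rw [matInner_dyad, toEuclideanLin_dyad, inner_smul_right, real_inner_comm v b, mul_comm]

theorem frobNorm_dyad (u v : EuclideanSpace ℝ (Fin p)) : frobNorm (dyad u v) = ‖u‖ * ‖v‖ := by
  rw [← sq_eq_sq₀ (frobNorm_nonneg _) (by positivity), frobNorm_sq, matInner_dyad_dyad,
    real_inner_self_eq_norm_sq, real_inner_self_eq_norm_sq, mul_pow]

theorem inner_toEuclideanLin (A : Matrix (Fin p) (Fin p) ℝ) (u v : EuclideanSpace ℝ (Fin p)) :
    inner ℝ (Matrix.toEuclideanLin A u) v = inner ℝ u (Matrix.toEuclideanLin A.transpose v) := by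
  rw [← matInner_dyad, ← dyad_transpose, matInner_transpose, Matrix.transpose_transpose,
    matInner_dyad, real_inner_comm]

theorem toEuclideanLin_mul (A B : Matrix (Fin p) (Fin p) ℝ) (v : EuclideanSpace ℝ (Fin p)) :
    Matrix.toEuclideanLin (A * B) v = Matrix.toEuclideanLin A (Matrix.toEuclideanLin B v) := by
  ext i
  simp [Matrix.mulVec_mulVec]

theorem norm_toEuclideanLin_le (A : Matrix (Fin p) (Fin p) ℝ) (v : EuclideanSpace ℝ (Fin p)) :
    ‖Matrix.toEuclideanLin A v‖ ≤ frobNorm A * ‖v‖ := by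
  have h := matInner_le (dyad (Matrix.toEuclideanLin A v) v) A
  rw [matInner_dyad, real_inner_self_eq_norm_sq, frobNorm_dyad] at h
  by_contra hlt
  push Not at hlt
  have h0 : 0 < ‖Matrix.toEuclideanLin A v‖ :=
    (mul_nonneg (frobNorm_nonneg A) (norm_nonneg v)).trans_lt hlt
  nlinarith

/-- `W` does not increase Euclidean norms. -/
def IsContraction (W : Matrix (Fin p) (Fin p) ℝ) : Prop :=
  ∀ v, ‖Matrix.toEuclideanLin W v‖ ≤ ‖v‖

theorem IsContraction.transpose {W : Matrix (Fin p) (Fin p) ℝ} (h : IsContraction W) :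
    IsContraction W.transpose := by
  intro v
  have h1 := inner_toEuclideanLin W (Matrix.toEuclideanLin W.transpose v) v
  rw [real_inner_self_eq_norm_sq] at h1
  have h2 := real_inner_le_norm (Matrix.toEuclideanLin W (Matrix.toEuclideanLin W.transpose v)) v
  have h3 := h (Matrix.toEuclideanLin W.transpose v)
  by_contra hlt
  push Not at hlt
  have h0 : 0 < ‖Matrix.toEuclideanLin W.transpose v‖ := (norm_nonneg v).trans_lt hlt
  nlinarith [norm_nonneg v]

theorem IsContraction.neg {W : Matrix (Fin p) (Fin p) ℝ} (h : IsContraction W) :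
    IsContraction (-W) := by
  intro v
  simpa using h v

theorem matInner_eq_sum_inner (W K : Matrix (Fin p) (Fin p) ℝ)
    (b : OrthonormalBasis (Fin p) ℝ (EuclideanSpace ℝ (Fin p))) :
    matInner W K = ∑ i, inner ℝ (Matrix.toEuclideanLin W (b i)) (Matrix.toEuclideanLin K (b i)) := by
  have h1 : LinearMap.trace ℝ _ (Matrix.toEuclideanLin (W.transpose * K)) = matInner W K := by
    rw [matInner_eq_trace, Matrix.toEuclideanLin_eq_toLin_orthonormal, Matrix.trace_toLin_eq]
  rw [← h1, LinearMap.trace_eq_sum_inner _ b]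
  refine Finset.sum_congr rfl fun i _ => ?_
  rw [inner_toEuclideanLin, toEuclideanLin_mul]

theorem frobNorm_mul_le {W : Matrix (Fin p) (Fin p) ℝ} (h : IsContraction W)
    (A : Matrix (Fin p) (Fin p) ℝ) : frobNorm (W * A) ≤ frobNorm A := by
  rw [← sq_le_sq₀ (frobNorm_nonneg _) (frobNorm_nonneg _), frobNorm_sq, frobNorm_sq,
    matInner_eq_sum_inner _ _ (EuclideanSpace.basisFun (Fin p) ℝ),
    matInner_eq_sum_inner A A (EuclideanSpace.basisFun (Fin p) ℝ)]
  refine Finset.sum_le_sum fun i _ => ?_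
  rw [real_inner_self_eq_norm_sq, real_inner_self_eq_norm_sq, toEuclideanLin_mul]
  exact pow_le_pow_left₀ (norm_nonneg _) (h _) 2

theorem frobNorm_mul_le' {W : Matrix (Fin p) (Fin p) ℝ} (h : IsContraction W)
    (A : Matrix (Fin p) (Fin p) ℝ) : frobNorm (A * W) ≤ frobNorm A := by
  rw [← frobNorm_transpose, Matrix.transpose_mul, ← frobNorm_transpose A]
  exact frobNorm_mul_le h.transpose _

theorem frobNorm_le_sqrt {W : Matrix (Fin p) (Fin p) ℝ} (h : IsContraction W) :
    frobNorm W ≤ √p := by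
  refine Real.le_sqrt_of_sq_le ?_
  rw [frobNorm_sq, matInner_eq_sum_inner _ _ (EuclideanSpace.basisFun (Fin p) ℝ)]
  refine (Finset.sum_le_sum (g := fun _ => (1 : ℝ)) fun i _ => ?_).trans (by simp)
  rw [real_inner_self_eq_norm_sq]
  have := h (EuclideanSpace.basisFun (Fin p) ℝ i)
  rw [OrthonormalBasis.norm_eq_one] at this
  exact pow_le_one₀ (norm_nonneg _) this

/-- An eigenbasis of `Kᵀ K`: its images under `K` are orthogonal and have the singular values as
norms. -/
theorem exists_orthonormalBasis_singularValues (K : Matrix (Fin p) (Fin p) ℝ) :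
    ∃ b : OrthonormalBasis (Fin p) ℝ (EuclideanSpace ℝ (Fin p)),
      nuclearNorm K = ∑ i, ‖Matrix.toEuclideanLin K (b i)‖ ∧
      ∀ i j, i ≠ j → inner ℝ (Matrix.toEuclideanLin K (b i)) (Matrix.toEuclideanLin K (b j)) = (0 : ℝ) := by
  have hn : Module.finrank ℝ (EuclideanSpace ℝ (Fin p)) = p := by simp
  set T := Matrix.toEuclideanLin K with hT
  set b := T.isSymmetric_adjoint_comp_self.eigenvectorBasis hn with hb
  have hij : ∀ i j, inner ℝ (T (b i)) (T (b j)) =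
      T.isSymmetric_adjoint_comp_self.eigenvalues hn j * inner ℝ (b i) (b j) := by
    intro i j
    have := T.isSymmetric_adjoint_comp_self.apply_eigenvectorBasis hn j
    rw [← LinearMap.adjoint_inner_right, ← LinearMap.comp_apply, this, inner_smul_right]
    rfl
  refine ⟨b, ?_, fun i j h => ?_⟩
  · rw [nuclearNorm, Finset.sum_range]
    refine Finset.sum_congr rfl fun i _ => ?_
    rw [T.singularValues_fin hn, Real.sqrt_eq_iff_mul_self_eq
      (T.isPositive_adjoint_comp_self.nonneg_eigenvalues hn i) (norm_nonneg _),
      ← real_inner_self_eq_norm_mul_norm, hij, real_inner_self_eq_norm_mul_norm, b.norm_eq_one]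
    ring
  · rw [hij, b.inner_eq_ite, if_neg h, mul_zero]

theorem matInner_le_nuclearNorm {W : Matrix (Fin p) (Fin p) ℝ} (h : IsContraction W)
    (K : Matrix (Fin p) (Fin p) ℝ) : matInner W K ≤ nuclearNorm K := by
  obtain ⟨b, hb, -⟩ := exists_orthonormalBasis_singularValues K
  rw [hb, matInner_eq_sum_inner W K b]
  refine Finset.sum_le_sum fun i _ => (real_inner_le_norm _ _).trans ?_
  have := h (b i)
  rw [b.norm_eq_one] at this
  exact mul_le_of_le_one_left (norm_nonneg _) this

/-- The witness is the partial isometry of the polar decomposition. With `matInner_le_nuclearNorm`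
it presents the nuclear norm as a maximum of linear functionals, from which the norm inequalities
below follow. -/
theorem exists_isContraction_matInner_eq (K : Matrix (Fin p) (Fin p) ℝ) :
    ∃ W, IsContraction W ∧ matInner W K = nuclearNorm K := by
  obtain ⟨b, hb, horth⟩ := exists_orthonormalBasis_singularValues K
  set T := Matrix.toEuclideanLin K with hT
  -- If `T (b i) = 0`, the inverse is `0` and so is `y i`; hence the `y i` are orthogonal with norm
  -- at most `1`, not always equal to `1`.
  set y : Fin p → EuclideanSpace ℝ (Fin p) := fun i => ‖T (b i)‖⁻¹ • T (b i) with hy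
  have hyn : ∀ i, ‖y i‖ ≤ 1 := fun i => by
    rw [hy]
    simp only [norm_smul, norm_inv, norm_norm]
    exact inv_mul_le_one
  have hyo : ∀ i j, i ≠ j → inner ℝ (y i) (y j) = (0 : ℝ) := fun i j hij => by
    simp only [hy, inner_smul_left, inner_smul_right, horth i j hij, mul_zero]
  have hW : ∀ v, Matrix.toEuclideanLin (∑ i, dyad (y i) (b i)) v =
      ∑ i, (inner ℝ (b i) v : ℝ) • y i := by
    intro v
    rw [map_sum, LinearMap.sum_apply]
    exact Finset.sum_congr rfl fun i _ => toEuclideanLin_dyad _ _ _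
  refine ⟨∑ i, dyad (y i) (b i), fun v => ?_, ?_⟩
  · rw [hW, ← sq_le_sq₀ (norm_nonneg _) (norm_nonneg _), ← real_inner_self_eq_norm_sq, sum_inner,
      ← OrthonormalBasis.sum_sq_norm_inner_right b v]
    refine Finset.sum_le_sum fun i _ => ?_
    rw [inner_sum, Finset.sum_eq_single i (fun j _ hj => ?_) (by simp)]
    · rw [inner_smul_left, inner_smul_right, real_inner_self_eq_norm_sq, conj_trivial,
        Real.norm_eq_abs, sq_abs, ← mul_assoc, ← sq]
      exact mul_le_of_le_one_right (sq_nonneg _) (pow_le_one₀ (norm_nonneg _) (hyn i))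
    · rw [inner_smul_left, inner_smul_right, hyo i j hj.symm, mul_zero, mul_zero]
  · rw [hb, matInner_eq_sum_inner _ _ b]
    refine Finset.sum_congr rfl fun i _ => ?_
    rw [hW, Finset.sum_eq_single i (fun j _ hj => ?_) (by simp), b.inner_eq_one, one_smul]
    · simp only [hy, inner_smul_left, conj_trivial]
      rw [real_inner_self_eq_norm_sq]
      rcases eq_or_ne ‖T (b i)‖ 0 with h | h
      · simp [h]
      · field_simp
    · rw [b.inner_eq_zero hj, zero_smul]

theorem nuclearNorm_le_of_forall {K : Matrix (Fin p) (Fin p) ℝ} {c : ℝ}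
    (h : ∀ W, IsContraction W → matInner W K ≤ c) : nuclearNorm K ≤ c := by
  obtain ⟨W, hW, hK⟩ := exists_isContraction_matInner_eq K
  exact hK ▸ h W hW

theorem nuclearNorm_nonneg (K : Matrix (Fin p) (Fin p) ℝ) : 0 ≤ nuclearNorm K :=
  Finset.sum_nonneg fun i _ => LinearMap.singularValues_nonneg _ i

theorem nuclearNorm_add_le (A B : Matrix (Fin p) (Fin p) ℝ) :
    nuclearNorm (A + B) ≤ nuclearNorm A + nuclearNorm B :=
  nuclearNorm_le_of_forall fun W hW => by
    rw [matInner_add_right]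
    exact add_le_add (matInner_le_nuclearNorm hW A) (matInner_le_nuclearNorm hW B)

theorem nuclearNorm_smul_le {c : ℝ} (hc : 0 ≤ c) (A : Matrix (Fin p) (Fin p) ℝ) :
    nuclearNorm (c • A) ≤ c * nuclearNorm A :=
  nuclearNorm_le_of_forall fun W hW => by
    rw [matInner_smul_right]
    exact mul_le_mul_of_nonneg_left (matInner_le_nuclearNorm hW A) hc

theorem nuclearNorm_neg_le (A : Matrix (Fin p) (Fin p) ℝ) : nuclearNorm (-A) ≤ nuclearNorm A :=
  nuclearNorm_le_of_forall fun W hW => by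
    have : matInner W (-A) = matInner (-W) A := by
      rw [matInner_neg_right, matInner_comm (-W), matInner_neg_right, matInner_comm]
    rw [this]
    exact matInner_le_nuclearNorm hW.neg A

theorem nuclearNorm_transpose_le (A : Matrix (Fin p) (Fin p) ℝ) :
    nuclearNorm A.transpose ≤ nuclearNorm A :=
  nuclearNorm_le_of_forall fun W hW => by
    rw [← matInner_transpose]
    exact matInner_le_nuclearNorm hW.transpose A

theorem nuclearNorm_le_sqrt_mul_frobNorm (A : Matrix (Fin p) (Fin p) ℝ) :
    nuclearNorm A ≤ √p * frobNorm A :=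
  nuclearNorm_le_of_forall fun W hW => (matInner_le W A).trans
    (mul_le_mul_of_nonneg_right (frobNorm_le_sqrt hW) (frobNorm_nonneg A))

/-- The duality after scaling by the operator norm bound; `m = 0` forces `M = 0` and is separate
because of the inverse. -/
theorem matInner_le_mul_nuclearNorm {M : Matrix (Fin p) (Fin p) ℝ} {m : ℝ} (hm : 0 ≤ m)
    (h : ∀ v, ‖Matrix.toEuclideanLin M v‖ ≤ m * ‖v‖) (Z : Matrix (Fin p) (Fin p) ℝ) :
    matInner M Z ≤ m * nuclearNorm Z := by
  rcases hm.eq_or_lt with rfl | h0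
  · have : Matrix.toEuclideanLin M = 0 := LinearMap.ext fun v => by
      have := h v
      rw [zero_mul] at this
      simpa using norm_le_zero_iff.1 this
    have hM : M = 0 := by simpa using this
    simp [hM, matInner]
  · have hW : IsContraction (m⁻¹ • M) := fun v => by
      simp only [map_smul, LinearMap.smul_apply, norm_smul, norm_inv, Real.norm_eq_abs,
        abs_of_pos h0]
      rw [inv_mul_le_iff₀ h0]
      exact h v
    have := matInner_le_nuclearNorm hW Z
    rwa [matInner_smul_left, inv_mul_le_iff₀ h0] at this

end LinearAlgebra

end MixedRegression

namespace MixedRegression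

/-! ### Nets, the cone condition and perturbation of the first eigenpair -/

section Geometry

variable {p : ℕ}

/-- A `1`-separated subset of the ball of radius `2` with the largest number of points is a net,
since any uncovered point could be added. The volume bound `Besicovitch.card_le_of_separated` makes
that number finite. -/
theorem exists_finset_one_net (E : Type*) [NormedAddCommGroup E] [NormedSpace ℝ E]
    [FiniteDimensional ℝ E] :
    ∃ s : Finset E, s.card ≤ 5 ^ Module.finrank ℝ E ∧ (∀ c ∈ s, ‖c‖ ≤ 2) ∧
      ∀ v : E, ‖v‖ ≤ 2 → ∃ c ∈ s, ‖v - c‖ < 1 := by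
  classical
  let good : Finset E → Prop := fun s =>
    (∀ c ∈ s, ‖c‖ ≤ 2) ∧ ∀ c ∈ s, ∀ d ∈ s, c ≠ d → 1 ≤ ‖c - d‖
  have hcard : ∀ s, good s → s.card ≤ 5 ^ Module.finrank ℝ E :=
    fun s hs => Besicovitch.card_le_of_separated s hs.1 hs.2
  let Q : ℕ → Prop := fun k => ∃ s, good s ∧ s.card = k
  have hQ0 : Q 0 := ⟨∅, by simp [good], rfl⟩
  obtain ⟨s, hs, hsc⟩ : Q (Nat.findGreatest Q (5 ^ Module.finrank ℝ E)) :=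
    Nat.findGreatest_spec (Nat.zero_le _) hQ0
  refine ⟨s, hcard s hs, hs.1, fun v hv => ?_⟩
  by_contra! hcon
  have hvs : v ∉ s := fun h => by
    have := hcon v h
    simp at this
    linarith
  have hgood : good (insert v s) := by
    refine ⟨fun c hc => ?_, fun c hc d hd hcd => ?_⟩
    · rcases Finset.mem_insert.1 hc with rfl | hc
      exacts [hv, hs.1 c hc]
    · rcases Finset.mem_insert.1 hc with hcv | hc <;> rcases Finset.mem_insert.1 hd with hdv | hd
      · exact absurd (hcv.trans hdv.symm) hcd
      · exact hcv ▸ hcon d hd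
      · rw [norm_sub_rev, hdv]
        exact hcon c hc
      · exact hs.2 c hc d hd hcd
  have h1 := Nat.le_findGreatest (P := Q) (hcard _ hgood) ⟨_, hgood, rfl⟩
  rw [← hsc, Finset.card_insert_of_notMem hvs] at h1
  omega

/-- The previous net is used at two scales: `c / 2` approximates `v` within `1/2`, and `d / 4` then
approximates the remainder within `1/4`. Hence `5^p * 5^p` points, of norm at most `1 + 1/2`. -/
theorem exists_finset_quarter_net (p : ℕ) :
    ∃ U : Finset (EuclideanSpace ℝ (Fin p)), U.card ≤ 25 ^ p ∧ (∀ u ∈ U, ‖u‖ ≤ 3 / 2) ∧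
      ∀ v : EuclideanSpace ℝ (Fin p), ‖v‖ ≤ 1 → ∃ u ∈ U, ‖v - u‖ ≤ 1 / 4 := by
  classical
  obtain ⟨s, hs, hs2, hnet⟩ := exists_finset_one_net (EuclideanSpace ℝ (Fin p))
  rw [finrank_euclideanSpace, Fintype.card_fin] at hs
  refine ⟨(s ×ˢ s).image fun c => (1 / 2 : ℝ) • c.1 + (1 / 4 : ℝ) • c.2, ?_, ?_, ?_⟩
  · refine Finset.card_image_le.trans ?_
    rw [Finset.card_product, show 25 = 5 * 5 by norm_num, mul_pow]
    exact Nat.mul_le_mul hs hs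
  · intro u hu
    obtain ⟨c, hc, rfl⟩ := Finset.mem_image.1 hu
    rw [Finset.mem_product] at hc
    refine (norm_add_le _ _).trans ?_
    rw [norm_smul, norm_smul]
    norm_num
    linarith [hs2 _ hc.1, hs2 _ hc.2]
  · intro v hv
    obtain ⟨c, hc, h1⟩ := hnet ((2 : ℝ) • v) (by rw [norm_smul]; norm_num; exact hv)
    obtain ⟨d, hd, h2⟩ := hnet ((2 : ℝ) • ((2 : ℝ) • v - c)) (by rw [norm_smul]; norm_num; exact h1.le)
    refine ⟨_, Finset.mem_image.2 ⟨(c, d), Finset.mem_product.2 ⟨hc, hd⟩, rfl⟩, ?_⟩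
    have : v - ((1 / 2 : ℝ) • c + (1 / 4 : ℝ) • d) =
        (1 / 4 : ℝ) • ((2 : ℝ) • ((2 : ℝ) • v - c) - d) := by module
    rw [this, norm_smul]
    norm_num
    linarith

theorem quad_eq_inner (M : Matrix (Fin p) (Fin p) ℝ) (v : EuclideanSpace ℝ (Fin p)) :
    matInner (outer v) M = inner ℝ v (Matrix.toEuclideanLin M v) := matInner_dyad v v M

theorem inner_toEuclideanLin_of_isSymm {M : Matrix (Fin p) (Fin p) ℝ} (hM : M.IsSymm)
    (u v : EuclideanSpace ℝ (Fin p)) :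
    inner ℝ (Matrix.toEuclideanLin M u) v = inner ℝ u (Matrix.toEuclideanLin M v) := by
  rw [inner_toEuclideanLin, hM.eq]

/-- Polarization and the parallelogram law give the bound with `(‖a‖² + ‖b‖²) / 2`; normalizing both
vectors turns this into the product of norms. -/
theorem abs_inner_le_of_quad_le {M : Matrix (Fin p) (Fin p) ℝ} (hM : M.IsSymm) {m : ℝ}
    (h : ∀ v, |matInner (outer v) M| ≤ m * ‖v‖ ^ 2) (v w : EuclideanSpace ℝ (Fin p)) :
    |inner ℝ v (Matrix.toEuclideanLin M w)| ≤ m * ‖v‖ * ‖w‖ := by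
  have key : ∀ a b : EuclideanSpace ℝ (Fin p),
      |inner ℝ a (Matrix.toEuclideanLin M b)| ≤ m * (‖a‖ ^ 2 + ‖b‖ ^ 2) / 2 := by
    intro a b
    have h1 := h (a + b)
    have h2 := h (a - b)
    rw [quad_eq_inner, map_add, inner_add_left, inner_add_right, inner_add_right] at h1
    rw [quad_eq_inner, map_sub, inner_sub_left, inner_sub_right, inner_sub_right] at h2
    have h3 := inner_toEuclideanLin_of_isSymm hM a b
    rw [real_inner_comm] at h3
    have h4 := parallelogram_law_with_norm ℝ a b
    have h5 : m * ‖a + b‖ ^ 2 + m * ‖a - b‖ ^ 2 = m * (2 * (‖a‖ ^ 2 + ‖b‖ ^ 2)) := by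
      rw [← mul_add, h4]
    rw [abs_le] at h1 h2 ⊢
    constructor <;> linarith [h1.1, h1.2, h2.1, h2.2]
  rcases eq_or_ne v 0 with rfl | hv
  · simp
  rcases eq_or_ne w 0 with rfl | hw
  · simp
  have hv' : 0 < ‖v‖ := norm_pos_iff.2 hv
  have hw' : 0 < ‖w‖ := norm_pos_iff.2 hw
  have := key (‖v‖⁻¹ • v) (‖w‖⁻¹ • w)
  rw [map_smul, inner_smul_left, inner_smul_right, norm_smul, norm_smul, norm_inv, norm_inv,
    norm_norm, norm_norm, inv_mul_cancel₀ hv'.ne', inv_mul_cancel₀ hw'.ne', conj_trivial,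
    abs_mul, abs_mul, abs_of_pos (inv_pos.2 hv'), abs_of_pos (inv_pos.2 hw'), ← mul_assoc,
    ← mul_inv, inv_mul_le_iff₀ (by positivity)] at this
  linarith

theorem norm_toEuclideanLin_le_of_quad_le {M : Matrix (Fin p) (Fin p) ℝ} (hM : M.IsSymm) {m : ℝ}
    (h : ∀ v, |matInner (outer v) M| ≤ m * ‖v‖ ^ 2) (v : EuclideanSpace ℝ (Fin p)) :
    ‖Matrix.toEuclideanLin M v‖ ≤ m * ‖v‖ := by
  have h1 := abs_inner_le_of_quad_le hM h (Matrix.toEuclideanLin M v) v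
  rw [real_inner_self_eq_norm_sq, abs_of_nonneg (sq_nonneg _)] at h1
  rcases (norm_nonneg (Matrix.toEuclideanLin M v)).eq_or_lt with h0 | h0
  · rcases eq_or_ne v 0 with rfl | hv
    · simp
    have := (abs_nonneg _).trans (h v)
    have hm : 0 ≤ m := nonneg_of_mul_nonneg_left this (by positivity)
    rw [← h0]
    positivity
  · rw [sq, mul_comm m, mul_assoc] at h1
    exact le_of_mul_le_mul_left h1 h0

/-- A bound for a quadratic form on a net yields a bound on the whole space. -/
theorem quad_le_of_net {M : Matrix (Fin p) (Fin p) ℝ} (hM : M.IsSymm)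
    {U : Finset (EuclideanSpace ℝ (Fin p))}
    (hU : ∀ v : EuclideanSpace ℝ (Fin p), ‖v‖ ≤ 1 → ∃ u ∈ U, ‖v - u‖ ≤ 1 / 4)
    {s : ℝ} (h : ∀ u ∈ U, |matInner (outer u) M| ≤ s) (v : EuclideanSpace ℝ (Fin p)) :
    |matInner (outer v) M| ≤ 3 * s * ‖v‖ ^ 2 := by
  rcases eq_or_ne v 0 with rfl | hv
  · simp [quad_eq_inner]
  have hs : 0 ≤ s := by
    obtain ⟨u, hu, -⟩ := hU 0 (by simp)
    exact (abs_nonneg _).trans (h u hu)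
  have hcont : Continuous fun w : EuclideanSpace ℝ (Fin p) => |matInner (outer w) M| := by
    simp only [matInner, outer, Matrix.of_apply]
    fun_prop
  have hne : (Metric.sphere (0 : EuclideanSpace ℝ (Fin p)) 1).Nonempty :=
    ⟨‖v‖⁻¹ • v, by simp [norm_smul, norm_ne_zero_iff.2 hv]⟩
  obtain ⟨w, hw, hmax⟩ := (isCompact_sphere (0 : EuclideanSpace ℝ (Fin p)) 1).exists_isMaxOn hne
    hcont.continuousOn
  set m := |matInner (outer w) M| with hm
  have hm0 : 0 ≤ m := abs_nonneg _
  have hall : ∀ x, |matInner (outer x) M| ≤ m * ‖x‖ ^ 2 := by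
    intro x
    rcases eq_or_ne x 0 with rfl | hx
    · simp [quad_eq_inner]
    have hx' : 0 < ‖x‖ := norm_pos_iff.2 hx
    have h1 : |matInner (outer (‖x‖⁻¹ • x)) M| ≤ m :=
      hmax (by simp [norm_smul, hx'.ne'])
    rw [quad_eq_inner, map_smul, inner_smul_left, inner_smul_right, conj_trivial, abs_mul, abs_mul,
      abs_of_pos (inv_pos.2 hx'), ← mul_assoc, ← mul_inv, inv_mul_le_iff₀ (by positivity),
      ← quad_eq_inner] at h1
    linarith
  have hw1 : ‖w‖ = 1 := by simpa using hw
  obtain ⟨u, hu, hwu⟩ := hU w hw1.le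
  have h2 := abs_inner_le_of_quad_le hM hall (w - u) (w + u)
  -- At a maximizer `w` on the sphere, with net point `u`, the two forms differ by `⟨w - u, M (w +
  -- u)⟩`, at most `m * (1/4) * (9/4)`. Thus `m ≤ s + 9m/16`, and `16/7 ≤ 3`.
  have h3 : matInner (outer w) M = matInner (outer u) M +
      inner ℝ (w - u) (Matrix.toEuclideanLin M (w + u)) := by
    have := inner_toEuclideanLin_of_isSymm hM w u
    rw [real_inner_comm] at this
    rw [quad_eq_inner, quad_eq_inner, map_add, inner_sub_left, inner_add_right, inner_add_right]
    linarith
  have h4 : ‖w + u‖ ≤ 9 / 4 := by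
    have : w + u = (2 : ℝ) • w - (w - u) := by module
    rw [this]
    refine (norm_sub_le _ _).trans ?_
    rw [norm_smul, hw1]
    norm_num
    linarith
  have h5 : m ≤ s + m * (1 / 4) * (9 / 4) := by
    have e : m = |matInner (outer u) M + inner ℝ (w - u) (Matrix.toEuclideanLin M (w + u))| := by
      rw [hm, h3]
    refine e.le.trans ((abs_add_le _ _).trans (add_le_add (h u hu) (h2.trans ?_)))
    gcongr
  have h6 : m ≤ 3 * s := by linarith
  exact (hall v).trans (mul_le_mul_of_nonneg_right h6 (sq_nonneg _))

/-- Pythagoras: the ranges of `P` and `1 - P` are orthogonal and each block is a contraction. Such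
block matrices serve as dual certificates in the cone condition. -/
theorem IsContraction.compression {P : Matrix (Fin p) (Fin p) ℝ} (hP : IsContraction P)
    (hPs : P.IsSymm) (hPi : P * P = P) {W V : Matrix (Fin p) (Fin p) ℝ} (hW : IsContraction W)
    (hV : IsContraction V) : IsContraction (P * W * P + (1 - P) * V * (1 - P)) := by
  have hdec : ∀ a b : EuclideanSpace ℝ (Fin p),
      ‖Matrix.toEuclideanLin P a + Matrix.toEuclideanLin (1 - P) b‖ ^ 2 =
        ‖Matrix.toEuclideanLin P a‖ ^ 2 + ‖Matrix.toEuclideanLin (1 - P) b‖ ^ 2 := by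
    intro a b
    have h0 : inner ℝ (Matrix.toEuclideanLin P a) (Matrix.toEuclideanLin (1 - P) b) = (0 : ℝ) := by
      rw [inner_toEuclideanLin_of_isSymm hPs, ← toEuclideanLin_mul, Matrix.mul_sub, hPi]
      simp
    rw [norm_add_sq_real, h0]
    ring
  have hQ : IsContraction (1 - P) := fun v => by
    have h := hdec v v
    have e : Matrix.toEuclideanLin P v + Matrix.toEuclideanLin (1 - P) v = v := by
      rw [← LinearMap.add_apply, ← map_add, add_sub_cancel]
      simp
    rw [e] at h
    rw [← sq_le_sq₀ (norm_nonneg _) (norm_nonneg _)]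
    nlinarith [sq_nonneg ‖Matrix.toEuclideanLin P v‖]
  intro v
  have h := hdec v v
  have e : Matrix.toEuclideanLin P v + Matrix.toEuclideanLin (1 - P) v = v := by
    rw [← LinearMap.add_apply, ← map_add, add_sub_cancel]
    simp
  rw [e] at h
  rw [map_add, LinearMap.add_apply, ← sq_le_sq₀ (norm_nonneg _) (norm_nonneg _), h]
  simp only [toEuclideanLin_mul]
  rw [hdec]
  have h1 := (hP _).trans (hW (Matrix.toEuclideanLin P v))
  have h2 := (hQ _).trans (hV (Matrix.toEuclideanLin (1 - P) v))
  exact add_le_add (pow_le_pow_left₀ (norm_nonneg _) h1 2) (pow_le_pow_left₀ (norm_nonneg _) h2 2)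

/-- The orthogonal projection onto the span of two vectors. -/
structure IsProjOn (P : Matrix (Fin p) (Fin p) ℝ) (β : Fin 2 → EuclideanSpace ℝ (Fin p)) :
    Prop where
  symm : P.IsSymm
  idem : P * P = P
  contraction : IsContraction P
  apply : ∀ b, Matrix.toEuclideanLin P (β b) = β b
  frob : frobNorm P ≤ √2

theorem exists_isProjOn (β : Fin 2 → EuclideanSpace ℝ (Fin p)) : ∃ P, IsProjOn P β := by
  set S : Submodule ℝ (EuclideanSpace ℝ (Fin p)) := Submodule.span ℝ (Set.range β) with hS
  set P : Matrix (Fin p) (Fin p) ℝ := Matrix.toEuclideanLin.symm S.starProjection.toLinearMap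
    with hP
  have hPa : ∀ v, Matrix.toEuclideanLin P v = S.starProjection v := fun v => by
    rw [hP, LinearEquiv.apply_symm_apply]
    rfl
  have hsymm : P.IsSymm := by
    rw [Matrix.IsSymm]
    apply Matrix.toEuclideanLin.injective
    refine LinearMap.ext fun v => ?_
    refine ext_inner_left ℝ fun w => ?_
    rw [← inner_toEuclideanLin, hPa, hPa]
    exact S.inner_starProjection_left_eq_right w v
  have hidem : P * P = P := by
    apply Matrix.toEuclideanLin.injective
    refine LinearMap.ext fun v => ?_
    rw [toEuclideanLin_mul, hPa, hPa]
    exact Submodule.starProjection_eq_self_iff.2 (S.starProjection_apply_mem v)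
  refine ⟨P, hsymm, hidem, fun v => ?_, fun b => ?_, ?_⟩
  · rw [hPa]
    exact S.norm_starProjection_apply_le v
  · rw [hPa]
    exact Submodule.starProjection_eq_self_iff.2 (Submodule.subset_span (Set.mem_range_self b))
  · refine Real.le_sqrt_of_sq_le ?_
    rw [frobNorm_sq, matInner_eq_trace, hsymm.eq, hidem]
    have h1 : LinearMap.trace ℝ _ (Matrix.toEuclideanLin P) = P.trace := by
      rw [Matrix.toEuclideanLin_eq_toLin_orthonormal, Matrix.trace_toLin_eq]
    have h2 : LinearMap.IsProj S (Matrix.toEuclideanLin P) :=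
      ⟨fun v => by rw [hPa]; exact S.starProjection_apply_mem v,
        fun v hv => by rw [hPa]; exact Submodule.starProjection_eq_self_iff.2 hv⟩
    rw [← h1, h2.trace]
    have h3 : Module.finrank ℝ S ≤ 2 :=
      (finrank_range_le_card (R := ℝ) β).trans (by simp)
    exact_mod_cast h3

namespace IsProjOn

variable {P : Matrix (Fin p) (Fin p) ℝ} {β : Fin 2 → EuclideanSpace ℝ (Fin p)}

theorem compl_symm (h : IsProjOn P β) : (1 - P).IsSymm := by
  rw [Matrix.IsSymm, Matrix.transpose_sub, h.symm.eq, Matrix.transpose_one]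

theorem compl_contraction (h : IsProjOn P β) : IsContraction (1 - P) := by
  have h1 : IsContraction (1 : Matrix (Fin p) (Fin p) ℝ) := fun v => by simp
  have h0 : IsContraction (0 : Matrix (Fin p) (Fin p) ℝ) := fun v => by simp
  have := h.contraction.compression h.symm h.idem h0 h1
  have e : P * 0 * P + (1 - P) * 1 * (1 - P) = 1 - P := by
    rw [mul_zero, zero_mul, zero_add, mul_one, mul_sub, mul_one, sub_mul, one_mul, h.idem, sub_self,
      sub_zero]
  rwa [e] at this

theorem compl_apply (h : IsProjOn P β) (b : Fin 2) :
    Matrix.toEuclideanLin (1 - P) (β b) = 0 := by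
  rw [map_sub, LinearMap.sub_apply, h.apply]
  simp

/-- The part of `Z` that does not lie in `Pᗮ Z Pᗮ` has small nuclear norm. -/
theorem nuclearNorm_sub_compl_le (h : IsProjOn P β) (Z : Matrix (Fin p) (Fin p) ℝ) :
    nuclearNorm (Z - (1 - P) * Z * (1 - P)) ≤ 2 * √2 * frobNorm Z := by
  have hPW : ∀ W, IsContraction W → frobNorm (P * W) ≤ √2 := fun W hW =>
    (frobNorm_mul_le' hW P).trans h.frob
  have hWP : ∀ W, IsContraction W → frobNorm (W * P) ≤ √2 := fun W hW =>
    (frobNorm_mul_le hW P).trans h.frob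
  refine nuclearNorm_le_of_forall fun W hW => ?_
  -- Each of the two summands has a factor `P`, of Frobenius norm at most `√2`; moving it to the
  -- side of `W` replaces the dimension by the rank.
  have e : Z - (1 - P) * Z * (1 - P) = P * Z + (1 - P) * Z * P := by noncomm_ring
  have h1 : matInner W (P * Z) = matInner (P * W) Z := by rw [matInner_mul_left, h.symm.eq]
  have h2 : matInner W ((1 - P) * Z * P) = matInner (W * P) ((1 - P) * Z) := by
    rw [matInner_mul_right, h.symm.eq]
  rw [e, matInner_add_right, h1, h2]
  have h3 := (matInner_le (P * W) Z).trans
    (mul_le_mul_of_nonneg_right (hPW W hW) (frobNorm_nonneg Z))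
  have h4 := (matInner_le (W * P) ((1 - P) * Z)).trans (mul_le_mul (hWP W hW)
    (frobNorm_mul_le h.compl_contraction Z) (frobNorm_nonneg _) (Real.sqrt_nonneg 2))
  linarith

/-- The cone condition. -/
theorem nuclearNorm_compl_le (h : IsProjOn P β) {K H : Matrix (Fin p) (Fin p) ℝ}
    (hK : P * K * P = K) (hH : nuclearNorm (K + H) ≤ nuclearNorm K) :
    nuclearNorm ((1 - P) * H * (1 - P)) ≤ nuclearNorm (H - (1 - P) * H * (1 - P)) := by
  obtain ⟨W, hW, hWK⟩ := exists_isContraction_matInner_eq K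
  obtain ⟨V, hV, hVH⟩ := exists_isContraction_matInner_eq ((1 - P) * H * (1 - P))
  have hPQ : P * (1 - P) = 0 := by rw [mul_sub, mul_one, h.idem, sub_self]
  have hQP : (1 - P) * P = 0 := by rw [sub_mul, one_mul, h.idem, sub_self]
  have hQQ : (1 - P) * (1 - P) = 1 - P := by rw [mul_sub, mul_one, hQP, sub_zero]
  have hcomp : ∀ R A B : Matrix (Fin p) (Fin p) ℝ, R.IsSymm →
      matInner (R * A * R) B = matInner A (R * B * R) := by
    intro R A B hR
    rw [matInner_mul_right, hR.eq, matInner_mul_left, hR.eq, mul_assoc]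
  -- The block certificate is optimal for both `K` and `(1 - P) H (1 - P)`, so their nuclear norms
  -- add up in the sum. Replacing that sum by `K + H` costs only the nuclear norm of the rest of
  -- `H`.
  have key := matInner_le_nuclearNorm
    (h.contraction.compression h.symm h.idem hW hV) (K + (1 - P) * H * (1 - P))
  have e1 : P * (K + (1 - P) * H * (1 - P)) * P = K := by
    rw [mul_add, add_mul, hK]
    have : P * ((1 - P) * H * (1 - P)) * P = (P * (1 - P)) * H * (1 - P) * P := by
      simp only [mul_assoc]
    rw [this, hPQ]
    simp
  have e2 : (1 - P) * (K + (1 - P) * H * (1 - P)) * (1 - P) = (1 - P) * H * (1 - P) := by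
    rw [mul_add, add_mul]
    have h1 : (1 - P) * K * (1 - P) = 0 := by
      rw [← hK]
      have : (1 - P) * (P * K * P) * (1 - P) = ((1 - P) * P) * K * P * (1 - P) := by
        simp only [mul_assoc]
      rw [this, hQP]
      simp
    have h2 : (1 - P) * ((1 - P) * H * (1 - P)) * (1 - P) =
        ((1 - P) * (1 - P)) * H * ((1 - P) * (1 - P)) := by simp only [mul_assoc]
    rw [h1, zero_add, h2, hQQ]
  rw [matInner_add_left, hcomp _ _ _ h.symm, hcomp _ _ _ h.compl_symm, e1, e2, hWK, hVH] at key
  have h3 := nuclearNorm_add_le (K + H) (-(H - (1 - P) * H * (1 - P)))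
  have h4 := nuclearNorm_neg_le (H - (1 - P) * H * (1 - P))
  have e3 : K + H + -(H - (1 - P) * H * (1 - P)) = K + (1 - P) * H * (1 - P) := by abel
  rw [e3] at h3
  linarith

end IsProjOn

/-- Perturbation of the first eigenpair of the rank-one matrix `d dᵀ`. -/
theorem exists_sign_norm_sub_le {J : Matrix (Fin p) (Fin p) ℝ} (hJ : J.IsSymm)
    {d v : EuclideanSpace ℝ (Fin p)} {lam ε : ℝ} (hε : frobNorm (J - outer d) ≤ ε)
    (h : IsFirstEigenpair J lam v) :
    ‖√lam • v - d‖ * ‖d‖ ≤ 10 * ε ∨ ‖√lam • v + d‖ * ‖d‖ ≤ 10 * ε := by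
  obtain ⟨hv, hev, hmax⟩ := h
  have hT : (Matrix.toEuclideanLin J).IsSymmetric := fun a b =>
    inner_toEuclideanLin_of_isSymm hJ a b
  have hε0 : 0 ≤ ε := (frobNorm_nonneg _).trans hε
  have hnt : Nontrivial (EuclideanSpace ℝ (Fin p)) := ⟨v, 0, fun h0 => by simp [h0] at hv⟩
  -- For a symmetric matrix the supremum of the Rayleigh quotient is itself an eigenvalue, hence at
  -- most `lam`.
  have hray : inner ℝ d (Matrix.toEuclideanLin J d) ≤ lam * ‖d‖ ^ 2 := by
    rcases eq_or_ne d 0 with rfl | hd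
    · simp
    have h1 := hmax _ hT.hasEigenvalue_iSup_of_finiteDimensional
    have hb : BddAbove (Set.range fun x : {x : EuclideanSpace ℝ (Fin p) // x ≠ 0} =>
        RCLike.re (inner ℝ (Matrix.toEuclideanLin J x) (x : EuclideanSpace ℝ (Fin p))) /
          ‖(x : EuclideanSpace ℝ (Fin p))‖ ^ 2) := by
      refine ⟨frobNorm J, ?_⟩
      rintro _ ⟨x, rfl⟩
      have hx : 0 < ‖(x : EuclideanSpace ℝ (Fin p))‖ := norm_pos_iff.2 x.2
      simp only [RCLike.re_to_real]
      rw [div_le_iff₀ (by positivity)]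
      refine (real_inner_le_norm _ _).trans ?_
      rw [sq, ← mul_assoc]
      exact mul_le_mul_of_nonneg_right (norm_toEuclideanLin_le J _) hx.le
    have h2 := (le_ciSup hb ⟨d, hd⟩).trans h1
    have hd' : 0 < ‖d‖ := norm_pos_iff.2 hd
    simp only [RCLike.re_to_real] at h2
    rwa [div_le_iff₀ (by positivity), real_inner_comm] at h2
  set r := Matrix.toEuclideanLin (J - outer d) v with hr
  have hrn : ‖r‖ ≤ ε := by
    have := (norm_toEuclideanLin_le (J - outer d) v).trans
      (mul_le_mul_of_nonneg_right hε (norm_nonneg v))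
    rwa [hv, mul_one] at this
  have hJd : inner ℝ d (Matrix.toEuclideanLin (J - outer d) d) ≥ -(ε * ‖d‖ ^ 2) := by
    have h1 := abs_real_inner_le_norm d (Matrix.toEuclideanLin (J - outer d) d)
    have h2 := (norm_toEuclideanLin_le (J - outer d) d).trans
      (mul_le_mul_of_nonneg_right hε (norm_nonneg d))
    have h3 := (abs_le.1 h1).1
    nlinarith [norm_nonneg d]
  have hJv : Matrix.toEuclideanLin J v = lam • v := hev.apply_eq_smul
  set s : ℝ := inner ℝ d v with hs
  have hlv : lam • v = s • d + r := by
    rw [← hJv, hr, map_sub, LinearMap.sub_apply, outer_eq_dyad, toEuclideanLin_dyad]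
    abel
  have hvv : inner ℝ v v = (1 : ℝ) := by rw [real_inner_self_eq_norm_sq, hv, one_pow]
  have hlam : lam = s ^ 2 + inner ℝ r v := by
    have h1 : inner ℝ (lam • v) v = lam := by rw [inner_smul_left, hvv]; simp
    rw [← h1, hlv, inner_add_left, inner_smul_left, conj_trivial, ← hs]
    ring
  have hrv : |inner ℝ r v| ≤ ε := by
    refine (abs_real_inner_le_norm r v).trans ?_
    rw [hv, mul_one]
    exact hrn
  rcases eq_or_ne d 0 with rfl | hd
  · left
    simp [hε0]
  have hd' : 0 < ‖d‖ := norm_pos_iff.2 hd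
  have hlow : ‖d‖ ^ 2 - ε ≤ lam := by
    have h1 : inner ℝ d (Matrix.toEuclideanLin J d) =
        ‖d‖ ^ 2 * ‖d‖ ^ 2 + inner ℝ d (Matrix.toEuclideanLin (J - outer d) d) := by
      rw [map_sub, LinearMap.sub_apply, outer_eq_dyad, toEuclideanLin_dyad, inner_sub_right,
        inner_smul_right, real_inner_self_eq_norm_sq]
      ring
    have h2 : (‖d‖ ^ 2 - ε) * ‖d‖ ^ 2 ≤ lam * ‖d‖ ^ 2 := by linarith
    exact le_of_mul_le_mul_right h2 (by positivity)
  have hs2 : ‖d‖ ^ 2 - 2 * ε ≤ s ^ 2 := by linarith [(abs_le.1 hrv).2]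
  have hsd : |s| ≤ ‖d‖ := by
    have := abs_real_inner_le_norm d v
    rwa [hv, mul_one] at this
  have hlamup : lam ≤ ‖d‖ ^ 2 + ε := by
    have := sq_le_sq₀ (abs_nonneg s) hd'.le |>.2 hsd
    rw [sq_abs] at this
    linarith [(abs_le.1 hrv).2]
  -- Without a spectral gap the triangle inequality suffices: `‖d‖² ≤ 4ε` and `(√lam)² ≤ 5ε`, so
  -- `(√lam + ‖d‖) ‖d‖` is already below `10ε`.
  by_cases hcase : ‖d‖ ^ 2 ≤ 4 * ε
  · left
    have h1 : ‖√lam • v - d‖ ≤ √lam + ‖d‖ := by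
      refine (norm_sub_le _ _).trans ?_
      rw [norm_smul, hv, mul_one, Real.norm_eq_abs, abs_of_nonneg (Real.sqrt_nonneg _)]
    have h2 : √lam * ‖d‖ ≤ (9 * ε) / 2 := by
      have h3 : √lam ^ 2 ≤ 5 * ε := by
        rcases le_total lam 0 with h0 | h0
        · rw [Real.sqrt_eq_zero_of_nonpos h0]
          simp [hε0]
        · rw [Real.sq_sqrt h0]
          linarith
      nlinarith [sq_nonneg (√lam - ‖d‖)]
    nlinarith
  · push Not at hcase
    have hlampos : 0 < lam := by linarith
    have hsq : √lam ^ 2 = lam := Real.sq_sqrt hlampos.le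
    have hsl := Real.sqrt_pos.2 hlampos
    -- Here `t = |s|` and `c` is the sign of `s` times `d`. The vector `t (√lam v - c)` is the sum
    -- of two terms of norm at most `ε`, the first because `√lam |t - √lam| ≤ |t² - lam| = |⟨r,
    -- v⟩|`. Division by `t ≥ ‖d‖ / 2` concludes.
    have main : ∀ (t : ℝ) (c : EuclideanSpace ℝ (Fin p)), 0 ≤ t → t ^ 2 = s ^ 2 → t • c = s • d →
        ‖√lam • v - c‖ * ‖d‖ ≤ 10 * ε := by
      intro t c ht hts htc
      have h1 : t • (√lam • v - c) = (√lam * (t - √lam)) • v + r := by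
        have h2 : r = lam • v - s • d := by rw [hlv]; abel
        rw [h2, ← htc, mul_sub, sub_smul, ← sq, hsq, smul_sub, smul_smul, mul_comm t]
        abel
      have h2 : |√lam * (t - √lam)| ≤ ε := by
        have h3 : (t - √lam) * (t + √lam) = -inner ℝ r v := by
          have : (t - √lam) * (t + √lam) = t ^ 2 - √lam ^ 2 := by ring
          rw [this, hsq, hts, hlam]
          ring
        have h4 : |t - √lam| * (t + √lam) ≤ ε := by
          rw [← abs_of_pos (by linarith : 0 < t + √lam), ← abs_mul, h3, abs_neg]
          exact hrv
        rw [abs_mul, abs_of_pos hsl]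
        nlinarith [abs_nonneg (t - √lam)]
      have h5 : t * ‖√lam • v - c‖ ≤ 2 * ε := by
        have : t * ‖√lam • v - c‖ = ‖t • (√lam • v - c)‖ := by
          rw [norm_smul, Real.norm_eq_abs, abs_of_nonneg ht]
        rw [this, h1]
        refine (norm_add_le _ _).trans ?_
        rw [norm_smul, hv, mul_one, Real.norm_eq_abs]
        linarith
      have h6 : ‖d‖ ≤ 2 * t := by
        refine le_of_sq_le_sq ?_ (by linarith)
        rw [mul_pow, hts]
        linarith
      nlinarith [norm_nonneg (√lam • v - c)]
    rcases le_total 0 s with h0 | h0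
    · left
      exact main s d h0 rfl rfl
    · right
      have := main (-s) (-d) (by linarith) (by ring) (by simp)
      rwa [sub_neg_eq_add] at this

theorem exists_isFirstEigenpair {J : Matrix (Fin p) (Fin p) ℝ} (hJ : J.IsSymm) (hp : 0 < p) :
    ∃ lam v, IsFirstEigenpair J lam v := by
  have hT : (Matrix.toEuclideanLin J).IsSymmetric := fun a b =>
    inner_toEuclideanLin_of_isSymm hJ a b
  have hnt : Nontrivial (EuclideanSpace ℝ (Fin p)) := by
    have : Nonempty (Fin p) := ⟨⟨0, hp⟩⟩
    infer_instance
  have h1 := hT.hasEigenvalue_iSup_of_finiteDimensional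
  set T := Matrix.toEuclideanLin J
  have hfin : {lam | Module.End.HasEigenvalue T lam}.Finite :=
    Module.End.finite_hasEigenvalue T
  obtain ⟨lam, hlam, hmax⟩ := Set.exists_max_image _ id hfin ⟨_, h1⟩
  obtain ⟨w, hw⟩ := Module.End.HasEigenvalue.exists_hasEigenvector hlam
  have hwn : ‖w‖ ≠ 0 := norm_ne_zero_iff.2 hw.2
  refine ⟨lam, ‖w‖⁻¹ • w, ?_, ⟨?_, ?_⟩, fun lam' h => hmax lam' h⟩
  · simp [norm_smul, hwn]
  · exact Submodule.smul_mem _ _ hw.1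
  · exact smul_ne_zero (inv_ne_zero hwn) hw.2

end Geometry

end MixedRegression

namespace MixedRegression

/-! ### Equivalent forms of sub-Gaussian tails -/

section SubGaussian

variable {Ω : Type*} [MeasurableSpace Ω] {P : Measure Ω} {X : Ω → ℝ}

theorem lintegral_pow_le_of_subGaussianNorm_le {L : ℝ} (hL : 0 ≤ L)
    (h : subGaussianNorm P X ≤ ENNReal.ofReal L) {k : ℕ} (hk : 1 ≤ k) :
    ∫⁻ ω, ENNReal.ofReal ((X ω ^ 2) ^ k) ∂P ≤ ENNReal.ofReal ((2 * k * L ^ 2) ^ k) := by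
  have hk1 : (1 : ℝ) ≤ k := by exact_mod_cast hk
  have hq : (1 : ℝ) ≤ 2 * k := by linarith
  have hq0 : (0 : ℝ) < 2 * k := by linarith
  have h1 : eLpNorm X (ENNReal.ofReal (2 * k)) P / ENNReal.ofReal √(2 * k) ≤ ENNReal.ofReal L :=
    (le_iSup₂ (f := fun (q : ℝ) (_ : 1 ≤ q) =>
      eLpNorm X (ENNReal.ofReal q) P / ENNReal.ofReal √q) (2 * (k : ℝ)) hq).trans h
  rw [ENNReal.div_le_iff (by simpa using hq0) ENNReal.ofReal_ne_top,
    ← ENNReal.ofReal_mul hL, eLpNorm_eq_lintegral_rpow_enorm_toReal (ENNReal.ofReal_pos.2 hq0).ne'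
    ENNReal.ofReal_ne_top, ENNReal.toReal_ofReal hq0.le] at h1
  have h2 := ENNReal.rpow_le_rpow h1 hq0.le
  rw [← ENNReal.rpow_mul, one_div_mul_cancel hq0.ne', ENNReal.rpow_one,
    ENNReal.ofReal_rpow_of_nonneg (by positivity) hq0.le] at h2
  have e1 : ∀ y : ℝ, ‖y‖ₑ ^ (2 * (k : ℝ)) = ENNReal.ofReal ((y ^ 2) ^ k) := by
    intro y
    rw [Real.enorm_eq_ofReal_abs, ENNReal.ofReal_rpow_of_nonneg (abs_nonneg y) hq0.le]
    congr 1
    rw [show (2 * (k : ℝ)) = ((2 * k : ℕ) : ℝ) by push_cast; ring, Real.rpow_natCast, pow_mul, sq_abs]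
  have e2 : (L * √(2 * k)) ^ (2 * (k : ℝ)) = (2 * k * L ^ 2) ^ k := by
    rw [show (2 * (k : ℝ)) = ((2 * k : ℕ) : ℝ) by push_cast; ring, Real.rpow_natCast, pow_mul,
      mul_pow, Real.sq_sqrt (by positivity)]
    push_cast
    ring
  simp_rw [e1] at h2
  rwa [e2] at h2

/-- In the power series of the exponential, the moment bound and `k^k / k! ≤ e^k` bound the `k`-th
term by `(2 c e L²)^k = 2^{-k}`; the constant `1 / (4 e L²)` is chosen for this. -/
theorem lintegral_exp_sq_le_of_subGaussianNorm_le [IsProbabilityMeasure P] (hX : Measurable X)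
    {L : ℝ} (hL : 0 < L) (h : subGaussianNorm P X ≤ ENNReal.ofReal L) :
    ∫⁻ ω, ENNReal.ofReal (Real.exp (1 / (4 * Real.exp 1 * L ^ 2) * X ω ^ 2)) ∂P ≤ 2 := by
  set c : ℝ := 1 / (4 * Real.exp 1 * L ^ 2) with hc
  have hc0 : 0 < c := by positivity
  have hexp : ∀ y : ℝ, 0 ≤ y → ENNReal.ofReal (Real.exp y) =
      ∑' k : ℕ, ENNReal.ofReal (y ^ k / k.factorial) := by
    intro y hy
    rw [Real.exp_eq_exp_ℝ, NormedSpace.exp_eq_tsum_div]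
    exact ENNReal.ofReal_tsum_of_nonneg (fun k => by positivity) (Real.summable_pow_div_factorial y)
  have hterm : ∀ k : ℕ, ∫⁻ ω, ENNReal.ofReal ((c * X ω ^ 2) ^ k / k.factorial) ∂P ≤
      ENNReal.ofReal ((1 / 2) ^ k) := by
    intro k
    rcases Nat.eq_zero_or_pos k with rfl | hk
    · simp
    have e : ∀ ω, ENNReal.ofReal ((c * X ω ^ 2) ^ k / k.factorial) =
        ENNReal.ofReal (c ^ k / k.factorial) * ENNReal.ofReal ((X ω ^ 2) ^ k) := fun ω => by
      rw [← ENNReal.ofReal_mul (by positivity)]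
      congr 1
      rw [mul_pow]
      ring
    simp_rw [e]
    rw [lintegral_const_mul _ (by fun_prop)]
    refine (mul_le_mul_right (lintegral_pow_le_of_subGaussianNorm_le hL.le h hk) _).trans ?_
    rw [← ENNReal.ofReal_mul (by positivity)]
    refine ENNReal.ofReal_le_ofReal ?_
    have h1 := Real.pow_div_factorial_le_exp (x := (k : ℝ)) (by positivity) k
    have h2 : c ^ k / k.factorial * (2 * k * L ^ 2) ^ k =
        (2 * c * L ^ 2) ^ k * ((k : ℝ) ^ k / k.factorial) := by
      simp only [mul_pow]
      ring
    have h3 : (1 / 2 : ℝ) ^ k = (2 * c * L ^ 2) ^ k * Real.exp k := by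
      rw [show (k : ℝ) = k * 1 by ring, Real.exp_nat_mul, ← mul_pow]
      congr 1
      rw [hc]
      field_simp
      norm_num
    rw [h2, h3]
    exact mul_le_mul_of_nonneg_left h1 (by positivity)
  calc ∫⁻ ω, ENNReal.ofReal (Real.exp (c * X ω ^ 2)) ∂P
      = ∫⁻ ω, ∑' k : ℕ, ENNReal.ofReal ((c * X ω ^ 2) ^ k / k.factorial) ∂P :=
        lintegral_congr fun ω => hexp _ (by positivity)
    _ = ∑' k : ℕ, ∫⁻ ω, ENNReal.ofReal ((c * X ω ^ 2) ^ k / k.factorial) ∂P :=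
        lintegral_tsum fun k => by fun_prop
    _ ≤ ∑' k : ℕ, ENNReal.ofReal ((1 / 2) ^ k) := ENNReal.tsum_le_tsum hterm
    _ = 2 := by
        rw [← ENNReal.ofReal_tsum_of_nonneg (fun k => by positivity) summable_geometric_two,
          tsum_geometric_two]
        simp

theorem exp_le_one_add_add_sq_mul_exp_abs (x : ℝ) :
    Real.exp x ≤ 1 + x + x ^ 2 * Real.exp |x| := by
  have h := Complex.norm_exp_sub_sum_le_norm_mul_exp (x : ℂ) 2
  have e : Complex.exp (x : ℂ) - ∑ m ∈ Finset.range 2, (x : ℂ) ^ m / m.factorial =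
      ((Real.exp x - (1 + x) : ℝ) : ℂ) := by
    simp [Finset.sum_range_succ]
  rw [e, Complex.norm_real, Complex.norm_real, Real.norm_eq_abs, Real.norm_eq_abs, sq_abs] at h
  linarith [(abs_le.1 h).2]

/-- In `exp x ≤ 1 + x + x² exp |x|` the linear term has mean zero. With `|t x| ≤ t²/c + c x²/2` and
`s = t²/c`, the remainder is at most `4 s e^s`, and `1 + 4 s e^s ≤ e^{9s}`, which gives `18 / c`. -/
theorem mgf_le_of_lintegral_exp_sq_le [IsProbabilityMeasure P] (hX : Measurable X) {c : ℝ}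
    (hc : 0 < c) (h : ∫⁻ ω, ENNReal.ofReal (Real.exp (c * X ω ^ 2)) ∂P ≤ 2)
    (hmean : ∫ ω, X ω ∂P = 0) :
    HasSubgaussianMGF X (Real.toNNReal (18 / c)) P := by
  have hI : Integrable (fun ω => Real.exp (c * X ω ^ 2)) P := by
    refine ⟨by fun_prop, ?_⟩
    rw [hasFiniteIntegral_iff_ofReal (Filter.Eventually.of_forall fun _ => (Real.exp_pos _).le)]
    exact h.trans_lt (by simp)
  have hI2 : ∫ ω, Real.exp (c * X ω ^ 2) ∂P ≤ 2 := by
    rw [integral_eq_lintegral_of_nonneg_ae (Filter.Eventually.of_forall fun _ => (Real.exp_pos _).le)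
      (by fun_prop)]
    exact ENNReal.toReal_le_of_le_ofReal (by norm_num) (h.trans (by simp))
  have hpt : ∀ t x : ℝ, |t * x| ≤ t ^ 2 / c + c * x ^ 2 / 2 := by
    intro t x
    have h1 : t ^ 2 / c * c = t ^ 2 := div_mul_cancel₀ _ hc.ne'
    have h2 : 0 ≤ (|t| - c * |x|) ^ 2 / c + t ^ 2 / c := by positivity
    have h3 : (|t| - c * |x|) ^ 2 / c + t ^ 2 / c = 2 * (t ^ 2 / c) - 2 * |t * x| + c * x ^ 2 := by
      rw [abs_mul]
      field_simp
      rw [sub_sq, mul_pow, sq_abs, sq_abs]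
      ring
    linarith
  have hsq : ∀ x : ℝ, x ^ 2 * Real.exp (c * x ^ 2 / 2) ≤ 2 / c * Real.exp (c * x ^ 2) := by
    intro x
    have h1 := Real.add_one_le_exp (c * x ^ 2 / 2)
    have h2 : Real.exp (c * x ^ 2) = Real.exp (c * x ^ 2 / 2) * Real.exp (c * x ^ 2 / 2) := by
      rw [← Real.exp_add]
      ring_nf
    have h3 : x ^ 2 ≤ 2 / c * Real.exp (c * x ^ 2 / 2) := by
      rw [div_mul_eq_mul_div, le_div_iff₀ hc]
      linarith
    rw [h2, ← mul_assoc]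
    exact mul_le_mul_of_nonneg_right h3 (Real.exp_pos _).le
  have hXi : Integrable X P := by
    refine (hI.const_mul (1 + 1 / c)).mono' hX.aestronglyMeasurable
      (Filter.Eventually.of_forall fun ω => ?_)
    have h1 := Real.add_one_le_exp (c * X ω ^ 2)
    have h2 := hpt 1 (X ω)
    rw [one_mul, one_pow] at h2
    have h3 : 0 ≤ 1 / c := by positivity
    have h4 : 0 ≤ c * X ω ^ 2 := by positivity
    rw [Real.norm_eq_abs]
    nlinarith
  have hbound : ∀ t ω, Real.exp (t * X ω) ≤
      1 + t * X ω + t ^ 2 * (2 / c * Real.exp (t ^ 2 / c)) * Real.exp (c * X ω ^ 2) := by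
    intro t ω
    refine (exp_le_one_add_add_sq_mul_exp_abs _).trans (add_le_add le_rfl ?_)
    have h1 : Real.exp |t * X ω| ≤ Real.exp (t ^ 2 / c) * Real.exp (c * X ω ^ 2 / 2) := by
      rw [← Real.exp_add]
      exact Real.exp_le_exp.2 (hpt t _)
    calc (t * X ω) ^ 2 * Real.exp |t * X ω|
        ≤ (t * X ω) ^ 2 * (Real.exp (t ^ 2 / c) * Real.exp (c * X ω ^ 2 / 2)) := by gcongr
      _ = t ^ 2 * Real.exp (t ^ 2 / c) * (X ω ^ 2 * Real.exp (c * X ω ^ 2 / 2)) := by ring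
      _ ≤ t ^ 2 * Real.exp (t ^ 2 / c) * (2 / c * Real.exp (c * X ω ^ 2)) :=
          mul_le_mul_of_nonneg_left (hsq _) (by positivity)
      _ = _ := by ring
  have hJ : ∀ t, Integrable (fun ω => 1 + t * X ω +
      t ^ 2 * (2 / c * Real.exp (t ^ 2 / c)) * Real.exp (c * X ω ^ 2)) P := fun t =>
    ((integrable_const 1).add (hXi.const_mul t)).add (hI.const_mul _)
  have hE : ∀ t, Integrable (fun ω => Real.exp (t * X ω)) P := fun t =>
    (hJ t).mono' (by fun_prop) (Filter.Eventually.of_forall fun ω => by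
      rw [Real.norm_eq_abs, Real.abs_exp]
      exact hbound t ω)
  refine ⟨hE, fun t => ?_⟩
  have h1 : mgf X P t ≤ 1 + t ^ 2 * (2 / c * Real.exp (t ^ 2 / c)) * 2 := by
    refine (integral_mono (hE t) (hJ t) (hbound t)).trans ?_
    have hA : Integrable (fun ω => 1 + t * X ω) P := (integrable_const 1).add (hXi.const_mul t)
    rw [integral_add hA (hI.const_mul _), integral_add (integrable_const 1) (hXi.const_mul t), integral_const_mul, integral_const_mul,
      hmean, integral_const, probReal_univ, one_smul, mul_zero, add_zero]
    gcongr
  refine h1.trans ?_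
  rw [Real.coe_toNNReal _ (by positivity)]
  set s := t ^ 2 / c with hs
  have hs0 : 0 ≤ s := by positivity
  have e1 : 1 + t ^ 2 * (2 / c * Real.exp s) * 2 = 1 + 4 * s * Real.exp s := by
    rw [hs]
    ring
  have e2 : 18 / c * t ^ 2 / 2 = 8 * s + s := by
    rw [hs]
    ring
  rw [e1, e2, Real.exp_add]
  have h2 := Real.add_one_le_exp (8 * s)
  have h3 := Real.one_le_exp hs0
  nlinarith

/-- Gaussian linearization: `exp (y² / (4s))` is the mean of `exp (r g y)` over a standard normal
`g`, with `r² = 1 / (2s)`. After exchanging the integrals, the hypothesis leaves the mean of `exp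
(g² / 4)`, which is `√2`. -/
theorem lintegral_exp_mul_sq_le_of_mgf_le [IsProbabilityMeasure P] {Y : Ω → ℝ} (hY : Measurable Y)
    {s : ℝ} (hs : 0 < s) (hint : ∀ t, Integrable (fun ω => Real.exp (t * Y ω)) P)
    (h : ∀ t, mgf Y P t ≤ Real.exp (s * t ^ 2 / 2)) :
    ∫⁻ ω, ENNReal.ofReal (Real.exp (1 / (4 * s) * Y ω ^ 2)) ∂P ≤ 2 := by
  set γ := gaussianReal 0 1 with hγ
  set r : ℝ := √(1 / (2 * s)) with hr
  have hr2 : r ^ 2 = 1 / (2 * s) := Real.sq_sqrt (by positivity)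
  have e1 : ∀ y : ℝ, ENNReal.ofReal (Real.exp (1 / (4 * s) * y ^ 2)) =
      ∫⁻ g, ENNReal.ofReal (Real.exp (r * g * y)) ∂γ := by
    intro y
    have h1 := congrFun (mgf_fun_id_gaussianReal (μ := 0) (v := 1)) (r * y)
    simp only [mgf] at h1
    have h2 := integrable_exp_mul_gaussianReal (μ := 0) (v := 1) (r * y)
    rw [show (∫⁻ g, ENNReal.ofReal (Real.exp (r * g * y)) ∂γ) =
      ∫⁻ g, ENNReal.ofReal (Real.exp (r * y * g)) ∂γ from
        lintegral_congr fun g => by rw [mul_right_comm], ← ofReal_integral_eq_lintegral_ofReal h2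
        (Filter.Eventually.of_forall fun _ => (Real.exp_pos _).le), h1]
    congr 2
    rw [mul_pow, hr2]
    push_cast
    field_simp
    ring
  have e2 : ∀ g : ℝ, ∫⁻ ω, ENNReal.ofReal (Real.exp (r * g * Y ω)) ∂P ≤
      ENNReal.ofReal (Real.exp (g ^ 2 / 4)) := by
    intro g
    rw [← ofReal_integral_eq_lintegral_ofReal (hint _)
      (Filter.Eventually.of_forall fun _ => (Real.exp_pos _).le)]
    refine ENNReal.ofReal_le_ofReal ((h (r * g)).trans (le_of_eq ?_))
    congr 1
    rw [mul_pow, hr2]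
    field_simp
    ring
  simp_rw [e1]
  rw [lintegral_lintegral_swap (by fun_prop)]
  refine (lintegral_mono e2).trans ?_
  rw [hγ, gaussianReal_of_var_ne_zero _ one_ne_zero,
    lintegral_withDensity_eq_lintegral_mul _ (measurable_gaussianPDF 0 1) (by fun_prop)]
  have e3 : ∀ g : ℝ, (gaussianPDF 0 1 * fun g => ENNReal.ofReal (Real.exp (g ^ 2 / 4))) g =
      ENNReal.ofReal ((√(2 * Real.pi))⁻¹ * Real.exp (-(1 / 4) * g ^ 2)) := by
    intro g
    rw [Pi.mul_apply, gaussianPDF, ← ENNReal.ofReal_mul (gaussianPDFReal_nonneg _ _ _)]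
    congr 1
    simp only [gaussianPDFReal, NNReal.coe_one, mul_one, sub_zero]
    rw [mul_assoc, ← Real.exp_add]
    ring_nf
  simp_rw [e3]
  have hG := (integrable_exp_neg_mul_sq (by norm_num : (0 : ℝ) < 1 / 4)).const_mul
    (√(2 * Real.pi))⁻¹
  rw [← ofReal_integral_eq_lintegral_ofReal hG
    (Filter.Eventually.of_forall fun _ => by positivity), integral_const_mul, integral_gaussian]
  refine ENNReal.ofReal_le_of_le_toReal ?_
  rw [ENNReal.toReal_ofNat, inv_mul_le_iff₀ (by positivity)]
  refine Real.sqrt_le_iff.2 ⟨by positivity, ?_⟩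
  rw [mul_pow, Real.sq_sqrt (by positivity)]
  have := Real.pi_pos
  linarith

end SubGaussian

end MixedRegression

namespace MixedRegression

/-! ### Fourth against second moments of quadratic forms -/

section Moments

variable {Ω : Type*} [MeasurableSpace Ω] {P : Measure Ω}

/-- A measurable function with finite moments of all orders. -/
structure HasMoments (P : Measure Ω) (f : Ω → ℝ) : Prop where
  measurable : Measurable f
  memLp : ∀ q : NNReal, MemLp f q P

namespace HasMoments

variable {f g : Ω → ℝ}

theorem add (hf : HasMoments P f) (hg : HasMoments P g) : HasMoments P fun ω => f ω + g ω :=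
  ⟨hf.1.add hg.1, fun q => (hf.2 q).add (hg.2 q)⟩

theorem const_mul (hf : HasMoments P f) (c : ℝ) : HasMoments P fun ω => c * f ω :=
  ⟨hf.1.const_mul c, fun q => (hf.2 q).const_mul c⟩

theorem const [IsProbabilityMeasure P] (c : ℝ) : HasMoments P fun _ : Ω => c :=
  ⟨measurable_const, fun _ => memLp_const c⟩

theorem mul (hf : HasMoments P f) (hg : HasMoments P g) : HasMoments P fun ω => f ω * g ω := by
  refine ⟨hf.1.mul hg.1, fun q => ?_⟩
  have : ENNReal.HolderTriple ((2 * q : NNReal) : ℝ≥0∞) ((2 * q : NNReal) : ℝ≥0∞) (q : ℝ≥0∞) := by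
    constructor
    rcases eq_or_ne q 0 with rfl | hq
    · simp
    · rw [← ENNReal.coe_inv (by simpa using hq), ← ENNReal.coe_inv hq, ← ENNReal.coe_add]
      congr 1
      field_simp
      norm_num
  exact MemLp.mul (hg.2 (2 * q)) (hf.2 (2 * q))

theorem pow [IsProbabilityMeasure P] (hf : HasMoments P f) (k : ℕ) :
    HasMoments P fun ω => f ω ^ k := by
  induction k with
  | zero => simpa using const 1
  | succ k ih => simpa only [pow_succ] using ih.mul hf

theorem sum [IsProbabilityMeasure P] {ι : Type*} {F : ι → Ω → ℝ} (S : Finset ι)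
    (h : ∀ i, HasMoments P (F i)) : HasMoments P fun ω => ∑ i ∈ S, F i ω := by
  classical
  induction S using Finset.induction_on with
  | empty => simpa using const 0
  | insert i S hi ih => simpa only [Finset.sum_insert hi] using (h i).add ih

theorem integrable (hf : HasMoments P f) : Integrable f P :=
  memLp_one_iff_integrable.1 (by simpa using hf.2 1)

end HasMoments

theorem integral_mul_le_of_sq_le {f g : Ω → ℝ} (hf : MemLp f 2 P) (hg : MemLp g 2 P) {b : ℝ}
    (hb : 0 ≤ b) (h : (∫ ω, f ω ^ 2 ∂P) * (∫ ω, g ω ^ 2 ∂P) ≤ b ^ 2) :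
    ∫ ω, f ω * g ω ∂P ≤ b := by
  have h1 := integral_mul_le_Lp_mul_Lq_of_nonneg (μ := P) (f := fun ω => |f ω|) (g := fun ω => |g ω|)
    Real.HolderConjugate.two_two (Filter.Eventually.of_forall fun _ => abs_nonneg _)
    (Filter.Eventually.of_forall fun _ => abs_nonneg _) (by simpa using hf.norm) (by simpa using hg.norm)
  simp only [Real.rpow_two, sq_abs] at h1
  have h2 : ∫ ω, f ω * g ω ∂P ≤ ∫ ω, |f ω| * |g ω| ∂P := by
    refine integral_mono (hf.integrable_mul hg) ?_ fun ω => ?_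
    · simpa [abs_mul] using (hf.integrable_mul hg).abs
    · rw [← abs_mul]
      exact le_abs_self _
  refine h2.trans (h1.trans ?_)
  rw [← Real.sqrt_eq_rpow, ← Real.sqrt_eq_rpow, ← Real.sqrt_mul (integral_nonneg fun _ => sq_nonneg _)]
  exact Real.sqrt_le_iff.2 ⟨hb, h⟩

/-- The term linear in `s + t` is kept exactly, because it integrates to zero in `moments_add_step`;
the rest is bounded by even powers. -/
theorem add_add_pow_four_le (a s t : ℝ) :
    (a + s + t) ^ 4 ≤ a ^ 4 + 4 * a ^ 3 * (s + t) + 16 * a ^ 2 * (s ^ 2 + t ^ 2) +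
      24 * (s ^ 4 + t ^ 4) := by
  have h1 : (a + (s + t)) ^ 4 ≤ a ^ 4 + 4 * a ^ 3 * (s + t) + 8 * a ^ 2 * (s + t) ^ 2 +
      3 * (s + t) ^ 4 := by
    have h := mul_nonneg (sq_nonneg (s + t)) (sq_nonneg (a - (s + t)))
    have e : a ^ 4 + 4 * a ^ 3 * (s + t) + 8 * a ^ 2 * (s + t) ^ 2 + 3 * (s + t) ^ 4 -
        (a + (s + t)) ^ 4 = 2 * ((s + t) ^ 2 * (a - (s + t)) ^ 2) := by ring
    linarith
  have h2 : (s + t) ^ 2 ≤ 2 * (s ^ 2 + t ^ 2) := add_sq_le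
  have h3 : (s + t) ^ 4 ≤ 8 * (s ^ 4 + t ^ 4) := by
    have h4 : ((s + t) ^ 2) ^ 2 ≤ (2 * (s ^ 2 + t ^ 2)) ^ 2 :=
      pow_le_pow_left₀ (sq_nonneg _) h2 2
    have h5 : (s ^ 2 + t ^ 2) ^ 2 ≤ 2 * ((s ^ 2) ^ 2 + (t ^ 2) ^ 2) := add_sq_le
    rw [← pow_mul] at h4
    rw [← pow_mul, ← pow_mul] at h5
    norm_num [mul_pow] at h4 h5
    linarith
  have h5 := mul_le_mul_of_nonneg_left h2 (by positivity : 0 ≤ 8 * a ^ 2)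
  rw [add_assoc a]
  linarith

/-- The arithmetic that closes the induction on the number of variables with an unchanged constant
`K`. -/
theorem four_moment_sum_le {K A B D x y z : ℝ} (hK : 8 ≤ K) (hA : 0 ≤ A) (hB : 0 ≤ B) (hD : 0 ≤ D)
    (hx : x ≤ K * A ^ 2) (hy : y ≤ K / 16 * (A * B)) (hz : z ≤ K * B ^ 2) :
    x + 16 * y + 16 * (A * D) + z + K * D ^ 2 ≤ K * (A + B + D) ^ 2 := by
  have hAD := mul_le_mul_of_nonneg_right hK (mul_nonneg hA hD)
  have hK0 : 0 ≤ K := by linarith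
  have hAB := mul_nonneg hK0 (mul_nonneg hA hB)
  have hBD := mul_nonneg hK0 (mul_nonneg hB hD)
  have e : K * (A + B + D) ^ 2 = K * A ^ 2 + K * B ^ 2 + K * D ^ 2 + 2 * (K * (A * B)) +
      2 * (K * (A * D)) + 2 * (K * (B * D)) := by ring
  rw [e]
  linarith

/-- Adding one independent variable to a quadratic polynomial preserves the comparison of its
fourth and second moments. -/
theorem moments_add_step [IsProbabilityMeasure P] {U a l : Ω → ℝ} (hU : HasMoments P U)
    (ha : HasMoments P a) (hl : HasMoments P l) (hind : IndepFun U (fun ω => (a ω, l ω)) P)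
    {μ W K₁ K z : ℝ} (hμ : 1 < μ) (hU1 : ∫ ω, U ω ∂P = 0) (hU2 : ∫ ω, U ω ^ 2 ∂P = 1)
    (hU4 : ∫ ω, U ω ^ 4 ∂P = μ) (hW : ∫ ω, (U ω ^ 2 - 1) ^ 4 ∂P ≤ W) (hl1 : ∫ ω, l ω ∂P = 0)
    (hl4 : ∫ ω, l ω ^ 4 ∂P ≤ K₁ * (∫ ω, l ω ^ 2 ∂P) ^ 2)
    (ha4 : ∫ ω, a ω ^ 4 ∂P ≤ K * (∫ ω, a ω ^ 2 ∂P) ^ 2) (hKa : 256 * K₁ ≤ K) (hKb : 8 ≤ K)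
    (hKc : 24 * μ * K₁ ≤ K) (hKd : 24 * W ≤ K * (μ - 1) ^ 2) :
    ∫ ω, (a ω + U ω * l ω + z * (U ω ^ 2 - 1)) ^ 2 ∂P =
        (∫ ω, a ω ^ 2 ∂P) + (∫ ω, l ω ^ 2 ∂P) + z ^ 2 * (μ - 1) ∧
      ∫ ω, (a ω + U ω * l ω + z * (U ω ^ 2 - 1)) ^ 4 ∂P ≤
        K * (∫ ω, (a ω + U ω * l ω + z * (U ω ^ 2 - 1)) ^ 2 ∂P) ^ 2 := by
  have hw : HasMoments P fun ω => U ω ^ 2 - 1 := by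
    simpa only [sub_eq_add_neg] using (hU.pow 2).add (HasMoments.const (-1))
  have key : ∀ (f : ℝ → ℝ) (g : ℝ × ℝ → ℝ), Measurable f → Measurable g →
      ∫ ω, f (U ω) * g (a ω, l ω) ∂P = (∫ ω, f (U ω) ∂P) * ∫ ω, g (a ω, l ω) ∂P := by
    intro f g hf hg
    have := hind.comp hf hg
    exact this.integral_fun_mul_eq_mul_integral (hf.comp hU.1).aestronglyMeasurable
      (hg.comp (ha.1.prodMk hl.1)).aestronglyMeasurable
  have hw1 : ∫ ω, (U ω ^ 2 - 1) ∂P = 0 := by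
    rw [integral_sub (hU.pow 2).integrable (integrable_const 1), hU2]
    simp
  have hw2 : ∫ ω, (U ω ^ 2 - 1) ^ 2 ∂P = μ - 1 := by
    have e : ∀ ω, (U ω ^ 2 - 1) ^ 2 = U ω ^ 4 - 2 * U ω ^ 2 + 1 := fun ω => by ring
    simp_rw [e]
    have hsub : Integrable (fun ω => U ω ^ 4 - 2 * U ω ^ 2) P :=
      (hU.pow 4).integrable.sub ((hU.pow 2).const_mul 2).integrable
    rw [integral_add hsub (integrable_const 1), integral_sub (hU.pow 4).integrable ((hU.pow 2).const_mul 2).integrable,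
      integral_const_mul, hU2, hU4]
    simp
    ring
  have k1 := key (fun u => u ^ 2) (fun q => q.2 ^ 2) (by fun_prop) (by fun_prop)
  have k2 := key (fun u => u) (fun q => q.1 * q.2) (by fun_prop) (by fun_prop)
  have k3 := key (fun u => u ^ 2 - 1) (fun q => q.1) (by fun_prop) (by fun_prop)
  have k4 := key (fun u => u * (u ^ 2 - 1)) (fun q => q.2) (by fun_prop) (by fun_prop)
  have k5 := key (fun u => u) (fun q => q.1 ^ 3 * q.2) (by fun_prop) (by fun_prop)
  have k6 := key (fun u => u ^ 2 - 1) (fun q => q.1 ^ 3) (by fun_prop) (by fun_prop)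
  have k7 := key (fun u => u ^ 2) (fun q => q.1 ^ 2 * q.2 ^ 2) (by fun_prop) (by fun_prop)
  have k8 := key (fun u => (u ^ 2 - 1) ^ 2) (fun q => q.1 ^ 2) (by fun_prop) (by fun_prop)
  have k9 := key (fun u => u ^ 4) (fun q => q.2 ^ 4) (by fun_prop) (by fun_prop)
  simp only [hU1, hU2, hU4, hw1, hw2, hl1, zero_mul, mul_zero, one_mul] at k1 k2 k3 k4 k5 k6 k7 k8 k9
  set A := ∫ ω, a ω ^ 2 ∂P with hA
  set B := ∫ ω, l ω ^ 2 ∂P with hB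
  have hA0 : 0 ≤ A := integral_nonneg fun _ => sq_nonneg _
  have hB0 : 0 ≤ B := integral_nonneg fun _ => sq_nonneg _
  have hK0 : 0 ≤ K := by linarith
  have hsecond : ∫ ω, (a ω + U ω * l ω + z * (U ω ^ 2 - 1)) ^ 2 ∂P = A + B + z ^ 2 * (μ - 1) := by
    have e : ∀ ω, (a ω + U ω * l ω + z * (U ω ^ 2 - 1)) ^ 2 =
        a ω ^ 2 + U ω ^ 2 * l ω ^ 2 + z ^ 2 * (U ω ^ 2 - 1) ^ 2 + 2 * (U ω * (a ω * l ω)) +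
          2 * z * ((U ω ^ 2 - 1) * a ω) + 2 * z * (U ω * (U ω ^ 2 - 1) * l ω) := fun ω => by ring
    have i1 := (ha.pow 2)
    have i2 := ((hU.pow 2).mul (hl.pow 2))
    have i3 := (hw.pow 2).const_mul (z ^ 2)
    have i4 := (hU.mul (ha.mul hl)).const_mul 2
    have i5 := (hw.mul ha).const_mul (2 * z)
    have i6 := ((hU.mul hw).mul hl).const_mul (2 * z)
    simp_rw [e]
    rw [integral_add ((((i1.add i2).add i3).add i4).add i5).integrable i6.integrable,
      integral_add (((i1.add i2).add i3).add i4).integrable i5.integrable,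
      integral_add ((i1.add i2).add i3).integrable i4.integrable,
      integral_add (i1.add i2).integrable i3.integrable, integral_add i1.integrable i2.integrable,
      integral_const_mul, integral_const_mul, integral_const_mul, integral_const_mul, k1, k2, k3, k4,
      hw2]
    ring
  refine ⟨hsecond, ?_⟩
  rw [hsecond]
  -- Cauchy-Schwarz, since `a` and `l` are dependent. The condition `256 * K₁ ≤ K` makes the
  -- constant `√(K * K₁)` at most `K / 16`, so that after the coefficient `16` it still fits into `K
  -- (A + B + D)²`.
  have hcross : ∫ ω, a ω ^ 2 * l ω ^ 2 ∂P ≤ K / 16 * (A * B) := by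
    refine integral_mul_le_of_sq_le (by simpa using (ha.pow 2).2 2) (by simpa using (hl.pow 2).2 2)
      (by positivity) ?_
    have e1 : ∀ y : ℝ, (y ^ 2) ^ 2 = y ^ 4 := fun y => by ring
    simp_rw [e1]
    calc (∫ ω, a ω ^ 4 ∂P) * ∫ ω, l ω ^ 4 ∂P ≤ (K * A ^ 2) * (K₁ * B ^ 2) :=
          mul_le_mul ha4 hl4 (integral_nonneg fun _ => by positivity) (by positivity)
      _ ≤ (K * A ^ 2) * (K / 256 * B ^ 2) := by
          gcongr
          linarith
      _ = _ := by ring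
  have hpt : ∀ ω, (a ω + U ω * l ω + z * (U ω ^ 2 - 1)) ^ 4 ≤
      a ω ^ 4 + 4 * (U ω * (a ω ^ 3 * l ω)) + 4 * z * ((U ω ^ 2 - 1) * a ω ^ 3) +
        16 * (U ω ^ 2 * (a ω ^ 2 * l ω ^ 2)) + 16 * z ^ 2 * ((U ω ^ 2 - 1) ^ 2 * a ω ^ 2) +
          24 * (U ω ^ 4 * l ω ^ 4) + 24 * z ^ 4 * (U ω ^ 2 - 1) ^ 4 := by
    intro ω
    refine (add_add_pow_four_le (a ω) (U ω * l ω) (z * (U ω ^ 2 - 1))).trans (le_of_eq ?_)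
    ring
  have j1 := ha.pow 4
  have j2 := (hU.mul ((ha.pow 3).mul hl)).const_mul 4
  have j3 := (hw.mul (ha.pow 3)).const_mul (4 * z)
  have j4 := ((hU.pow 2).mul ((ha.pow 2).mul (hl.pow 2))).const_mul 16
  have j5 := ((hw.pow 2).mul (ha.pow 2)).const_mul (16 * z ^ 2)
  have j6 := ((hU.pow 4).mul (hl.pow 4)).const_mul 24
  have j7 := (hw.pow 4).const_mul (24 * z ^ 4)
  have hY := ((ha.add (hU.mul hl)).add (hw.const_mul z)).pow 4
  refine (integral_mono hY.integrable
    ((((((j1.add j2).add j3).add j4).add j5).add j6).add j7).integrable hpt).trans ?_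
  rw [integral_add (((((j1.add j2).add j3).add j4).add j5).add j6).integrable j7.integrable,
    integral_add ((((j1.add j2).add j3).add j4).add j5).integrable j6.integrable,
    integral_add (((j1.add j2).add j3).add j4).integrable j5.integrable,
    integral_add ((j1.add j2).add j3).integrable j4.integrable,
    integral_add (j1.add j2).integrable j3.integrable, integral_add j1.integrable j2.integrable,
    integral_const_mul, integral_const_mul, integral_const_mul, integral_const_mul,
    integral_const_mul, integral_const_mul, k5, k6, k7, k8, k9]
  have hD : 24 * z ^ 4 * ∫ ω, (U ω ^ 2 - 1) ^ 4 ∂P ≤ K * (z ^ 2 * (μ - 1)) ^ 2 := by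
    have h1 : 24 * z ^ 4 * ∫ ω, (U ω ^ 2 - 1) ^ 4 ∂P ≤ 24 * z ^ 4 * W := by gcongr
    have h2 := mul_le_mul_of_nonneg_left hKd (by positivity : 0 ≤ z ^ 4)
    nlinarith
  have hB4 : 24 * (μ * ∫ ω, l ω ^ 4 ∂P) ≤ K * B ^ 2 := by
    have h1 := mul_le_mul_of_nonneg_left hl4 (by positivity : 0 ≤ 24 * μ)
    have h2 := mul_le_mul_of_nonneg_right hKc (sq_nonneg B)
    linarith
  set D := z ^ 2 * (μ - 1) with hDdef
  have hD0 : 0 ≤ D := mul_nonneg (sq_nonneg z) (by linarith)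
  have e2 : 16 * z ^ 2 * ((μ - 1) * A) = 16 * (A * D) := by rw [hDdef]; ring
  have hfin := four_moment_sum_le hKb hA0 hB0 hD0 ha4 hcross hB4
  rw [e2]
  linarith

/-- Second and fourth moments of a quadratic form in independent variables. -/
theorem moments_quadratic_form [IsProbabilityMeasure P] {p : ℕ} {X : Fin p → Ω → ℝ}
    (hX : ∀ i, HasMoments P (X i)) (hind : iIndepFun X P) {μ W K₁ K : ℝ} (hμ : 1 < μ)
    (hX1 : ∀ i, ∫ ω, X i ω ∂P = 0) (hX2 : ∀ i, ∫ ω, X i ω ^ 2 ∂P = 1)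
    (hX4 : ∀ i, ∫ ω, X i ω ^ 4 ∂P = μ) (hW : ∀ i, ∫ ω, (X i ω ^ 2 - 1) ^ 4 ∂P ≤ W)
    (hK₁ : 0 ≤ K₁)
    (hlin : ∀ (S : Finset (Fin p)) (v : Fin p → ℝ),
      ∫ ω, (∑ k ∈ S, v k * X k ω) ^ 2 ∂P = ∑ k ∈ S, v k ^ 2 ∧
      ∫ ω, (∑ k ∈ S, v k * X k ω) ^ 4 ∂P ≤ K₁ * (∑ k ∈ S, v k ^ 2) ^ 2)
    (hKa : 256 * K₁ ≤ K) (hKb : 8 ≤ K) (hKc : 24 * μ * K₁ ≤ K) (hKd : 24 * W ≤ K * (μ - 1) ^ 2)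
    {Z : Matrix (Fin p) (Fin p) ℝ} (hZ : Z.IsSymm) (S : Finset (Fin p)) (c : ℝ) :
    min 2 (μ - 1) * (∑ i ∈ S, ∑ j ∈ S, Z i j ^ 2) ≤
        ∫ ω, (c + ∑ i ∈ S, ∑ j ∈ S, Z i j * (X i ω * X j ω)) ^ 2 ∂P ∧
      ∫ ω, (c + ∑ i ∈ S, ∑ j ∈ S, Z i j * (X i ω * X j ω)) ^ 4 ∂P ≤
        K * (∫ ω, (c + ∑ i ∈ S, ∑ j ∈ S, Z i j * (X i ω * X j ω)) ^ 2 ∂P) ^ 2 := by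
  classical
  induction S using Finset.induction_on generalizing c with
  | empty =>
    simp only [Finset.sum_empty, mul_zero, add_zero, integral_const, probReal_univ, one_smul]
    refine ⟨sq_nonneg c, ?_⟩
    nlinarith [sq_nonneg (c ^ 2)]
  | insert m S hm ih =>
    -- A new index `m` contributes `X m * l + Z m m * (X m ^ 2 - 1)`, and the mean `Z m m` of the
    -- diagonal term goes into the constant. This is why the induction runs over all `c`.
    set a : Ω → ℝ := fun ω => (c + Z m m) + ∑ i ∈ S, ∑ j ∈ S, Z i j * (X i ω * X j ω) with ha
    set l : Ω → ℝ := fun ω => ∑ k ∈ S, (2 * Z m k) * X k ω with hl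
    have haM : HasMoments P a := (HasMoments.const _).add
      (HasMoments.sum S fun i => HasMoments.sum S fun j => ((hX i).mul (hX j)).const_mul _)
    have hlM : HasMoments P l := HasMoments.sum S fun k => (hX k).const_mul _
    have hexp : ∀ ω, c + ∑ i ∈ insert m S, ∑ j ∈ insert m S, Z i j * (X i ω * X j ω) =
        a ω + X m ω * l ω + Z m m * (X m ω ^ 2 - 1) := by
      intro ω
      simp only [ha, hl, Finset.sum_insert hm, Finset.sum_add_distrib, Finset.mul_sum]
      have e1 : ∑ i ∈ S, Z i m * (X i ω * X m ω) = ∑ i ∈ S, Z m i * (X m ω * X i ω) :=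
        Finset.sum_congr rfl fun i _ => by rw [hZ.apply m i, mul_comm (X i ω)]
      have e2 : ∑ i ∈ S, X m ω * (2 * Z m i * X i ω) = 2 * ∑ i ∈ S, Z m i * (X m ω * X i ω) := by
        rw [Finset.mul_sum]
        exact Finset.sum_congr rfl fun i _ => by ring
      rw [e1, e2]
      ring
    have hi : IndepFun (X m) (fun ω => (a ω, l ω)) P := by
      have h1 := hind.indepFun_finset {m} S (by simpa using hm) fun i => (hX i).1
      let φ : (S → ℝ) → ℝ × ℝ := fun r =>
        ((c + Z m m) + ∑ i : S, ∑ j : S, Z i j * (r i * r j), ∑ k : S, (2 * Z m k) * r k)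
      have hφ : Measurable φ := by fun_prop
      have hev : Measurable fun r : ({m} : Finset (Fin p)) → ℝ => r ⟨m, by simp⟩ :=
        measurable_pi_apply _
      have h2 := h1.comp hev hφ
      have e : (fun ω => (a ω, l ω)) = φ ∘ fun ω (i : S) => X i ω := by
        refine funext fun ω => Prod.ext ?_ ?_
        · refine congrArg (c + Z m m + ·) ?_
          exact (Finset.sum_congr rfl fun i _ => (Finset.sum_coe_sort S
            fun j => Z i j * (X i ω * X j ω)).symm).trans (Finset.sum_coe_sort S
              fun i => ∑ j : S, Z i j * (X i ω * X j ω)).symm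
        · exact (Finset.sum_coe_sort S fun k => 2 * Z m k * X k ω).symm
      rw [e]
      exact h2
    have hl1 : ∫ ω, l ω ∂P = 0 := by
      rw [hl, integral_finsetSum _ fun k _ => ((hX k).const_mul _).integrable]
      refine Finset.sum_eq_zero fun k _ => ?_
      rw [integral_const_mul, hX1, mul_zero]
    obtain ⟨hl2, hl4⟩ := hlin S fun k => 2 * Z m k
    obtain ⟨ih2, ih4⟩ := ih (c + Z m m)
    have hl4' : ∫ ω, l ω ^ 4 ∂P ≤ K₁ * (∫ ω, l ω ^ 2 ∂P) ^ 2 := by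
      rw [hl, hl2]
      exact hl4
    obtain ⟨s2, s4⟩ := moments_add_step (z := Z m m) (hX m) haM hlM hi hμ (hX1 m) (hX2 m) (hX4 m)
      (hW m) hl1 hl4' ih4 hKa hKb hKc hKd
    simp_rw [hexp]
    refine ⟨?_, s4⟩
    rw [s2, hl, hl2]
    have e3 : ∑ i ∈ insert m S, ∑ j ∈ insert m S, Z i j ^ 2 =
        (∑ i ∈ S, ∑ j ∈ S, Z i j ^ 2) + 2 * (∑ k ∈ S, Z m k ^ 2) + Z m m ^ 2 := by
      simp only [Finset.sum_insert hm, Finset.sum_add_distrib]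
      have : ∑ i ∈ S, Z i m ^ 2 = ∑ i ∈ S, Z m i ^ 2 :=
        Finset.sum_congr rfl fun i _ => by rw [hZ.apply m i]
      rw [this]
      ring
    have e4 : ∑ k ∈ S, (2 * Z m k) ^ 2 = 4 * ∑ k ∈ S, Z m k ^ 2 := by
      rw [Finset.mul_sum]
      exact Finset.sum_congr rfl fun k _ => by ring
    rw [e3, e4]
    -- Off-diagonal entries give variance `4 Z²` against `2 Z²` in the squared Frobenius norm,
    -- diagonal ones `(μ - 1) Z²`; hence the factor `min 2 (μ - 1)`.
    have f1 := mul_le_mul_of_nonneg_right (min_le_left 2 (μ - 1))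
      (Finset.sum_nonneg fun k (_ : k ∈ S) => sq_nonneg (Z m k))
    have f2 := mul_le_mul_of_nonneg_right (min_le_right 2 (μ - 1)) (sq_nonneg (Z m m))
    linarith

/-- A lower bound for a truncated first moment, from the second and the fourth moments. -/
theorem le_integral_min_abs [IsProbabilityMeasure P] {Y : Ω → ℝ} (hY : HasMoments P Y) {A K : ℝ}
    (hA : 0 < A) (hA2 : A ^ 2 ≤ ∫ ω, Y ω ^ 2 ∂P) (hK : 1 ≤ K)
    (h4 : ∫ ω, Y ω ^ 4 ∂P ≤ K * (∫ ω, Y ω ^ 2 ∂P) ^ 2) :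
    A / (4 * K) ≤ ∫ ω, min |Y ω| A ∂P := by
  set V := ∫ ω, Y ω ^ 2 ∂P with hV
  have hV0 : 0 < V := lt_of_lt_of_le (by positivity) hA2
  set s := √V with hs
  have hs2 : s ^ 2 = V := Real.sq_sqrt hV0.le
  have hs0 : 0 < s := Real.sqrt_pos.2 hV0
  have hAs : A ≤ s := Real.le_sqrt_of_sq_le hA2
  -- The truncation is minorized by the polynomial `A (w - w²)`, `w = θ y² / V`. Its mean is at
  -- least `A (θ - θ² K)`, which is largest at this `θ`, with value `A / (4K)`.
  set θ := 1 / (2 * K) with hθ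
  have hθ0 : 0 < θ := by positivity
  have hθ1 : θ ≤ 1 := by
    rw [hθ, div_le_one (by linarith)]
    linarith
  have hpt : ∀ y : ℝ, A * (θ / V * y ^ 2 - θ ^ 2 / V ^ 2 * y ^ 4) ≤ min |y| A := by
    intro y
    set u := |y| / s with hu
    have hu0 : 0 ≤ u := by positivity
    have hyu : |y| = s * u := by rw [hu]; field_simp
    have e2 : y ^ 2 = V * u ^ 2 := by rw [← sq_abs, hyu, mul_pow, hs2]
    have e : θ / V * y ^ 2 - θ ^ 2 / V ^ 2 * y ^ 4 = θ * u ^ 2 - θ ^ 2 * u ^ 4 := by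
      rw [show y ^ 4 = (y ^ 2) ^ 2 by ring, e2]
      field_simp
    rw [e, hyu]
    have hle1 : θ * u ^ 2 - θ ^ 2 * u ^ 4 ≤ 1 := by nlinarith [sq_nonneg (θ * u ^ 2 - 1)]
    have hleu : θ * u ^ 2 - θ ^ 2 * u ^ 4 ≤ u := by
      rcases le_total u 1 with h | h
      · have h1 : θ * u ^ 2 ≤ 1 * u ^ 2 := mul_le_mul_of_nonneg_right hθ1 (sq_nonneg u)
        have h2 : 0 ≤ θ ^ 2 * u ^ 4 := by positivity
        nlinarith
      · exact hle1.trans h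
    refine le_min ?_ ?_
    · exact (mul_le_mul_of_nonneg_left hleu hA.le).trans (mul_le_mul_of_nonneg_right hAs hu0)
    · exact mul_le_of_le_one_right hA.le hle1
  have hmin : Integrable (fun ω => min |Y ω| A) P := by
    refine hY.integrable.abs.mono' (by have := hY.1; fun_prop)
      (Filter.Eventually.of_forall fun ω => ?_)
    rw [Real.norm_eq_abs, abs_of_nonneg (le_min (abs_nonneg _) hA.le)]
    exact min_le_left _ _
  have i1 := (hY.pow 2).const_mul (θ / V)
  have i2 := (hY.pow 4).const_mul (θ ^ 2 / V ^ 2)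
  have h1 := integral_mono ((i1.integrable.sub i2.integrable).const_mul A) hmin fun ω => hpt (Y ω)
  refine le_trans ?_ h1
  simp only [Pi.sub_apply]
  rw [integral_const_mul, integral_sub i1.integrable i2.integrable, integral_const_mul,
    integral_const_mul, ← hV]
  have h2 : θ ^ 2 / V ^ 2 * ∫ ω, Y ω ^ 4 ∂P ≤ θ ^ 2 / V ^ 2 * (K * V ^ 2) := by gcongr
  have h3 : θ / V * V = θ := by field_simp
  have h4 : θ ^ 2 / V ^ 2 * (K * V ^ 2) = θ / 2 := by
    rw [hθ]
    field_simp
  have h5 : A / (4 * K) = A * (θ / 2) := by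
    rw [hθ]
    field_simp
    norm_num
  rw [h5, h3]
  exact mul_le_mul_of_nonneg_left (by linarith) hA.le

end Moments

end MixedRegression

namespace MixedRegression

/-! ### Moments and exponential integrability of the covariates -/

section Design

variable {Ω : Type*} [MeasurableSpace Ω] {P : Measure Ω}

theorem pow_four_le_exp {a y : ℝ} (ha : 0 < a) : y ^ 4 ≤ 2 / a ^ 2 * Real.exp (a * y ^ 2) := by
  have h := Real.quadratic_le_exp_of_nonneg (by positivity : 0 ≤ a * y ^ 2)
  have h2 : 0 ≤ a * y ^ 2 := by positivity
  rw [div_mul_eq_mul_div, le_div_iff₀ (by positivity)]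
  nlinarith

theorem integrable_exp_and_integral_le {Y : Ω → ℝ} (hY : Measurable Y) {a : ℝ}
    (h : ∫⁻ ω, ENNReal.ofReal (Real.exp (a * Y ω ^ 2)) ∂P ≤ 2) :
    Integrable (fun ω => Real.exp (a * Y ω ^ 2)) P ∧ ∫ ω, Real.exp (a * Y ω ^ 2) ∂P ≤ 2 := by
  refine ⟨⟨by fun_prop, ?_⟩, ?_⟩
  · rw [hasFiniteIntegral_iff_ofReal (Filter.Eventually.of_forall fun _ => (Real.exp_pos _).le)]
    exact h.trans_lt (by simp)
  · rw [integral_eq_lintegral_of_nonneg_ae (Filter.Eventually.of_forall fun _ => (Real.exp_pos _).le)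
      (by fun_prop)]
    exact ENNReal.toReal_le_of_le_ofReal (by norm_num) (h.trans (by simp))

theorem integral_pow_four_le {Y : Ω → ℝ} (hY : Measurable Y) {a : ℝ} (ha : 0 < a)
    (h : ∫⁻ ω, ENNReal.ofReal (Real.exp (a * Y ω ^ 2)) ∂P ≤ 2) :
    ∫ ω, Y ω ^ 4 ∂P ≤ 4 / a ^ 2 := by
  obtain ⟨h1, h2⟩ := integrable_exp_and_integral_le hY h
  have h3 : Integrable (fun ω => Y ω ^ 4) P := by
    refine (h1.const_mul (2 / a ^ 2)).mono' (by fun_prop) (Filter.Eventually.of_forall fun ω => ?_)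
    rw [Real.norm_eq_abs, abs_of_nonneg (by positivity)]
    exact pow_four_le_exp ha
  refine (integral_mono h3 (h1.const_mul (2 / a ^ 2)) fun ω => pow_four_le_exp ha).trans ?_
  rw [integral_const_mul]
  have : 2 / a ^ 2 * ∫ ω, Real.exp (a * Y ω ^ 2) ∂P ≤ 2 / a ^ 2 * 2 := by gcongr
  refine this.trans (le_of_eq ?_)
  ring

theorem integral_sq_sub_one_pow_four_le [IsProbabilityMeasure P] {X : Ω → ℝ} (hX : HasMoments P X)
    {c : ℝ} (hc : 0 < c) (h : ∫⁻ ω, ENNReal.ofReal (Real.exp (c * X ω ^ 2)) ∂P ≤ 2) :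
    ∫ ω, (X ω ^ 2 - 1) ^ 4 ∂P ≤ 8 * (48 / c ^ 4 + 1) := by
  obtain ⟨h1, h2⟩ := integrable_exp_and_integral_le hX.1 h
  have hw : HasMoments P fun ω => X ω ^ 2 - 1 := by
    simpa only [sub_eq_add_neg] using (hX.pow 2).add (HasMoments.const (-1))
  have hpt : ∀ ω, (X ω ^ 2 - 1) ^ 4 ≤ 8 * (24 / c ^ 4 * Real.exp (c * X ω ^ 2) + 1) := by
    intro ω
    have e1 := Real.pow_div_factorial_le_exp (x := c * X ω ^ 2) (by positivity) 4
    have e2 : (X ω ^ 2) ^ 4 ≤ 24 / c ^ 4 * Real.exp (c * X ω ^ 2) := by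
      rw [div_mul_eq_mul_div, le_div_iff₀ (by positivity)]
      rw [div_le_iff₀ (by positivity)] at e1
      norm_num [Nat.factorial, mul_pow] at e1 ⊢
      linarith
    have e3 : ∀ t : ℝ, 0 ≤ t → (t - 1) ^ 4 ≤ 8 * (t ^ 4 + 1) := by
      intro t ht
      have h5 : (t - 1) ^ 2 ≤ 2 * (t ^ 2 + 1) := by nlinarith [sq_nonneg (t + 1)]
      have h6 : ((t - 1) ^ 2) ^ 2 ≤ (2 * (t ^ 2 + 1)) ^ 2 := pow_le_pow_left₀ (sq_nonneg _) h5 2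
      nlinarith [sq_nonneg (t ^ 2 - 1)]
    linarith [e3 (X ω ^ 2) (sq_nonneg _)]
  have hi : Integrable (fun ω => 24 / c ^ 4 * Real.exp (c * X ω ^ 2) + 1) P :=
    (h1.const_mul _).add (integrable_const 1)
  refine (integral_mono (hw.pow 4).integrable (hi.const_mul 8) hpt).trans ?_
  rw [integral_const_mul, integral_add (h1.const_mul _) (integrable_const 1), integral_const_mul,
    integral_const, probReal_univ, one_smul]
  have : 24 / c ^ 4 * ∫ ω, Real.exp (c * X ω ^ 2) ∂P ≤ 24 / c ^ 4 * 2 := by gcongr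
  have e : 24 / c ^ 4 * 2 = 48 / c ^ 4 := by ring
  linarith

/-- The variance proxy that goes with the sub-Gaussian norm `L`. -/
noncomputable def proxy (L : ℝ) : ℝ := 72 * Real.exp 1 * L ^ 2

theorem proxy_pos {L : ℝ} (hL : 0 < L) : 0 < proxy L := by
  unfold proxy
  positivity

variable {μ L : ℝ} {n p : ℕ} {x : Fin n → Ω → EuclideanSpace ℝ (Fin p)}

namespace IsDesign

theorem mono (h : IsDesign P μ L x) {L' : ℝ} (hL : L ≤ L') : IsDesign P μ L' x :=
  ⟨h.1, h.2, h.3, h.4, h.5, h.6, fun i l => (h.7 i l).trans (ENNReal.ofReal_le_ofReal hL)⟩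

theorem measurable_entry (h : IsDesign P μ L x) (i : Fin n) (l : Fin p) :
    Measurable fun ω => x i ω l :=
  (measurable_pi_apply l).comp ((WithLp.measurable_ofLp 2 _).comp (h.measurable i))

theorem indep_row (h : IsDesign P μ L x) (i : Fin n) : iIndepFun (fun l ω => x i ω l) P :=
  h.indep.precomp (g := fun l : Fin p => (i, l)) fun _ _ h => (Prod.mk.inj h).2

theorem measurable_inner (h : IsDesign P μ L x) (u : EuclideanSpace ℝ (Fin p)) (i : Fin n) :
    Measurable fun ω => (inner ℝ u (x i ω) : ℝ) := by
  have := h.measurable i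
  fun_prop

theorem map_row_eq (h : IsDesign P μ L x) (i j : Fin n) : P.map (x i) = P.map (x j) := by
  have hrow : ∀ i, Measurable fun ω (l : Fin p) => x i ω l := fun i =>
    measurable_pi_lambda _ fun l => h.measurable_entry i l
  have e : ∀ i, P.map (x i) = (P.map fun ω (l : Fin p) => x i ω l).map (WithLp.toLp 2) := by
    intro i
    rw [Measure.map_map (WithLp.measurable_toLp 2 _) (hrow i)]
    rfl
  rw [e, e, iIndepFun.map_fun_eq_pi_map (fun l => (h.measurable_entry i l).aemeasurable)
    (h.indep_row i), iIndepFun.map_fun_eq_pi_map (fun l => (h.measurable_entry j l).aemeasurable)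
    (h.indep_row j)]
  congr 2
  funext l
  exact (h.identDistrib (i, l) (j, l)).map_eq

variable [IsProbabilityMeasure P]

/-- The joint law of all entries is a product over pairs of indices; currying regroups it as a
product over rows. -/
theorem iIndepFun_rows (h : IsDesign P μ L x) : iIndepFun x P := by
  have hm : ∀ k : Fin n × Fin p, Measurable fun ω => x k.1 ω k.2 := fun k => h.measurable_entry _ _
  have hm' : Measurable fun ω (k : Fin n × Fin p) => x k.1 ω k.2 := measurable_pi_lambda _ hm
  have hrow : ∀ i, Measurable fun ω (l : Fin p) => x i ω l := fun i =>
    measurable_pi_lambda _ fun l => h.measurable_entry i l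
  have hprob : ∀ i j, IsProbabilityMeasure (P.map fun ω => x i ω j) := fun i j =>
    Measure.isProbabilityMeasure_map (h.measurable_entry i j).aemeasurable
  have hp2 : ∀ i, IsProbabilityMeasure (P.map fun ω (l : Fin p) => x i ω l) := fun i =>
    Measure.isProbabilityMeasure_map (hrow i).aemeasurable
  have h1 : iIndepFun (fun i ω (l : Fin p) => x i ω l) P := by
    rw [iIndepFun_iff_map_fun_eq_infinitePi_map hrow]
    have e := (iIndepFun_iff_map_fun_eq_infinitePi_map hm).1 h.indep
    have e2 := Measure.infinitePi_map_curry (fun i j => P.map fun ω => x i ω j)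
    rw [← e, Measure.map_map (by fun_prop) hm'] at e2
    refine Eq.trans ?_ (e2.trans ?_)
    · rfl
    · congr 1
      funext i
      exact ((iIndepFun_iff_map_fun_eq_infinitePi_map fun l => h.measurable_entry i l).1
        (h.indep_row i)).symm
  exact h1.comp (fun _ => WithLp.toLp 2) fun _ => WithLp.measurable_toLp 2 _

theorem lintegral_exp_entry_le (h : IsDesign P μ L x) (hL : 0 < L) (i : Fin n) (l : Fin p) :
    ∫⁻ ω, ENNReal.ofReal (Real.exp (1 / (4 * Real.exp 1 * L ^ 2) * x i ω l ^ 2)) ∂P ≤ 2 :=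
  lintegral_exp_sq_le_of_subGaussianNorm_le (h.measurable_entry i l) hL (h.subGaussian i l)

theorem hasSubgaussianMGF_entry (h : IsDesign P μ L x) (hL : 0 < L) (i : Fin n) (l : Fin p) :
    HasSubgaussianMGF (fun ω => x i ω l) (Real.toNNReal (proxy L)) P := by
  have := mgf_le_of_lintegral_exp_sq_le (h.measurable_entry i l) (by positivity)
    (h.lintegral_exp_entry_le hL i l) (h.mean i l)
  convert this using 2
  rw [proxy]
  field_simp
  norm_num

theorem hasMoments_entry (h : IsDesign P μ L x) (hL : 0 < L) (i : Fin n) (l : Fin p) :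
    HasMoments P fun ω => x i ω l :=
  ⟨h.measurable_entry i l, fun q => (h.hasSubgaussianMGF_entry hL i l).memLp q⟩

theorem hasSubgaussianMGF_sum (h : IsDesign P μ L x) (hL : 0 < L) (i : Fin n) (S : Finset (Fin p))
    (v : Fin p → ℝ) :
    (∀ t, Integrable (fun ω => Real.exp (t * ∑ l ∈ S, v l * x i ω l)) P) ∧
      ∀ t, mgf (fun ω => ∑ l ∈ S, v l * x i ω l) P t ≤
        Real.exp (proxy L * (∑ l ∈ S, v l ^ 2) * t ^ 2 / 2) := by
  have hind : iIndepFun (fun l ω => v l * x i ω l) P :=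
    (h.indep_row i).comp (fun l r => v l * r) fun l => by fun_prop
  have h1 := HasSubgaussianMGF.sum_of_iIndepFun (s := S) hind
    fun l _ => (h.hasSubgaussianMGF_entry hL i l).const_mul (v l)
  refine ⟨h1.integrable_exp_mul, fun t => (h1.mgf_le t).trans (le_of_eq ?_)⟩
  congr 3
  rw [NNReal.coe_sum, Finset.mul_sum]
  refine Finset.sum_congr rfl fun l _ => ?_
  change v l ^ 2 * ((proxy L).toNNReal : ℝ) = _
  rw [Real.coe_toNNReal _ (proxy_pos hL).le, mul_comm]

theorem integral_sum_sq (h : IsDesign P μ L x) (hL : 0 < L) (i : Fin n) (S : Finset (Fin p))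
    (v : Fin p → ℝ) : ∫ ω, (∑ l ∈ S, v l * x i ω l) ^ 2 ∂P = ∑ l ∈ S, v l ^ 2 := by
  classical
  have hm := h.hasMoments_entry hL i
  have e : ∀ ω, (∑ l ∈ S, v l * x i ω l) ^ 2 =
      ∑ l ∈ S, ∑ k ∈ S, (v l * v k) * (x i ω l * x i ω k) := by
    intro ω
    rw [sq, Finset.sum_mul_sum]
    exact Finset.sum_congr rfl fun l _ => Finset.sum_congr rfl fun k _ => by ring
  have hI : ∀ l k, Integrable (fun ω => (v l * v k) * (x i ω l * x i ω k)) P := fun l k =>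
    (((hm l).mul (hm k)).const_mul _).integrable
  simp_rw [e]
  rw [integral_finsetSum _ fun l _ => integrable_finsetSum _ fun k _ => hI l k]
  refine Finset.sum_congr rfl fun l hl => ?_
  rw [integral_finsetSum _ fun k _ => hI l k, Finset.sum_eq_single l]
  · rw [integral_const_mul]
    have := h.variance i l
    simp only [sq] at this ⊢
    rw [this, mul_one]
  · intro k _ hk
    rw [integral_const_mul, ((h.indep_row i).indepFun hk.symm).integral_fun_mul_eq_mul_integral
      (hm l).1.aestronglyMeasurable (hm k).1.aestronglyMeasurable, h.mean, zero_mul, mul_zero]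
  · exact fun hn => absurd hl hn

theorem integral_sum_pow_four_le (h : IsDesign P μ L x) (hL : 0 < L) (i : Fin n)
    (S : Finset (Fin p)) (v : Fin p → ℝ) :
    ∫ ω, (∑ l ∈ S, v l * x i ω l) ^ 4 ∂P ≤ 64 * proxy L ^ 2 * (∑ l ∈ S, v l ^ 2) ^ 2 := by
  rcases (Finset.sum_nonneg fun l (_ : l ∈ S) => sq_nonneg (v l)).eq_or_lt with h0 | h0
  · have hv : ∀ l ∈ S, v l = 0 := fun l hl => by
      have := (Finset.sum_eq_zero_iff_of_nonneg fun l _ => sq_nonneg (v l)).1 h0.symm l hl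
      exact pow_eq_zero_iff (two_ne_zero) |>.1 this
    have e : ∀ ω, ∑ l ∈ S, v l * x i ω l = 0 := fun ω =>
      Finset.sum_eq_zero fun l hl => by rw [hv l hl, zero_mul]
    simp_rw [e, ← h0]
    simp
  · obtain ⟨h1, h2⟩ := h.hasSubgaussianMGF_sum hL i S v
    have hs : 0 < proxy L * ∑ l ∈ S, v l ^ 2 := mul_pos (proxy_pos hL) h0
    have hmeas : Measurable fun ω => ∑ l ∈ S, v l * x i ω l :=
      Finset.measurable_fun_sum _ fun l _ => (h.measurable_entry i l).const_mul _
    refine (integral_pow_four_le hmeas (by positivity)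
      (lintegral_exp_mul_sq_le_of_mgf_le hmeas hs h1 h2)).trans (le_of_eq ?_)
    field_simp
    ring

/-- Net points have norm up to `3/2`, hence the allowance `‖u‖ ≤ 2`; it multiplies the variance
proxy by `4`, which explains the `16`. -/
theorem lintegral_exp_inner_le (h : IsDesign P μ L x) (hL : 0 < L) (i : Fin n)
    {u : EuclideanSpace ℝ (Fin p)} (hu : ‖u‖ ≤ 2) :
    ∫⁻ ω, ENNReal.ofReal (Real.exp (1 / (16 * proxy L) * (inner ℝ u (x i ω)) ^ 2)) ∂P ≤ 2 := by
  obtain ⟨h1, h2⟩ := h.hasSubgaussianMGF_sum hL i Finset.univ fun l => u l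
  have e : ∀ ω, ∑ l, u l * x i ω l = inner ℝ u (x i ω) := fun ω => (inner_eq_sum _ _).symm
  simp_rw [e] at h1 h2
  have hmeas : Measurable fun ω => (inner ℝ u (x i ω) : ℝ) := by
    have := h.measurable i
    fun_prop
  have hs := proxy_pos hL
  have hu2 : ∑ l, u l ^ 2 ≤ 4 := by
    have : ∑ l, u l ^ 2 = ‖u‖ ^ 2 := by rw [EuclideanSpace.real_norm_sq_eq]
    rw [this]
    nlinarith [norm_nonneg u]
  have h3 := lintegral_exp_mul_sq_le_of_mgf_le hmeas (by positivity : 0 < proxy L * 4) h1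
    fun t => (h2 t).trans (Real.exp_le_exp.2 (by gcongr))
  convert h3 using 6
  ring_nf

theorem hasMoments_quad (h : IsDesign P μ L x) (hL : 0 < L) (i : Fin n)
    (Z : Matrix (Fin p) (Fin p) ℝ) : HasMoments P fun ω => matInner (outer (x i ω)) Z :=
  HasMoments.sum _ fun j => HasMoments.sum _ fun k => by
    simpa only [outer, Matrix.of_apply, mul_comm] using
      ((h.hasMoments_entry hL i j).mul (h.hasMoments_entry hL i k)).const_mul (Z j k)

/-- The constants in the small-ball estimate. -/
theorem exists_le_integral_min (hμ : 1 < μ) (hL : 0 < L) :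
    ∃ A m : ℝ, 0 < A ∧ 0 < m ∧ ∀ {Ω : Type*} [MeasurableSpace Ω] (P : Measure Ω)
      [IsProbabilityMeasure P] (n p : ℕ) (x : Fin n → Ω → EuclideanSpace ℝ (Fin p)),
      IsDesign P μ L x → ∀ (i : Fin n) (Z : Matrix (Fin p) (Fin p) ℝ), Z.IsSymm → frobNorm Z = 1 →
        m ≤ ∫ ω, min |matInner (outer (x i ω)) Z| A ∂P := by
  -- This is the lower bound for the standard deviation of a form of unit Frobenius norm. It is
  -- positive because `μ > 1`; for `μ = 1` diagonal forms could be constant.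
  set A := √(min 2 (μ - 1)) with hA
  have hmin : 0 < min 2 (μ - 1) := lt_min (by norm_num) (by linarith)
  have hA0 : 0 < A := Real.sqrt_pos.2 hmin
  set K₁ := 64 * proxy L ^ 2 with hK₁
  have hK₁0 : 0 ≤ K₁ := by positivity
  set c := 1 / (4 * Real.exp 1 * L ^ 2) with hc
  set W := 8 * (48 / c ^ 4 + 1) with hW
  have hW0 : 0 ≤ W := by positivity
  have hμ1 : 0 < (μ - 1) ^ 2 := by
    have : 0 < μ - 1 := by linarith
    positivity
  have hμ0 : 0 < μ := by linarith
  -- The sum of the four lower bounds that the moment comparison asks of `K`.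
  set K := 256 * K₁ + 8 + 24 * μ * K₁ + 24 * W / (μ - 1) ^ 2 with hK
  have t1 : 0 ≤ 24 * μ * K₁ := by positivity
  have t2 : 0 ≤ 24 * W / (μ - 1) ^ 2 := by positivity
  have hK8 : 8 ≤ K := by linarith
  refine ⟨A, A / (4 * K), hA0, by positivity, fun P _ n p x h i Z hZ hZ1 => ?_⟩
  have hm := h.hasMoments_entry hL i
  obtain ⟨m2, m4⟩ := moments_quadratic_form hm (h.indep_row i) (W := W) (K₁ := K₁) (K := K) hμ
    (h.mean i) (h.variance i) (h.fourth i)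
    (fun l => integral_sq_sub_one_pow_four_le (hm l) (by positivity)
      (h.lintegral_exp_entry_le hL i l)) hK₁0
    (fun S v => ⟨h.integral_sum_sq hL i S v, h.integral_sum_pow_four_le hL i S v⟩)
    (by linarith) hK8 (by linarith)
    (by
      have : 24 * W / (μ - 1) ^ 2 * (μ - 1) ^ 2 = 24 * W := div_mul_cancel₀ _ hμ1.ne'
      rw [← this]
      exact mul_le_mul_of_nonneg_right (by linarith) hμ1.le) hZ Finset.univ 0
  have e : ∀ ω, 0 + ∑ j, ∑ k, Z j k * (x i ω j * x i ω k) = matInner (outer (x i ω)) Z := by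
    intro ω
    rw [zero_add]
    simp only [matInner, outer, Matrix.of_apply, mul_comm]
  simp_rw [e] at m2 m4
  have hF : ∑ j, ∑ k, Z j k ^ 2 = 1 := by
    have := frobNorm_sq Z
    rw [hZ1, one_pow] at this
    rw [this]
    simp only [matInner, sq]
  rw [hF, mul_one] at m2
  refine le_integral_min_abs (h.hasMoments_quad hL i Z) hA0 ?_ (by linarith) m4
  rw [hA, Real.sq_sqrt hmin.le]
  exact m2

end IsDesign

end Design

end MixedRegression

/-! ### Uniform small-ball estimate for finite families of matrices -/

namespace MixedRegression

/-- Termwise in the power series, since `s^{2n} ≤ s²` for `n ≥ 1`. It converts exponential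
integrability at a fixed scale into a correction of order `s²` at the small scale `s`. -/
theorem cosh_mul_le {s : ℝ} (hs : s ^ 2 ≤ 1) (t : ℝ) :
    Real.cosh (s * t) ≤ 1 + s ^ 2 * Real.cosh t := by
  have h1 : HasSum (fun n : ℕ => s ^ 2 * (t ^ (2 * n) / (2 * n).factorial) +
      if n = 0 then 1 - s ^ 2 else 0) (s ^ 2 * Real.cosh t + (1 - s ^ 2)) :=
    ((Real.hasSum_cosh t).mul_left (s ^ 2)).add (hasSum_ite_eq 0 (1 - s ^ 2))
  have h2 := hasSum_le (fun n => ?_) (Real.hasSum_cosh (s * t)) h1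
  · nlinarith [sq_nonneg s]
  · rcases n with _ | n
    · simp
    · rw [if_neg n.succ_ne_zero, add_zero, ← mul_div_assoc]
      gcongr
      rw [mul_pow, pow_mul s, pow_succ (s ^ 2), mul_comm ((s ^ 2) ^ n)]
      have : (s ^ 2) ^ n ≤ 1 := pow_le_one₀ (sq_nonneg s) hs
      have h3 : 0 ≤ t ^ (2 * (n + 1)) := by rw [pow_mul]; positivity
      exact mul_le_mul_of_nonneg_right (mul_le_of_le_one_right (sq_nonneg s) this) h3

theorem cosh_le_exp {t : ℝ} (ht : 0 ≤ t) : Real.cosh t ≤ Real.exp t := by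
  rw [Real.cosh_eq]
  have : Real.exp (-t) ≤ Real.exp t := Real.exp_le_exp.2 (by linarith)
  linarith

/-- Compactness suffices: the cardinality of this net never matters, because the probability bound
for a finite family does not depend on its size. -/
theorem exists_finset_frobNorm_net {p : ℕ} {T : Set (Matrix (Fin p) (Fin p) ℝ)}
    (hT : ∀ Z ∈ T, frobNorm Z ≤ 1) {ε : ℝ} (hε : 0 < ε) :
    ∃ F : Finset (Matrix (Fin p) (Fin p) ℝ), (∀ Z ∈ F, Z ∈ T) ∧
      ∀ Z ∈ T, ∃ Z' ∈ F, frobNorm (Z - Z') ≤ ε := by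
  classical
  have hb : TotallyBounded (matVec '' T) := by
    refine (isCompact_closedBall (0 : EuclideanSpace ℝ (Fin p × Fin p)) 1).totallyBounded.subset ?_
    rintro _ ⟨Z, hZ, rfl⟩
    rw [mem_closedBall_zero_iff]
    exact hT Z hZ
  obtain ⟨t, hts, htf, hcov⟩ := hb.exists_subset (Metric.dist_mem_uniformity hε)
  choose! g hg hg2 using fun y (hy : y ∈ t) => hts hy
  refine ⟨htf.toFinset.image g, fun Z hZ => ?_, fun Z hZ => ?_⟩
  · obtain ⟨y, hy, rfl⟩ := Finset.mem_image.1 hZ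
    exact hg y (htf.mem_toFinset.1 hy)
  · obtain ⟨y, hy, hd⟩ := Set.mem_iUnion₂.1 (hcov (Set.mem_image_of_mem _ hZ))
    refine ⟨g y, Finset.mem_image_of_mem _ (htf.mem_toFinset.2 hy), ?_⟩
    have : dist (matVec Z) (matVec (g y)) < ε := by rw [hg2 y hy]; exact hd
    rw [dist_eq_norm] at this
    exact this.le

variable {Ω : Type*} [MeasurableSpace Ω] {P : Measure Ω} [IsProbabilityMeasure P]
  {μ L : ℝ} {n p : ℕ} {x : Fin n → Ω → EuclideanSpace ℝ (Fin p)}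

namespace IsDesign

theorem measureReal_le_sum_sq (h : IsDesign P μ L x) (hL : 0 < L) {u : EuclideanSpace ℝ (Fin p)}
    (hu : ‖u‖ ≤ 2) (s : ℝ) :
    P.real {ω | s ≤ ∑ i, (inner ℝ u (x i ω)) ^ 2} ≤
      Real.exp (-(1 / (16 * proxy L)) * s) * 2 ^ n := by
  set a := 1 / (16 * proxy L) with ha
  have ha0 : 0 ≤ a := by have := proxy_pos hL; positivity
  have hind : iIndepFun (fun i ω => (inner ℝ u (x i ω) : ℝ) ^ 2) P :=
    h.iIndepFun_rows.comp (fun _ y => (inner ℝ u y : ℝ) ^ 2) fun _ => by fun_prop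
  have hmeas : ∀ i, Measurable fun ω => (inner ℝ u (x i ω) : ℝ) ^ 2 := fun i =>
    (h.measurable_inner u i).pow_const 2
  have h1 := fun i => integrable_exp_and_integral_le (h.measurable_inner u i)
    (h.lintegral_exp_inner_le hL i hu)
  have h2 := measure_ge_le_exp_mul_mgf (μ := P) (X := ∑ i, fun ω => (inner ℝ u (x i ω) : ℝ) ^ 2)
    (t := a) s ha0 (hind.integrable_exp_mul_sum hmeas fun i _ => (h1 i).1)
  simp only [Finset.sum_apply] at h2
  refine h2.trans (mul_le_mul_of_nonneg_left ?_ (Real.exp_pos _).le)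
  rw [hind.mgf_sum hmeas]
  calc ∏ i, mgf (fun ω => (inner ℝ u (x i ω) : ℝ) ^ 2) P a ≤ ∏ _i : Fin n, (2 : ℝ) :=
        Finset.prod_le_prod (fun i _ => mgf_nonneg) fun i _ => (h1 i).2
    _ = 2 ^ n := by simp

/-- The sums are truncated at level `A`, where each mean is at least `m`, and deviate by at most `m
/ 2` per sample uniformly in `k`. After symmetrization the process is bounded by nuclear norm times
operator norm, so the nuclear bound `R` and the dimension enter but the number of matrices does not.
-/
theorem measure_exists_sum_abs_le (h : IsDesign P μ L x) (hL : 0 < L) {A m : ℝ} (hA : 0 < A)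
    (hm : 0 < m) {S : Finset (Fin n)} (hp : 0 < p) (hS : p ≤ S.card) {κ : Type*} [Fintype κ]
    [Nonempty κ] {Z : κ → Matrix (Fin p) (Fin p) ℝ} (hZ : ∀ k, (Z k).IsSymm)
    (hmin : ∀ i k, m ≤ ∫ ω, min |matInner (outer (x i ω)) (Z k)| A ∂P)
    (hR : ∀ k, nuclearNorm (Z k) ≤ m / (2304 * proxy L) * √(S.card / p)) :
    P {ω | ∃ k, ∑ i ∈ S, |matInner (outer (x i ω)) (Z k)| ≤ S.card * (m / 2)} ≤
      ENNReal.ofReal (Real.exp (-(m ^ 2 / (128 * A ^ 2) * S.card))) := by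
  have hN : 0 < S.card := hp.trans_le hS
  obtain ⟨i₀, hi₀⟩ := Finset.card_pos.1 hN
  have hN' : (0 : ℝ) < S.card := by exact_mod_cast hN
  have hp' : (0 : ℝ) < p := by exact_mod_cast hp
  have hpN : (p : ℝ) ≤ S.card := by exact_mod_cast hS
  have hpr := proxy_pos hL
  set ν := P.map (x i₀) with hν
  have : IsProbabilityMeasure ν := Measure.isProbabilityMeasure_map (h.measurable i₀).aemeasurable
  set f : EuclideanSpace ℝ (Fin p) → κ → ℝ := fun y k => matInner (outer y) (Z k) with hf
  have hfm : Measurable f := by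
    refine measurable_pi_lambda _ fun k => ?_
    simp only [hf, matInner, outer, Matrix.of_apply]
    fun_prop
  have hfi : Integrable f ν := by
    refine Integrable.of_eval fun k => ?_
    have hk : Measurable fun y => f y k := (measurable_pi_apply k).comp hfm
    exact (integrable_map_measure hk.aestronglyMeasurable (h.measurable i₀).aemeasurable).2
      (h.hasMoments_quad hL i₀ (Z k)).integrable
  set u : EuclideanSpace ℝ (Fin p) → κ → ℝ := fun y k => min |f y k| A with hu
  have hum : Measurable u := measurable_pi_lambda _ fun k =>
    (((measurable_pi_apply k).comp hfm).norm).min measurable_const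
  have huint : ∀ k, m ≤ ∫ y, u y k ∂ν := by
    intro k
    have hk : Measurable fun y => u y k := (measurable_pi_apply k).comp hum
    rw [integral_map (h.measurable i₀).aemeasurable hk.aestronglyMeasurable]
    exact hmin i₀ k
  obtain ⟨U, hUc, hU2, hU⟩ := exists_finset_quarter_net p
  have hUne : Nonempty U := by
    obtain ⟨u, hu, -⟩ := hU 0 (by simp)
    exact ⟨⟨u, hu⟩⟩
  set a := 1 / (16 * proxy L) with ha
  have ha0 : 0 < a := by positivity
  set R := m / (2304 * proxy L) * √(S.card / p) with hRdef
  have hR0 : 0 ≤ R := by positivity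
  -- At this scale the cost `2 s²` per sample adds up to `2 p`, of the same order as the logarithm
  -- of the size of the net.
  set s := √(p / S.card) with hs
  have hs0 : 0 < s := Real.sqrt_pos.2 (by positivity)
  have hs2 : s ^ 2 = p / S.card := Real.sq_sqrt (by positivity)
  have hs1 : s ^ 2 ≤ 1 := by rw [hs2]; exact (div_le_one hN').2 hpN
  set D : Matrix (Fin p) (Fin p) ℝ →ₗ[ℝ] κ → ℝ :=
    { toFun := fun M k => matInner M (Z k)
      map_add' := fun M M' => funext fun k => matInner_add_left _ _ _
      map_smul' := fun c M => funext fun k => by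
        simp [matInner_smul_left] } with hD
  set B : Matrix (Fin p) (Fin p) ℝ →ₗ[ℝ] U → ℝ :=
    { toFun := fun M u => matInner (outer u.1) M
      map_add' := fun M M' => funext fun k => matInner_add_right _ _ _
      map_smul' := fun c M => funext fun k => by
        simp [matInner_smul_right] } with hB
  set q : EuclideanSpace ℝ (Fin p) → Matrix (Fin p) (Fin p) ℝ := fun y => (2 : ℝ) • outer y with hq
  have hDq : ∀ y, D (q y) = (2 : ℝ) • f y := fun y => by rw [hq, map_smul]; rfl
  have hBq : ∀ y u, s * a / 2 * B (q y) u = s * (a * (inner ℝ u.1 y) ^ 2) := by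
    intro y u
    have : B (q y) u = 2 * (inner ℝ u.1 y) ^ 2 := by
      rw [hq, map_smul, Pi.smul_apply, smul_eq_mul]
      congr 1
      change matInner (dyad u.1 u.1) (dyad y y) = _
      rw [matInner_dyad_dyad, sq]
    rw [this]; ring
  have hDB : ∀ M k, ∃ u, D M k ≤ 3 * R * |B M u| := by
    intro M k
    obtain ⟨u, hu⟩ := Finite.exists_max fun u => |B M u|
    refine ⟨u, ?_⟩
    -- Passage from the net to the operator norm requires symmetry. Neither the pairings with `Z k`
    -- nor the quadratic forms see more than the symmetric part of `M`.
    set M' := (1 / 2 : ℝ) • (M + M.transpose) with hM'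
    have hM's : M'.IsSymm := by
      rw [Matrix.IsSymm, hM', Matrix.transpose_smul, Matrix.transpose_add,
        Matrix.transpose_transpose, add_comm]
    have e1 : ∀ v, matInner (outer v) M' = matInner (outer v) M := by
      intro v
      have e : (outer v).transpose = outer v := dyad_transpose v v
      rw [hM', matInner_smul_right, matInner_add_right, ← matInner_transpose, e]
      ring
    have e2 : matInner M' (Z k) = matInner M (Z k) := by
      rw [hM', matInner_smul_left, matInner_add_left, matInner_transpose, (hZ k).eq]
      ring
    have h1 := quad_le_of_net hM's hU (s := |B M u|) fun v hv => by
      rw [e1]; exact hu ⟨v, hv⟩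
    have h2 := matInner_le_mul_nuclearNorm (by positivity) (norm_toEuclideanLin_le_of_quad_le hM's h1)
      (Z k)
    rw [e2] at h2
    calc D M k ≤ 3 * |B M u| * nuclearNorm (Z k) := h2
      _ ≤ 3 * |B M u| * R := by gcongr; exact hR k
      _ = 3 * R * |B M u| := by ring
  have hexp := fun u : U => integrable_exp_and_integral_le (h.measurable_inner u.1 i₀)
    (h.lintegral_exp_inner_le hL i₀ ((hU2 u.1 u.2).trans (by norm_num)))
  have hcosh : ∀ u : U, Integrable (fun y => Real.cosh (s * a / 2 * B (q y) u)) ν ∧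
      ∫ y, Real.cosh (s * a / 2 * B (q y) u) ∂ν ≤ Real.exp (2 * s ^ 2) := by
    intro u
    simp_rw [hBq]
    have hm1 : Measurable fun y : EuclideanSpace ℝ (Fin p) =>
        Real.cosh (s * (a * (inner ℝ u.1 y) ^ 2)) := by fun_prop
    have hle : ∀ ω, Real.cosh (s * (a * (inner ℝ u.1 (x i₀ ω)) ^ 2)) ≤
        1 + s ^ 2 * Real.exp (a * (inner ℝ u.1 (x i₀ ω)) ^ 2) := fun ω =>
      (cosh_mul_le hs1 _).trans (by gcongr; exact cosh_le_exp (by positivity))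
    have hI : Integrable (fun ω => 1 + s ^ 2 * Real.exp (a * (inner ℝ u.1 (x i₀ ω)) ^ 2)) P :=
      (integrable_const _).add ((hexp u).1.const_mul _)
    have hI2 : Integrable (fun ω => Real.cosh (s * (a * (inner ℝ u.1 (x i₀ ω)) ^ 2))) P :=
      hI.mono' (hm1.comp (h.measurable i₀)).aestronglyMeasurable
        (Filter.Eventually.of_forall fun ω => by
          rw [Real.norm_eq_abs, abs_of_pos (Real.cosh_pos _)]; exact hle ω)
    refine ⟨(integrable_map_measure hm1.aestronglyMeasurable
      (h.measurable i₀).aemeasurable).2 hI2, ?_⟩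
    rw [integral_map (h.measurable i₀).aemeasurable hm1.aestronglyMeasurable]
    refine (integral_mono hI2 hI hle).trans ?_
    rw [integral_add (integrable_const _) ((hexp u).1.const_mul _), integral_const_mul]
    have h3 : s ^ 2 * ∫ ω, Real.exp (a * (inner ℝ u.1 (x i₀ ω)) ^ 2) ∂P ≤ s ^ 2 * 2 := by
      gcongr
      exact (hexp u).2
    have h4 := Real.add_one_le_exp (2 * s ^ 2)
    simp only [integral_const, probReal_univ, one_smul]
    linarith
  have hV := iterate_avgSignShift_le (ν := ν) (q := q) (c := 3 * R) (r := s * a / 2) D B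
    (by positivity) (by positivity) hDB (by simp_rw [hDq]; exact hfi.smul (2 : ℝ))
    (fun u => (hcosh u).1) (fun u => (hcosh u).2) S.card 0
  simp_rw [hDq, map_zero] at hV
  -- The net contributes at most `4 p`, because `2 * 25^p ≤ 50^p ≤ e^{4p}`, and the samples `2 p`.
  -- The constant `2304` in `R` makes the total exactly `m / 4` per sample, half of the permitted
  -- deviation.
  have hV2 : 3 * R / (s * a / 2) * (Real.log (∑ u : U, 2 * Real.cosh (s * a / 2 *
      (0 : U → ℝ) u)) + S.card * (2 * s ^ 2)) ≤ m * S.card / 4 := by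
    have e1 : ∑ u : U, 2 * Real.cosh (s * a / 2 * (0 : U → ℝ) u) = U.card * 2 := by
      simp
    have e2 : Real.log (U.card * 2) ≤ 4 * p := by
      have hUc0 : 0 < U.card := Finset.card_pos.2 ⟨_, hUne.some.2⟩
      have hUc' : (U.card : ℝ) ≤ 25 ^ p := by exact_mod_cast hUc
      have : (U.card : ℝ) * 2 ≤ 50 ^ p := by
        calc (U.card : ℝ) * 2 ≤ 25 ^ p * 2 ^ p := by
              gcongr
              exact le_self_pow₀ (by norm_num) hp.ne'
          _ = 50 ^ p := by rw [← mul_pow]; norm_num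
      have h50 : Real.log 50 ≤ 4 := by
        rw [Real.log_le_iff_le_exp (by norm_num)]
        have : (2.7 : ℝ) ^ 4 ≤ Real.exp 1 ^ 4 := by
          gcongr
          exact (by norm_num : (2.7 : ℝ) ≤ 2.7182818283).trans Real.exp_one_gt_d9.le
        rw [← Real.exp_nat_mul] at this
        norm_num at this ⊢
        linarith
      calc Real.log (U.card * 2) ≤ Real.log (50 ^ p) := Real.log_le_log (by positivity) this
        _ = p * Real.log 50 := by rw [Real.log_pow]
        _ ≤ p * 4 := by gcongr
        _ = 4 * p := mul_comm _ _
    have e3 : S.card * (2 * s ^ 2) = 2 * (p : ℝ) := by rw [hs2]; field_simp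
    have e4 : √((S.card : ℝ) / p) = 1 / s := by
      rw [hs, ← Real.sqrt_one, ← Real.sqrt_div (by norm_num)]
      congr 1
      field_simp
    have e5 : 3 * R / (s * a / 2) * (6 * p) = m * S.card / 4 := by
      have hsp : (p : ℝ) = s ^ 2 * S.card := by rw [hs2]; field_simp
      have key : ∀ s N l : ℝ, 0 < s → 0 < N → 0 < l →
          3 * (m / (2304 * l) * (1 / s)) / (s * (1 / (16 * l)) / 2) * (6 * (s ^ 2 * N)) =
            m * N / 4 := by
        intro s N l hs hN hl
        field_simp
        ring
      rw [hRdef, e4, ha]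
      nth_rewrite 1 [hsp]
      exact key s S.card (proxy L) hs0 hN' hpr
    rw [e1, e3, ← e5]
    gcongr
    linarith
  have hfin := measure_exists_sum_le (f := f) (u := u) (A := A) (fun i => h.measurable i)
    h.iIndepFun_rows (fun i => h.map_row_eq i i₀) hfi hum
    (fun y k => by
      rw [abs_of_nonneg (le_min (abs_nonneg _) hA.le)]; exact min_le_right _ _)
    (fun y k l => by
      refine (abs_min_sub_min_le_max _ _ _ _).trans ?_
      rw [sub_self, abs_zero, max_eq_left (abs_nonneg _)]
      exact abs_abs_sub_abs_le _ _) S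
    -- The minimizer of `-r m / 4 + 2 A² r²`, the exponent per sample, with minimum `-m² / (128
    -- A²)`.
    (r := m / (16 * A ^ 2)) (t := S.card * (m / 2)) (by positivity) (hV.trans hV2)
  refine (measure_mono ?_).trans (hfin.trans (ENNReal.ofReal_le_ofReal (Real.exp_le_exp.2 ?_)))
  · rintro ω ⟨k, hk⟩
    refine ⟨k, ?_⟩
    have h1 : ∑ i ∈ S, u (x i ω) k ≤ ∑ i ∈ S, |matInner (outer (x i ω)) (Z k)| :=
      Finset.sum_le_sum fun i _ => min_le_left _ _
    have h2 : (S.card : ℝ) * m ≤ S.card * ∫ y, u y k ∂ν := by gcongr; exact huint k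
    linarith
  · refine le_of_eq ?_
    field_simp
    ring

end IsDesign

end MixedRegression

/-! ### Well conditioned covariates with high probability -/

namespace MixedRegression

/-- A crude bound by `∑ ‖x i‖²`. The factor `p` is harmless, since it is only applied to the error
of a net that may be as fine as desired. -/
theorem sum_abs_matInner_outer_le {n p : ℕ} {x : Fin n → EuclideanSpace ℝ (Fin p)} {C : ℝ}
    (hx : ∀ v, ∑ i, (inner ℝ v (x i)) ^ 2 ≤ C * n * ‖v‖ ^ 2) (S : Finset (Fin n))
    (Z : Matrix (Fin p) (Fin p) ℝ) :
    ∑ i ∈ S, |matInner (outer (x i)) Z| ≤ C * n * p * frobNorm Z := by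
  have h1 : ∀ i, |matInner (outer (x i)) Z| ≤ (∑ l, x i l ^ 2) * frobNorm Z := by
    intro i
    have := abs_matInner_le (outer (x i)) Z
    rwa [outer_eq_dyad, frobNorm_dyad, ← sq, EuclideanSpace.real_norm_sq_eq] at this
  have h2 : ∑ i, ∑ l, x i l ^ 2 ≤ C * n * p := by
    rw [Finset.sum_comm]
    calc ∑ l, ∑ i, x i l ^ 2 ≤ ∑ _l : Fin p, C * n := by
          refine Finset.sum_le_sum fun l _ => ?_
          have := hx (EuclideanSpace.single l 1)
          simpa [EuclideanSpace.inner_single_left] using this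
      _ = C * n * p := by simp [mul_comm]
  calc ∑ i ∈ S, |matInner (outer (x i)) Z| ≤ ∑ i, |matInner (outer (x i)) Z| :=
        Finset.sum_le_sum_of_subset_of_nonneg (Finset.subset_univ _) fun _ _ _ => abs_nonneg _
    _ ≤ ∑ i, (∑ l, x i l ^ 2) * frobNorm Z := Finset.sum_le_sum fun i _ => h1 i
    _ = (∑ i, ∑ l, x i l ^ 2) * frobNorm Z := by rw [Finset.sum_mul]
    _ ≤ C * n * p * frobNorm Z := mul_le_mul_of_nonneg_right h2 (frobNorm_nonneg _)

/-- The covariates are well conditioned: their empirical second moments are bounded, and the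
quadratic forms of matrices of small effective rank are bounded below in `ℓ¹` on each class. -/
structure IsWellConditioned {n p : ℕ} (x : Fin n → EuclideanSpace ℝ (Fin p)) (z : Fin n → Fin 2)
    (c τ C : ℝ) : Prop where
  upper : ∀ v, ∑ i, (inner ℝ v (x i)) ^ 2 ≤ C * n * ‖v‖ ^ 2
  lower : ∀ b, ∀ Z : Matrix (Fin p) (Fin p) ℝ, Z.IsSymm →
    classSize z b * (c * (frobNorm Z - nuclearNorm Z / (τ * √(classSize z b / p)))) ≤
      ∑ i ∈ Finset.univ.filter (fun i => z i = b), |matInner (outer (x i)) Z|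

theorem classSize_le {n : ℕ} (z : Fin n → Fin 2) (b : Fin 2) : classSize z b ≤ n :=
  (Finset.card_filter_le _ _).trans (by simp)

section

variable {Ω : Type*} [MeasurableSpace Ω] {P : Measure Ω} [IsProbabilityMeasure P]
  {μ L : ℝ} {n p : ℕ} {x : Fin n → Ω → EuclideanSpace ℝ (Fin p)}

namespace IsDesign

/-- Union bound over the net: each point fails with probability at most `e^{-5n} 2^n`, there are at
most `25^n` points, and `50 ≤ e^4`. Passing from the net to all `v` multiplies `80` by `3`. -/
theorem exists_upper_event (h : IsDesign P μ L x) (hL : 0 < L) (hpn : p ≤ n) :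
    ∃ E : Set Ω, MeasurableSet E ∧ P.real Eᶜ ≤ Real.exp (-n) ∧ ∀ ω ∈ E, ∀ v,
      ∑ i, (inner ℝ v (x i ω)) ^ 2 ≤ 240 * proxy L * n * ‖v‖ ^ 2 := by
  obtain ⟨U, hUc, hU2, hU⟩ := exists_finset_quarter_net p
  have hpr := proxy_pos hL
  set s := 80 * proxy L * n with hs
  have hmeas : ∀ u, Measurable fun ω => ∑ i, (inner ℝ u (x i ω)) ^ 2 := fun u =>
    Finset.measurable_fun_sum _ fun i _ => (h.measurable_inner u i).pow_const 2
  refine ⟨⋂ u ∈ U, {ω | s ≤ ∑ i, (inner ℝ u (x i ω)) ^ 2}ᶜ,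
    Finset.measurableSet_biInter _ fun u _ =>
      (measurableSet_le measurable_const (hmeas u)).compl, ?_, fun ω hω v => ?_⟩
  · have e : (⋂ u ∈ U, {ω | s ≤ ∑ i, (inner ℝ u (x i ω)) ^ 2}ᶜ)ᶜ =
        ⋃ u ∈ U, {ω | s ≤ ∑ i, (inner ℝ u (x i ω)) ^ 2} := by
      simp only [Set.compl_iInter, compl_compl]
    rw [e]
    have h50 : (50 : ℝ) ≤ Real.exp 4 := by
      have : (2.7 : ℝ) ^ 4 ≤ Real.exp 1 ^ 4 := by
        gcongr
        exact (by norm_num : (2.7 : ℝ) ≤ 2.7182818283).trans Real.exp_one_gt_d9.le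
      rw [← Real.exp_nat_mul] at this
      norm_num at this ⊢
      linarith
    have hexp : -(1 / (16 * proxy L)) * s = -(5 * n) := by
      rw [hs]
      field_simp
      ring
    refine (measureReal_biUnion_finset_le U _).trans ?_
    calc ∑ u ∈ U, P.real {ω | s ≤ ∑ i, (inner ℝ u (x i ω)) ^ 2}
        ≤ ∑ u ∈ U, Real.exp (-(5 * n)) * 2 ^ n := by
          refine Finset.sum_le_sum fun u hu => ?_
          rw [← hexp]
          exact h.measureReal_le_sum_sq hL ((hU2 u hu).trans (by norm_num)) s
      _ = U.card * (Real.exp (-(5 * n)) * 2 ^ n) := by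
          rw [Finset.sum_const, nsmul_eq_mul]
      _ ≤ 25 ^ n * (Real.exp (-(5 * n)) * 2 ^ n) := by
          gcongr
          calc (U.card : ℝ) ≤ 25 ^ p := by exact_mod_cast hUc
            _ ≤ 25 ^ n := pow_le_pow_right₀ (by norm_num) hpn
      _ = 50 ^ n * Real.exp (-(5 * n)) := by
          rw [show (50 : ℝ) = 25 * 2 by norm_num, mul_pow]
          ring
      _ ≤ Real.exp 4 ^ n * Real.exp (-(5 * n)) := by gcongr
      _ = Real.exp (-n) := by
          rw [← Real.exp_nat_mul, ← Real.exp_add]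
          congr 1
          ring
  · set M := ∑ i, outer (x i ω) with hM
    have hMs : M.IsSymm := by
      rw [Matrix.IsSymm, hM, Matrix.transpose_sum]
      exact Finset.sum_congr rfl fun i _ => dyad_transpose _ _
    have e : ∀ v, matInner (outer v) M = ∑ i, (inner ℝ v (x i ω)) ^ 2 := by
      intro v
      rw [quad_eq_inner, hM, map_sum, LinearMap.sum_apply, inner_sum]
      refine Finset.sum_congr rfl fun i _ => ?_
      rw [← quad_eq_inner, outer_eq_dyad, outer_eq_dyad, matInner_dyad_dyad, sq]
    have h1 := quad_le_of_net hMs hU (s := s) (fun u hu => by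
      rw [e, abs_of_nonneg (Finset.sum_nonneg fun i _ => sq_nonneg _)]
      have : ¬s ≤ ∑ i, (inner ℝ u (x i ω)) ^ 2 := Set.mem_iInter₂.1 hω u hu
      exact (not_le.1 this).le) v
    rw [e] at h1
    refine ((le_abs_self _).trans h1).trans (le_of_eq ?_)
    rw [hs]
    ring

/-- By homogeneity it is enough to treat unit Frobenius norm. If the nuclear norm exceeds `R`, the
left side is negative; otherwise a net point is close, and the crude upper bound controls the
difference. -/
theorem exists_lower_event (h : IsDesign P μ L x) (hL : 0 < L) {A m : ℝ} (hA : 0 < A)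
    (hm : 0 < m) {S : Finset (Fin n)} (hp : 0 < p) (hS : p ≤ S.card)
    (hmin : ∀ (i : Fin n) (Z : Matrix (Fin p) (Fin p) ℝ), Z.IsSymm → frobNorm Z = 1 →
      m ≤ ∫ ω, min |matInner (outer (x i ω)) Z| A ∂P) :
    ∃ E : Set Ω, MeasurableSet E ∧
      P.real Eᶜ ≤ Real.exp (-(m ^ 2 / (128 * A ^ 2) * S.card)) ∧
      ∀ ω ∈ E, (∀ v, ∑ i, (inner ℝ v (x i ω)) ^ 2 ≤ 240 * proxy L * n * ‖v‖ ^ 2) →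
        ∀ Z : Matrix (Fin p) (Fin p) ℝ, Z.IsSymm →
          S.card * (m / 4 * (frobNorm Z -
            nuclearNorm Z / (m / (2304 * proxy L) * √(S.card / p)))) ≤
          ∑ i ∈ S, |matInner (outer (x i ω)) Z| := by
  have hpr := proxy_pos hL
  have hN : 0 < S.card := hp.trans_le hS
  have hn : 0 < n := hN.trans_le ((Finset.card_le_univ S).trans (by simp))
  have hN' : (0 : ℝ) < S.card := by exact_mod_cast hN
  have hp' : (0 : ℝ) < p := by exact_mod_cast hp
  have hn' : (0 : ℝ) < n := by exact_mod_cast hn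
  set R := m / (2304 * proxy L) * √(S.card / p) with hR
  have hR0 : 0 < R := by positivity
  set T : Set (Matrix (Fin p) (Fin p) ℝ) :=
    {Z | Z.IsSymm ∧ frobNorm Z = 1 ∧ nuclearNorm Z ≤ R} with hT
  have hCn : 0 < 240 * proxy L * n * p := by positivity
  obtain ⟨F, hFT, hF⟩ := exists_finset_frobNorm_net (T := T) (fun Z hZ => hZ.2.1.le)
    -- Fine enough that the net error is at most half of the guaranteed `S.card * (m / 2)`.
    (ε := S.card * (m / 4) / (240 * proxy L * n * p)) (by positivity)
  have hmeas : ∀ Z, Measurable fun ω => ∑ i ∈ S, |matInner (outer (x i ω)) Z| := fun Z =>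
    Finset.measurable_fun_sum _ fun i _ => (h.hasMoments_quad hL i Z).1.norm
  refine ⟨⋂ Z ∈ F, {ω | ∑ i ∈ S, |matInner (outer (x i ω)) Z| ≤ S.card * (m / 2)}ᶜ,
    Finset.measurableSet_biInter _ fun Z _ =>
      (measurableSet_le (hmeas Z) measurable_const).compl, ?_, fun ω hω hup Z hZ => ?_⟩
  · rcases isEmpty_or_nonempty F with hemp | hne
    · have : F = ∅ := Finset.isEmpty_coe_sort.1 hemp
      simp only [this, Finset.notMem_empty, Set.iInter_of_empty, Set.iInter_univ, Set.compl_univ,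
        measureReal_empty]
      positivity
    · have h1 := h.measure_exists_sum_abs_le hL hA hm hp hS (Z := fun k : F => k.1)
        (fun k => (hFT _ k.2).1) (fun i k => hmin i _ (hFT _ k.2).1 (hFT _ k.2).2.1)
        (fun k => (hFT _ k.2).2.2)
      refine ENNReal.toReal_le_of_le_ofReal (Real.exp_pos _).le ((measure_mono ?_).trans h1)
      intro ω hω
      simp only [Set.compl_iInter, compl_compl, Set.mem_iUnion] at hω
      obtain ⟨Z, hZ, hω⟩ := hω
      exact ⟨⟨Z, hZ⟩, hω⟩
  · rcases (frobNorm_nonneg Z).eq_or_lt with h0 | h0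
    · rw [← h0, zero_sub]
      refine le_trans ?_ (Finset.sum_nonneg fun i _ => abs_nonneg _)
      have : 0 ≤ nuclearNorm Z / R := div_nonneg (nuclearNorm_nonneg _) hR0.le
      exact mul_nonpos_of_nonneg_of_nonpos hN'.le
        (mul_nonpos_of_nonneg_of_nonpos (by positivity) (by linarith))
    by_cases hc : nuclearNorm Z ≤ R * frobNorm Z
    · have hW : (frobNorm Z)⁻¹ • Z ∈ T := by
        refine ⟨?_, ?_, ?_⟩
        · rw [Matrix.IsSymm, Matrix.transpose_smul, hZ.eq]
        · rw [frobNorm_smul, abs_of_pos (by positivity), inv_mul_cancel₀ h0.ne']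
        · refine (nuclearNorm_smul_le (by positivity) Z).trans ?_
          rw [inv_mul_le_iff₀ h0, mul_comm]
          exact hc
      obtain ⟨Z', hZ', hd⟩ := hF _ hW
      have h1 : S.card * (m / 2) < ∑ i ∈ S, |matInner (outer (x i ω)) Z'| :=
        not_le.1 (Set.mem_iInter₂.1 hω Z' hZ')
      have h2 := sum_abs_matInner_outer_le hup S ((frobNorm Z)⁻¹ • Z - Z')
      have h3 : 240 * proxy L * n * p * frobNorm ((frobNorm Z)⁻¹ • Z - Z') ≤
          S.card * (m / 4) := by
        rw [le_div_iff₀ hCn] at hd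
        rwa [mul_comm]
      have h4 : ∑ i ∈ S, |matInner (outer (x i ω)) Z'| ≤
          ∑ i ∈ S, |matInner (outer (x i ω)) ((frobNorm Z)⁻¹ • Z)| +
          ∑ i ∈ S, |matInner (outer (x i ω)) ((frobNorm Z)⁻¹ • Z - Z')| := by
        rw [← Finset.sum_add_distrib]
        refine Finset.sum_le_sum fun i _ => ?_
        have e : matInner (outer (x i ω)) Z' = matInner (outer (x i ω)) ((frobNorm Z)⁻¹ • Z) -
            matInner (outer (x i ω)) ((frobNorm Z)⁻¹ • Z - Z') := by
          rw [matInner_sub_right]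
          ring
        rw [e]
        exact abs_sub _ _
      have h5 : ∑ i ∈ S, |matInner (outer (x i ω)) ((frobNorm Z)⁻¹ • Z)| =
          (frobNorm Z)⁻¹ * ∑ i ∈ S, |matInner (outer (x i ω)) Z| := by
        rw [Finset.mul_sum]
        refine Finset.sum_congr rfl fun i _ => ?_
        rw [matInner_smul_right, abs_mul, abs_of_pos (inv_pos.2 h0)]
      have h6 : S.card * (m / 4) ≤ (frobNorm Z)⁻¹ * ∑ i ∈ S, |matInner (outer (x i ω)) Z| := by
        linarith
      rw [le_inv_mul_iff₀ h0] at h6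
      refine le_trans ?_ h6
      have : 0 ≤ nuclearNorm Z / R := div_nonneg (nuclearNorm_nonneg _) hR0.le
      calc S.card * (m / 4 * (frobNorm Z - nuclearNorm Z / R))
          ≤ S.card * (m / 4 * frobNorm Z) := by gcongr; linarith
        _ = frobNorm Z * (S.card * (m / 4)) := by ring
    · refine le_trans ?_ (Finset.sum_nonneg fun i _ => abs_nonneg _)
      have : frobNorm Z ≤ nuclearNorm Z / R := by
        rw [le_div_iff₀ hR0, mul_comm]
        exact (not_le.1 hc).le
      exact mul_nonpos_of_nonneg_of_nonpos hN'.le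
        (mul_nonpos_of_nonneg_of_nonpos (by positivity) (by linarith))

/-- With high probability the covariates are well conditioned. -/
theorem exists_event_isWellConditioned (hμ : 1 < μ) (hL : 0 < L) :
    ∃ c τ C γ : ℝ, 0 < c ∧ 0 < τ ∧ 0 < C ∧ 0 < γ ∧ ∀ {Ω : Type*} [MeasurableSpace Ω]
      (P : Measure Ω) [IsProbabilityMeasure P] (n p : ℕ)
      (x : Fin n → Ω → EuclideanSpace ℝ (Fin p)) (z : Fin n → Fin 2), IsDesign P μ L x →
      0 < p → (∀ b, p ≤ classSize z b) →
      ∃ E : Set Ω, MeasurableSet E ∧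
        1 - 3 * Real.exp (-(γ * (min (classSize z 0) (classSize z 1) : ℕ))) ≤ P.real E ∧
        ∀ ω ∈ E, IsWellConditioned (fun i => x i ω) z c τ C := by
  obtain ⟨A, m, hA, hm, hmin⟩ := exists_le_integral_min hμ hL
  have hpr := proxy_pos hL
  refine ⟨m / 4, m / (2304 * proxy L), 240 * proxy L, min 1 (m ^ 2 / (128 * A ^ 2)),
    by positivity, by positivity, by positivity, by positivity, ?_⟩
  intro Ω _ P _ n p x z h hp hz
  set γ := min 1 (m ^ 2 / (128 * A ^ 2)) with hγ
  have hγ0 : 0 < γ := by positivity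
  set N := min (classSize z 0) (classSize z 1) with hN
  obtain ⟨E, hE, hEP, hEω⟩ := h.exists_upper_event hL ((hz 0).trans (classSize_le z 0))
  have hlow := fun b => h.exists_lower_event hL hA hm hp (hz b) (hmin P n p x h)
  choose G hG hGP hGω using hlow
  refine ⟨E ∩ (G 0 ∩ G 1), hE.inter ((hG 0).inter (hG 1)), ?_, fun ω hω => ⟨hEω ω hω.1, ?_⟩⟩
  · have hb : ∀ k : ℕ, N ≤ k → ∀ a, γ ≤ a → Real.exp (-(a * k)) ≤ Real.exp (-(γ * N)) := by
      intro k hk a ha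
      have hk' : (N : ℝ) ≤ k := by exact_mod_cast hk
      refine Real.exp_le_exp.2 (neg_le_neg ?_)
      exact mul_le_mul ha hk' (by positivity) (hγ0.le.trans ha)
    have h0 : P.real Eᶜ ≤ Real.exp (-(γ * N)) := by
      refine hEP.trans ?_
      have := hb n ((min_le_left _ _).trans (classSize_le z 0)) 1 (min_le_left _ _)
      rwa [one_mul] at this
    have h1 := (hGP 0).trans (hb _ (min_le_left _ _) _ (min_le_right _ _))
    have h2 := (hGP 1).trans (hb _ (min_le_right _ _) _ (min_le_right _ _))
    have h3 := probReal_compl_eq_one_sub (μ := P) (hE.inter ((hG 0).inter (hG 1)))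
    rw [Set.compl_inter, Set.compl_inter] at h3
    have h4 := measureReal_union_le (μ := P) Eᶜ ((G 0)ᶜ ∪ (G 1)ᶜ)
    have h5 := measureReal_union_le (μ := P) (G 0)ᶜ (G 1)ᶜ
    linarith
  · intro b
    have hb : ω ∈ G b := by
      fin_cases b
      · exact hω.2.1
      · exact hω.2.2
    exact hGω b ω hb (hEω ω hω.1)

end IsDesign

end

end MixedRegression

/-! ### The lifted problem and its residuals -/

namespace MixedRegression

variable {n p : ℕ}

/-- The symmetrized product `(β₁β₂ᵀ + β₂β₁ᵀ) / 2`, which the program estimates by `K`. -/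
noncomputable def symmProd (β : Fin 2 → EuclideanSpace ℝ (Fin p)) : Matrix (Fin p) (Fin p) ℝ :=
  (1 / 2 : ℝ) • (dyad (β 0) (β 1) + dyad (β 1) (β 0))

/-- The average `(β₁ + β₂) / 2`, which the program estimates by `g`. -/
noncomputable def midpt (β : Fin 2 → EuclideanSpace ℝ (Fin p)) : EuclideanSpace ℝ (Fin p) :=
  (1 / 2 : ℝ) • (β 0 + β 1)

/-- The matrix whose quadratic form is the change of the noiseless residual when `(K, g)` is
displaced by `(H, h)`. -/
noncomputable def residualForm (b : EuclideanSpace ℝ (Fin p)) (H : Matrix (Fin p) (Fin p) ℝ)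
    (h : EuclideanSpace ℝ (Fin p)) : Matrix (Fin p) (Fin p) ℝ :=
  dyad b h + dyad h b - H

theorem symmProd_isSymm (β : Fin 2 → EuclideanSpace ℝ (Fin p)) : (symmProd β).IsSymm := by
  rw [Matrix.IsSymm, symmProd, Matrix.transpose_smul, Matrix.transpose_add, dyad_transpose,
    dyad_transpose, add_comm]

theorem residualForm_isSymm (b h : EuclideanSpace ℝ (Fin p)) {H : Matrix (Fin p) (Fin p) ℝ}
    (hH : H.IsSymm) : (residualForm b H h).IsSymm := by
  rw [Matrix.IsSymm, residualForm, Matrix.transpose_sub, Matrix.transpose_add, dyad_transpose,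
    dyad_transpose, hH.eq, add_comm (dyad h b)]

theorem matInner_outer_dyad (v a b : EuclideanSpace ℝ (Fin p)) :
    matInner (outer v) (dyad a b) = inner ℝ v a * inner ℝ v b :=
  matInner_dyad_dyad v v a b

theorem mul_dyad_mul {M : Matrix (Fin p) (Fin p) ℝ} (hM : M.IsSymm)
    (u v : EuclideanSpace ℝ (Fin p)) : M * dyad u v * M =
      dyad (Matrix.toEuclideanLin M u) (Matrix.toEuclideanLin M v) := by
  apply Matrix.toEuclideanLin.injective
  refine LinearMap.ext fun w => ?_
  rw [toEuclideanLin_mul, toEuclideanLin_mul, toEuclideanLin_dyad, toEuclideanLin_dyad, map_smul,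
    inner_toEuclideanLin_of_isSymm hM]

/-- The reason for the spectral step: at the truth, `J` has rank at most one and its range is
spanned by the half-difference of the regressors. -/
theorem outer_midpt_sub_symmProd (β : Fin 2 → EuclideanSpace ℝ (Fin p)) :
    outer (midpt β) - symmProd β = outer ((1 / 2 : ℝ) • (β 0 - β 1)) := by
  ext i j
  simp only [outer, midpt, symmProd, dyad, Matrix.sub_apply, Matrix.smul_apply, Matrix.add_apply,
    Matrix.of_apply, PiLp.smul_apply, PiLp.add_apply, PiLp.sub_apply, smul_eq_mul]
  ring

/-- The residual at a point of the program, relative to `(symmProd β, midpt β)`. -/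
theorem residual_eq (x : Fin n → EuclideanSpace ℝ (Fin p)) (z : Fin n → Fin 2)
    (β : Fin 2 → EuclideanSpace ℝ (Fin p)) (e : EuclideanSpace ℝ (Fin n))
    (K : Matrix (Fin p) (Fin p) ℝ) (g : EuclideanSpace ℝ (Fin p)) (i : Fin n) :
    -matInner (outer (x i)) K + 2 * response x z β e i * inner ℝ (x i) g -
        response x z β e i ^ 2 =
      matInner (outer (x i)) (residualForm (β (z i)) (K - symmProd β) (g - midpt β)) +
        2 * (e i * inner ℝ (x i) (g - midpt β)) -
        e i * (inner ℝ (x i) (β (z i)) - inner ℝ (x i) (β (1 - z i)) + e i) := by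
  rw [residualForm, matInner_sub_right, matInner_sub_right, matInner_add_right,
    matInner_outer_dyad, matInner_outer_dyad, symmProd, matInner_smul_right, matInner_add_right,
    matInner_outer_dyad, matInner_outer_dyad, midpt, inner_sub_right, inner_smul_right,
    inner_add_right, response]
  -- In `Fin 2` the element `1 - z i` is the other label.
  have hz : z i = 0 ∨ z i = 1 := by
    generalize z i = b
    fin_cases b <;> simp
  rcases hz with hz | hz
  · rw [hz, sub_zero]
    ring
  · rw [hz, sub_self]
    ring

/-- The constraints see only the symmetric part of `K`, and symmetrizing does not increase the
nuclear norm; so minimizing over symmetric matrices loses nothing. -/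
theorem isFeasible_symm {x : Fin n → EuclideanSpace ℝ (Fin p)} {y : Fin n → ℝ} {η : ℝ}
    {K : Matrix (Fin p) (Fin p) ℝ} {g : EuclideanSpace ℝ (Fin p)} (h : IsFeasible x y η K g) :
    IsFeasible x y η ((1 / 2 : ℝ) • (K + K.transpose)) g := by
  have e : ∀ v, matInner (outer v) ((1 / 2 : ℝ) • (K + K.transpose)) = matInner (outer v) K := by
    intro v
    have e : (outer v).transpose = outer v := dyad_transpose v v
    rw [matInner_smul_right, matInner_add_right, ← matInner_transpose, e]
    ring
  unfold IsFeasible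
  simp_rw [e]
  exact h

theorem nuclearNorm_symm_le (K : Matrix (Fin p) (Fin p) ℝ) :
    nuclearNorm ((1 / 2 : ℝ) • (K + K.transpose)) ≤ nuclearNorm K := by
  have h1 := nuclearNorm_smul_le (by norm_num : (0 : ℝ) ≤ 1 / 2) (K + K.transpose)
  have h2 := nuclearNorm_add_le K K.transpose
  have h3 := nuclearNorm_transpose_le K
  linarith

theorem sum_abs_mul_inner_le {x : Fin n → EuclideanSpace ℝ (Fin p)} {C : ℝ}
    (hx : ∀ v, ∑ i, (inner ℝ v (x i)) ^ 2 ≤ C * n * ‖v‖ ^ 2) (e : EuclideanSpace ℝ (Fin n))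
    (v : EuclideanSpace ℝ (Fin p)) :
    ∑ i, |e i * inner ℝ (x i) v| ≤ √C * (√n * ‖e‖ * ‖v‖) := by
  have h1 := Real.sum_mul_le_sqrt_mul_sqrt Finset.univ (fun i => |e i|)
    (fun i => |(inner ℝ (x i) v : ℝ)|)
  simp only [sq_abs] at h1
  simp_rw [abs_mul]
  refine h1.trans ?_
  have h2 : √(∑ i, e i ^ 2) = ‖e‖ := by
    rw [← EuclideanSpace.real_norm_sq_eq, Real.sqrt_sq (norm_nonneg _)]
  have h3 : √(∑ i, (inner ℝ (x i) v) ^ 2) ≤ √C * (√n * ‖v‖) := by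
    have e1 : ∑ i, (inner ℝ (x i) v) ^ 2 = ∑ i, (inner ℝ v (x i)) ^ 2 :=
      Finset.sum_congr rfl fun i _ => by rw [real_inner_comm]
    have := Real.sqrt_le_sqrt (hx v)
    rw [Real.sqrt_mul' _ (sq_nonneg _), Real.sqrt_sq (norm_nonneg _),
      Real.sqrt_mul' _ (Nat.cast_nonneg _)] at this
    rw [e1]
    linarith
  rw [h2]
  calc ‖e‖ * √(∑ i, (inner ℝ (x i) v) ^ 2) ≤ ‖e‖ * (√C * (√n * ‖v‖)) := by gcongr
    _ = √C * (√n * ‖e‖ * ‖v‖) := by ring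

/-! ### Elementary consequences of the separation -/

section Separation

variable {β : Fin 2 → EuclideanSpace ℝ (Fin p)}

theorem separation_mul (hα : 0 < separation β) :
    separation β * (‖β 0‖ ^ 2 + ‖β 1‖ ^ 2) = ‖β 0 - β 1‖ ^ 2 := by
  rw [separation]
  refine div_mul_cancel₀ _ fun h0 => ?_
  rw [separation, h0, div_zero] at hα
  exact hα.false

theorem norm_sub_pos (hα : 0 < separation β) : 0 < ‖β 0 - β 1‖ := by
  rcases (norm_nonneg (β 0 - β 1)).eq_or_lt with h | h
  · rw [separation, ← h] at hα
    norm_num at hα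
  · exact h

theorem separation_le_two (β : Fin 2 → EuclideanSpace ℝ (Fin p)) : separation β ≤ 2 := by
  rw [separation]
  refine div_le_of_le_mul₀ (by positivity) (by norm_num) ?_
  have h1 := norm_sub_le (β 0) (β 1)
  have h2 := pow_le_pow_left₀ (norm_nonneg _) h1 2
  nlinarith [sq_nonneg (‖β 0‖ - ‖β 1‖)]

theorem sqrt_separation_le (β : Fin 2 → EuclideanSpace ℝ (Fin p)) : √(separation β) ≤ 3 / 2 := by
  rw [Real.sqrt_le_left (by norm_num)]
  have := separation_le_two β
  linarith

theorem sqrt_separation_mul_norm_le (hα : 0 < separation β) (b : Fin 2) :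
    √(separation β) * ‖β b‖ ≤ ‖β 0 - β 1‖ := by
  refine le_of_sq_le_sq ?_ (norm_nonneg _)
  rw [mul_pow, Real.sq_sqrt hα.le, ← separation_mul hα]
  refine mul_le_mul_of_nonneg_left ?_ hα.le
  fin_cases b
  · simp
  · simp

theorem sqrt_separation_mul_le (hα : 0 < separation β) :
    √(separation β) * (‖β 0‖ + ‖β 1‖) ≤ 2 * ‖β 0 - β 1‖ := by
  have h0 := sqrt_separation_mul_norm_le hα 0
  have h1 := sqrt_separation_mul_norm_le hα 1
  linarith

end Separation

/-! ### Size of the displacement of a feasible point -/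

section Deterministic

variable {x : Fin n → EuclideanSpace ℝ (Fin p)} {z : Fin n → Fin 2}
  {β : Fin 2 → EuclideanSpace ℝ (Fin p)} {e : EuclideanSpace ℝ (Fin n)} {η C : ℝ}

/-- Each term is `e i` times `±⟨x i, β 0 - β 1⟩ + e i`. Cauchy-Schwarz handles the first part, and
the assumption on `‖e‖` reduces `‖e‖²` to the same order. -/
theorem sum_abs_noise_le (hx : ∀ v, ∑ i, (inner ℝ v (x i)) ^ 2 ≤ C * n * ‖v‖ ^ 2)
    (he : ‖e‖ ≤ √n * ‖β 0 - β 1‖) :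
    ∑ i, |e i * (inner ℝ (x i) (β (z i)) - inner ℝ (x i) (β (1 - z i)) + e i)| ≤
      (√C + 1) * (√n * ‖e‖ * ‖β 0 - β 1‖) := by
  have h1 : ∀ i, |e i * (inner ℝ (x i) (β (z i)) - inner ℝ (x i) (β (1 - z i)) + e i)| ≤
      |e i * inner ℝ (x i) (β 0 - β 1)| + e i ^ 2 := by
    intro i
    have hz : z i = 0 ∨ z i = 1 := by
      generalize z i = b
      fin_cases b <;> simp
    have h2 : |e i * (inner ℝ (x i) (β (z i)) - inner ℝ (x i) (β (1 - z i)))| =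
        |e i * inner ℝ (x i) (β 0 - β 1)| := by
      rw [inner_sub_right]
      rcases hz with hz | hz
      · rw [hz, sub_zero]
      · rw [hz, sub_self, abs_mul, abs_mul, abs_sub_comm]
    rw [mul_add, ← h2, ← abs_of_nonneg (sq_nonneg (e i)), sq]
    exact abs_add_le _ _
  refine (Finset.sum_le_sum fun i _ => h1 i).trans ?_
  rw [Finset.sum_add_distrib, ← EuclideanSpace.real_norm_sq_eq]
  have h3 := sum_abs_mul_inner_le hx e (β 0 - β 1)
  have h4 : ‖e‖ ^ 2 ≤ ‖e‖ * (√n * ‖β 0 - β 1‖) := by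
    rw [sq]
    exact mul_le_mul_of_nonneg_left he (norm_nonneg _)
  linarith

theorem isFeasible_symmProd (hx : ∀ v, ∑ i, (inner ℝ v (x i)) ^ 2 ≤ C * n * ‖v‖ ^ 2)
    (he : ‖e‖ ≤ √n * ‖β 0 - β 1‖) (hη : (√C + 1) * (√n * ‖e‖ * ‖β 0 - β 1‖) ≤ η) :
    IsFeasible x (response x z β e) η (symmProd β) (midpt β) := by
  unfold IsFeasible
  simp_rw [residual_eq]
  refine le_trans (le_of_eq (Finset.sum_congr rfl fun i _ => ?_))
    ((sum_abs_noise_le (z := z) hx he).trans hη)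
  rw [← abs_neg]
  congr 1
  have e0 : ∀ b : EuclideanSpace ℝ (Fin p), residualForm b 0 0 = 0 := by
    intro b
    ext k l
    simp [residualForm, dyad]
  rw [sub_self, sub_self, e0, inner_zero_right]
  simp [matInner]

/-- The displacement of a feasible point from the truth has small residual forms. -/
theorem sum_abs_residualForm_le (hx : ∀ v, ∑ i, (inner ℝ v (x i)) ^ 2 ≤ C * n * ‖v‖ ^ 2)
    (he : ‖e‖ ≤ √n * ‖β 0 - β 1‖) (hη : (√C + 1) * (√n * ‖e‖ * ‖β 0 - β 1‖) ≤ η)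
    {K : Matrix (Fin p) (Fin p) ℝ} {g : EuclideanSpace ℝ (Fin p)}
    (h : IsFeasible x (response x z β e) η K g) :
    ∑ i, |matInner (outer (x i)) (residualForm (β (z i)) (K - symmProd β) (g - midpt β))| ≤
      2 * η + 2 * (√C * (√n * ‖e‖ * ‖g - midpt β‖)) := by
  have h1 := (sum_abs_noise_le (z := z) hx he).trans hη
  have h2 := sum_abs_mul_inner_le hx e (g - midpt β)
  have h3 : ∀ i, |matInner (outer (x i))
      (residualForm (β (z i)) (K - symmProd β) (g - midpt β))| ≤
      |-matInner (outer (x i)) K + 2 * response x z β e i * inner ℝ (x i) g -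
        response x z β e i ^ 2| +
      |e i * (inner ℝ (x i) (β (z i)) - inner ℝ (x i) (β (1 - z i)) + e i)| +
      2 * |e i * inner ℝ (x i) (g - midpt β)| := by
    intro i
    rw [residual_eq]
    generalize matInner (outer (x i)) _ = a
    generalize e i * (_ - _ + _) = b
    generalize e i * _ = c
    have e1 : a = (a + 2 * c - b) + b - 2 * c := by ring
    calc |a| = |(a + 2 * c - b) + b - 2 * c| := by rw [← e1]
      _ ≤ |(a + 2 * c - b) + b| + |2 * c| := abs_sub _ _
      _ ≤ |a + 2 * c - b| + |b| + 2 * |c| := by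
          rw [abs_mul, abs_two]
          exact add_le_add_left (abs_add_le _ _) _
  refine (Finset.sum_le_sum fun i _ => h3 i).trans ?_
  rw [Finset.sum_add_distrib, Finset.sum_add_distrib, ← Finset.mul_sum]
  unfold IsFeasible at h
  linarith

/-- The total size of the two residual forms of a displacement. -/
noncomputable def residualSize (β : Fin 2 → EuclideanSpace ℝ (Fin p))
    (H : Matrix (Fin p) (Fin p) ℝ) (h : EuclideanSpace ℝ (Fin p)) : ℝ :=
  frobNorm (residualForm (β 0) H h) + frobNorm (residualForm (β 1) H h)

/-- `H` cancels in the difference of the two residual forms, leaving `u hᵀ + h uᵀ` with `u = β 0 - β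
1`, whose squared Frobenius norm is `2 (‖u‖² ‖h‖² + ⟨u, h⟩²)`. Both classes are needed to isolate
`h`. -/
theorem norm_mul_norm_le_residualSize (β : Fin 2 → EuclideanSpace ℝ (Fin p))
    (H : Matrix (Fin p) (Fin p) ℝ) (h : EuclideanSpace ℝ (Fin p)) :
    ‖β 0 - β 1‖ * ‖h‖ ≤ residualSize β H h := by
  have e1 : residualForm (β 0) H h - residualForm (β 1) H h =
      dyad (β 0 - β 1) h + dyad h (β 0 - β 1) := by
    ext i j
    simp only [residualForm, dyad, Matrix.sub_apply, Matrix.add_apply, Matrix.of_apply,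
      PiLp.sub_apply]
    ring
  refine le_trans ?_ (frobNorm_sub_le _ _)
  rw [e1]
  refine le_of_sq_le_sq ?_ (frobNorm_nonneg _)
  rw [frobNorm_sq, matInner_add_right, matInner_add_left, matInner_add_left]
  simp only [matInner_dyad_dyad, real_inner_self_eq_norm_sq]
  rw [real_inner_comm h (β 0 - β 1)]
  nlinarith [sq_nonneg (inner ℝ h (β 0 - β 1) : ℝ), sq_nonneg (‖β 0 - β 1‖ * ‖h‖)]

/-- Once `h` is controlled, `H` is read off from one residual form. The factor `√(separation β)`
pays for `‖β 0‖`, which may be much larger than `‖β 0 - β 1‖`. -/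
theorem frobNorm_le_residualSize (hα : 0 < separation β) (H : Matrix (Fin p) (Fin p) ℝ)
    (h : EuclideanSpace ℝ (Fin p)) :
    √(separation β) * frobNorm H ≤ 4 * residualSize β H h := by
  set S := residualSize β H h with hS
  have h0 : 0 ≤ S := add_nonneg (frobNorm_nonneg _) (frobNorm_nonneg _)
  have h1 : frobNorm H ≤ S + 2 * (‖β 0‖ * ‖h‖) := by
    have e1 : H = dyad (β 0) h + dyad h (β 0) - residualForm (β 0) H h := by
      rw [residualForm]; abel
    have h2 := frobNorm_sub_le (dyad (β 0) h + dyad h (β 0)) (residualForm (β 0) H h)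
    rw [← e1] at h2
    have h3 := frobNorm_add_le (dyad (β 0) h) (dyad h (β 0))
    rw [frobNorm_dyad, frobNorm_dyad] at h3
    have h4 := frobNorm_nonneg (residualForm (β 1) H h)
    rw [residualSize] at hS
    linarith [mul_comm ‖h‖ ‖β 0‖]
  have h2 := norm_mul_norm_le_residualSize β H h
  have h3 := sqrt_separation_mul_norm_le hα 0
  have h4 := sqrt_separation_le β
  have h5 : √(separation β) * ‖β 0‖ * ‖h‖ ≤ ‖β 0 - β 1‖ * ‖h‖ := by gcongr
  have h6 : √(separation β) * S ≤ 3 / 2 * S := by gcongr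
  have h7 : √(separation β) * frobNorm H ≤ √(separation β) * (S + 2 * (‖β 0‖ * ‖h‖)) := by gcongr
  nlinarith

/-- Compression to the complement of the span of the regressors kills `β b`, so there the residual
form equals `-H`, and the cone condition bounds that block by the rest of `H`. Both remainders have
small rank, hence nuclear norm at most `2√2` times Frobenius norm. -/
theorem nuclearNorm_residualForm_le (hα : 0 < separation β) {H : Matrix (Fin p) (Fin p) ℝ}
    (hH : nuclearNorm (symmProd β + H) ≤ nuclearNorm (symmProd β)) (h : EuclideanSpace ℝ (Fin p))
    (b : Fin 2) :
    √(separation β) * nuclearNorm (residualForm (β b) H h) ≤ 17 * residualSize β H h := by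
  obtain ⟨Q, hQ⟩ := exists_isProjOn β
  set S := residualSize β H h with hS
  have h0 : 0 ≤ S := add_nonneg (frobNorm_nonneg _) (frobNorm_nonneg _)
  set Z := residualForm (β b) H h with hZ
  have hK : Q * symmProd β * Q = symmProd β := by
    rw [symmProd, Matrix.mul_smul, Matrix.smul_mul, mul_add, add_mul, mul_dyad_mul hQ.symm,
      mul_dyad_mul hQ.symm, hQ.apply, hQ.apply]
  have e1 : (1 - Q) * Z * (1 - Q) = -((1 - Q) * H * (1 - Q)) := by
    have e0 : ∀ R A B : Matrix (Fin p) (Fin p) ℝ, R * (A + B - H) * R =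
        R * A * R + R * B * R - R * H * R := fun R A B => by
      rw [mul_sub, sub_mul, mul_add, add_mul]
    rw [hZ, residualForm, e0, mul_dyad_mul hQ.compl_symm,
      mul_dyad_mul hQ.compl_symm, hQ.compl_apply]
    have e2 : ∀ v : EuclideanSpace ℝ (Fin p), dyad 0 v = 0 ∧ dyad v 0 = 0 := fun v =>
      ⟨by ext i j; simp [dyad], by ext i j; simp [dyad]⟩
    rw [(e2 _).1, (e2 _).2, add_zero, zero_sub]
  have h1 := hQ.nuclearNorm_sub_compl_le Z
  have h2 := hQ.nuclearNorm_sub_compl_le H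
  have h3 := hQ.nuclearNorm_compl_le hK hH
  have h4 := nuclearNorm_add_le (Z - (1 - Q) * Z * (1 - Q)) ((1 - Q) * Z * (1 - Q))
  rw [sub_add_cancel] at h4
  have h5 := nuclearNorm_neg_le ((1 - Q) * H * (1 - Q))
  rw [← e1] at h5
  have h6 := frobNorm_le_residualSize hα H h
  have h7 : frobNorm Z ≤ S := by
    have h8 := frobNorm_nonneg (residualForm (β 0) H h)
    have h9 := frobNorm_nonneg (residualForm (β 1) H h)
    rw [hS, hZ, residualSize]
    fin_cases b <;> simp <;> assumption
  have hs := sqrt_separation_le β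
  have hs0 := Real.sqrt_nonneg (separation β)
  have h2s : 2 * √2 ≤ 17 / 6 := by
    have : √(2 : ℝ) ≤ 17 / 12 := by
      rw [Real.sqrt_le_left (by norm_num)]
      norm_num
    linarith
  have h10 : nuclearNorm Z ≤ 17 / 6 * S + 17 / 6 * frobNorm H := by
    have : 2 * √2 * frobNorm Z ≤ 17 / 6 * S := mul_le_mul h2s h7 (frobNorm_nonneg _) (by norm_num)
    have : 2 * √2 * frobNorm H ≤ 17 / 6 * frobNorm H := by gcongr; exact frobNorm_nonneg _
    linarith
  have h11 : √(separation β) * nuclearNorm Z ≤ √(separation β) * (17 / 6 * S + 17 / 6 * frobNorm H) := by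
    gcongr
  have h12 : √(separation β) * S ≤ 3 / 2 * S := by gcongr
  nlinarith

end Deterministic

end MixedRegression

namespace MixedRegression

variable {n p : ℕ}

/-! ### Existence of a symmetric optimal solution -/

section Existence

theorem continuous_nuclearNorm_of :
    Continuous fun w : EuclideanSpace ℝ (Fin p × Fin p) =>
      nuclearNorm (Matrix.of fun i j => w (i, j)) := by
  refine (LipschitzWith.of_le_add_mul' √p fun w w' => ?_).continuous
  have h1 := nuclearNorm_add_le (Matrix.of fun i j => w' (i, j))
    ((Matrix.of fun i j => w (i, j)) - Matrix.of fun i j => w' (i, j))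
  rw [add_sub_cancel] at h1
  have h2 := nuclearNorm_le_sqrt_mul_frobNorm
    ((Matrix.of fun i j => w (i, j)) - Matrix.of fun i j => w' (i, j))
  have h3 : frobNorm ((Matrix.of fun i j => w (i, j)) - Matrix.of fun i j => w' (i, j)) =
      dist w w' := by
    rw [dist_eq_norm, frobNorm]
    rfl
  rw [h3] at h2
  linarith

/-- The program has a symmetric optimal solution if its symmetric feasible points of nuclear norm
at most that of a given one are bounded. -/
theorem exists_isOptimal_isSymm {x : Fin n → EuclideanSpace ℝ (Fin p)} {y : Fin n → ℝ} {η B : ℝ}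
    {K₀ : Matrix (Fin p) (Fin p) ℝ} {g₀ : EuclideanSpace ℝ (Fin p)} (h₀ : IsFeasible x y η K₀ g₀)
    (hK₀ : K₀.IsSymm)
    (hB : ∀ K g, IsFeasible x y η K g → K.IsSymm → nuclearNorm K ≤ nuclearNorm K₀ →
      frobNorm K ≤ B ∧ ‖g‖ ≤ B) :
    ∃ K g, IsOptimal x y η K g ∧ K.IsSymm := by
  set mat : EuclideanSpace ℝ (Fin p × Fin p) → Matrix (Fin p) (Fin p) ℝ :=
    fun w => Matrix.of fun i j => w (i, j) with hmat
  have hvec : ∀ K, mat (matVec K) = K := fun K => rfl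
  set T : Set (EuclideanSpace ℝ (Fin p × Fin p) × EuclideanSpace ℝ (Fin p)) :=
    {w | (∀ i j, w.1 (i, j) = w.1 (j, i)) ∧ IsFeasible x y η (mat w.1) w.2 ∧
      nuclearNorm (mat w.1) ≤ nuclearNorm K₀} with hT
  have hsymm : ∀ w : EuclideanSpace ℝ (Fin p × Fin p), (∀ i j, w (i, j) = w (j, i)) ↔
      (mat w).IsSymm := fun w => by
    rw [Matrix.IsSymm.ext_iff]
    exact ⟨fun h i j => h j i, fun h i j => h j i⟩
  have hmem : ∀ K g, K.IsSymm → IsFeasible x y η K g → nuclearNorm K ≤ nuclearNorm K₀ →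
      (matVec K, g) ∈ T := fun K g h1 h2 h3 => ⟨(hsymm _).2 h1, h2, h3⟩
  have hnc : Continuous fun w : EuclideanSpace ℝ (Fin p × Fin p) × EuclideanSpace ℝ (Fin p) =>
      nuclearNorm (mat w.1) := continuous_nuclearNorm_of.comp continuous_fst
  have hclosed : IsClosed T := by
    have h1 : IsClosed (⋂ i, ⋂ j, {w : EuclideanSpace ℝ (Fin p × Fin p) ×
        EuclideanSpace ℝ (Fin p) | w.1 (i, j) = w.1 (j, i)}) :=
      isClosed_iInter fun i => isClosed_iInter fun j => isClosed_eq (by fun_prop) (by fun_prop)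
    have h2 : IsClosed {w : EuclideanSpace ℝ (Fin p × Fin p) × EuclideanSpace ℝ (Fin p) |
        ∑ i, |-matInner (outer (x i)) (mat w.1) + 2 * y i * inner ℝ (x i) w.2 - y i ^ 2| ≤ η} := by
      refine isClosed_le ?_ continuous_const
      simp only [hmat, matInner, Matrix.of_apply]
      fun_prop
    have h3 := isClosed_le hnc (continuous_const (y := nuclearNorm K₀))
    convert h1.inter (h2.inter h3) using 1
    ext w
    simp only [hT, Set.mem_inter_iff, Set.mem_iInter, Set.mem_ofPred_eq, IsFeasible]
  have hbdd : Bornology.IsBounded T := by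
    refine (Metric.isBounded_closedBall (x := (0 : EuclideanSpace ℝ (Fin p × Fin p) ×
      EuclideanSpace ℝ (Fin p))) (r := B)).subset fun w hw => ?_
    rw [mem_closedBall_zero_iff, Prod.norm_def]
    obtain ⟨h1, h2⟩ := hB _ _ hw.2.1 ((hsymm _).1 hw.1) hw.2.2
    exact max_le h1 h2
  obtain ⟨w, hw, hmin⟩ := (Metric.isCompact_of_isClosed_isBounded hclosed hbdd).exists_isMinOn
    ⟨_, hmem K₀ g₀ hK₀ h₀ le_rfl⟩ hnc.continuousOn
  refine ⟨mat w.1, w.2, ⟨hw.2.1, fun K' g' h' => ?_⟩, (hsymm _).1 hw.1⟩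
  have hs := nuclearNorm_symm_le K'
  -- The minimum is taken over the compact set `T` only. A competitor is replaced by its symmetric
  -- part, which either lies in `T` or has nuclear norm at least that of `K₀`.
  rcases le_total (nuclearNorm ((1 / 2 : ℝ) • (K' + K'.transpose))) (nuclearNorm K₀) with hc | hc
  · have hsym : ((1 / 2 : ℝ) • (K' + K'.transpose)).IsSymm := by
      rw [Matrix.IsSymm, Matrix.transpose_smul, Matrix.transpose_add, Matrix.transpose_transpose,
        add_comm]
    exact (isMinOn_iff.1 hmin _ (hmem _ g' hsym (isFeasible_symm h') hc)).trans hs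
  · exact hw.2.2.trans (hc.trans hs)

end Existence

/-! ### Error of the program and of the spectral step -/

section Deterministic

variable {x : Fin n → EuclideanSpace ℝ (Fin p)} {z : Fin n → Fin 2}
  {β : Fin 2 → EuclideanSpace ℝ (Fin p)} {e : EuclideanSpace ℝ (Fin n)} {η c τ C : ℝ}

/-- The basic estimate: symmetric feasible points whose nuclear norm does not exceed that of the
truth are close to the truth. -/
theorem residualSize_le (hreg : IsWellConditioned x z c τ C) (hc : 0 < c) (hτ : 0 < τ) (hp : 0 < p)
    (hα : 0 < separation β) {k c₅ : ℝ} (hk : ∀ b, (n : ℝ) ≤ k * classSize z b)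
    (hN : ∀ b, (68 / τ) ^ 2 * p ≤ separation β * classSize z b)
    (hc₅ : 2 ≤ c₅) (hc₅' : 32 * k * √C ≤ c * c₅)
    (he : ‖e‖ ≤ 2 / c₅ * (√n * ‖β 0 - β 1‖))
    (hη : (√C + 1) * (√n * ‖e‖ * ‖β 0 - β 1‖) ≤ η)
    {K : Matrix (Fin p) (Fin p) ℝ} {g : EuclideanSpace ℝ (Fin p)}
    (hf : IsFeasible x (response x z β e) η K g) (hK : K.IsSymm)
    (hKn : nuclearNorm K ≤ nuclearNorm (symmProd β)) :
    c * (n * residualSize β (K - symmProd β) (g - midpt β)) ≤ 16 * (k * η) := by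
  set H := K - symmProd β with hH
  set h := g - midpt β with hh
  set S := residualSize β H h with hS
  have hp' : (0 : ℝ) < p := by exact_mod_cast hp
  have hS0 : 0 ≤ S := add_nonneg (frobNorm_nonneg _) (frobNorm_nonneg _)
  have hc₅0 : 0 < c₅ := by linarith
  have he1 : ‖e‖ ≤ √n * ‖β 0 - β 1‖ := by
    refine he.trans (mul_le_of_le_one_left (by positivity) ?_)
    rw [div_le_one hc₅0]
    exact hc₅
  have hsum := sum_abs_residualForm_le hreg.upper he1 hη hf
  have hHs : H.IsSymm := by
    rw [Matrix.IsSymm, hH, Matrix.transpose_sub, hK.eq, (symmProd_isSymm β).eq]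
  have hHn : nuclearNorm (symmProd β + H) ≤ nuclearNorm (symmProd β) := by
    rwa [hH, add_sub_cancel]
  -- The class with the larger residual form suffices; the lower bound is not needed on the other
  -- one.
  obtain ⟨b, hb⟩ : ∃ b, S / 2 ≤ frobNorm (residualForm (β b) H h) := by
    by_contra! hcon
    have h0 := hcon 0
    have h1 := hcon 1
    rw [residualSize] at hS
    linarith
  set N : ℝ := (classSize z b : ℝ) with hNdef
  have hα0 : 0 < √(separation β) := Real.sqrt_pos.2 hα
  have hN0 : 0 < N := by
    have h1 := hN b
    have h2 : 0 < (68 / τ) ^ 2 * p := by positivity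
    exact pos_of_mul_pos_right (h2.trans_le h1) hα.le
  -- The value `68 = 4 * 17` makes the nuclear norm term at most `S / 4`, half of the Frobenius
  -- term.
  have hR : 68 ≤ √(separation β) * (τ * √(N / p)) := by
    have h1 : 68 / τ ≤ √(separation β * (N / p)) := by
      refine Real.le_sqrt_of_sq_le ?_
      rw [← mul_div_assoc, le_div_iff₀ hp']
      exact hN b
    rw [Real.sqrt_mul hα.le, div_le_iff₀ hτ] at h1
    linarith
  have hnuc : nuclearNorm (residualForm (β b) H h) / (τ * √(N / p)) ≤ S / 4 := by
    rw [div_le_iff₀ (by positivity)]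
    have h1 := nuclearNorm_residualForm_le hα hHn h b
    have h2 : 68 * S ≤ √(separation β) * (τ * √(N / p)) * S := by gcongr
    refine le_of_mul_le_mul_left ?_ hα0
    linarith
  have hlow := hreg.lower b _ (residualForm_isSymm (β b) h hHs)
  have hle : ∑ i ∈ Finset.univ.filter (fun i => z i = b),
      |matInner (outer (x i)) (residualForm (β b) H h)| ≤
      ∑ i, |matInner (outer (x i)) (residualForm (β (z i)) H h)| := by
    refine le_trans (le_of_eq (Finset.sum_congr rfl fun i hi => ?_))
      (Finset.sum_le_sum_of_subset_of_nonneg (Finset.filter_subset _ _) fun _ _ _ => abs_nonneg _)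
    rw [(Finset.mem_filter.1 hi).2]
  have h1 : N * (c * (S / 4)) ≤ 2 * η + 2 * (√C * (√n * ‖e‖ * ‖h‖)) := by
    refine le_trans ?_ (hlow.trans (hle.trans hsum))
    gcongr
    linarith
  have hk0 : 0 ≤ k := by
    have h2 := hk b
    have h3 : (0 : ℝ) ≤ k * N := (Nat.cast_nonneg n).trans h2
    exact nonneg_of_mul_nonneg_left h3 hN0
  have h2 : √n * ‖e‖ * ‖h‖ ≤ 2 / c₅ * (n * S) := by
    calc √n * ‖e‖ * ‖h‖ ≤ √n * (2 / c₅ * (√n * ‖β 0 - β 1‖)) * ‖h‖ := by gcongr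
      _ = 2 / c₅ * ((√n * √n) * (‖β 0 - β 1‖ * ‖h‖)) := by ring
      _ ≤ 2 / c₅ * (n * S) := by
          rw [Real.mul_self_sqrt (Nat.cast_nonneg n)]
          gcongr
          exact norm_mul_norm_le_residualSize β H h
  have h3 : n * (c * (S / 4)) ≤ k * (N * (c * (S / 4))) := by
    rw [← mul_assoc k]
    exact mul_le_mul_of_nonneg_right (hk b) (by positivity)
  have h4 : k * (N * (c * (S / 4))) ≤ k * (2 * η + 2 * (√C * (2 / c₅ * (n * S)))) := by
    refine mul_le_mul_of_nonneg_left (h1.trans ?_) hk0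
    gcongr
  -- The noise acting on `h` is absorbed: `c₅` is large enough that it takes at most half of the `c
  -- n S / 4` on the left.
  have h5 : k * (2 * (√C * (2 / c₅ * (n * S)))) ≤ c / 8 * (n * S) := by
    have h6 : k * (2 * (√C * (2 / c₅))) ≤ c / 8 := by
      rw [show k * (2 * (√C * (2 / c₅))) = 4 * k * √C / c₅ by ring, div_le_iff₀ hc₅0]
      linarith
    have h7 := mul_le_mul_of_nonneg_right h6 (by positivity : 0 ≤ n * S)
    linarith
  linarith

/-- A displacement of the truth by `(H, h)` changes the output by little. -/
theorem pairDist_le (hα : 0 < separation β) {D ν : ℝ} (hD : 0 ≤ D) (hν : 0 ≤ ν)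
    (hνβ : ν ≤ ‖β 0 - β 1‖) {K : Matrix (Fin p) (Fin p) ℝ} {g : EuclideanSpace ℝ (Fin p)}
    (hK : K.IsSymm) (hg : ‖g - midpt β‖ ≤ D * ν)
    (hKb : √(separation β) * frobNorm (K - symmProd β) ≤ 4 * D * (‖β 0 - β 1‖ * ν))
    {θ : Fin 2 → EuclideanSpace ℝ (Fin p)} (hθ : IsSpectralOutput K g θ) :
    pairDist θ β ≤ (250 * D + 80 * D ^ 2) * (1 / √(separation β)) * ν := by
  obtain ⟨lam, v, hpair, hθ0, hθ1⟩ := hθ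
  set s := √(separation β) with hs
  have hs0 : 0 < s := Real.sqrt_pos.2 hα
  have hs1 : s ≤ 3 / 2 := sqrt_separation_le β
  set Δ := ‖β 0 - β 1‖ with hΔ
  have hΔ0 : 0 < Δ := norm_sub_pos hα
  set m := midpt β with hm
  set h := g - m with hh
  set d : EuclideanSpace ℝ (Fin p) := (1 / 2 : ℝ) • (β 0 - β 1) with hd
  have hdn : ‖d‖ = Δ / 2 := by
    rw [hd, norm_smul, Real.norm_of_nonneg (by norm_num)]
    ring
  have hβ0 : β 0 = m + d := by
    rw [hm, hd, midpt]
    module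
  have hβ1 : β 1 = m - d := by
    rw [hm, hd, midpt]
    module
  have hgm : g = m + h := by rw [hh]; abel
  have hmn : s * ‖m‖ ≤ Δ := by
    have h1 : ‖m‖ ≤ 1 / 2 * (‖β 0‖ + ‖β 1‖) := by
      rw [hm, midpt, norm_smul, Real.norm_of_nonneg (by norm_num)]
      gcongr
      exact norm_add_le _ _
    have h2 := sqrt_separation_mul_le hα
    have h3 : s * ‖m‖ ≤ s * (1 / 2 * (‖β 0‖ + ‖β 1‖)) := by gcongr
    linarith
  have hJs : (outer g - K).IsSymm := by
    rw [Matrix.IsSymm, Matrix.transpose_sub, hK.eq, outer_eq_dyad, dyad_transpose]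
  have eJ : outer g - K - outer d =
      dyad m h + dyad h m + dyad h h - (K - symmProd β) := by
    rw [hd, ← outer_midpt_sub_symmProd, ← hm, hgm]
    ext i j
    simp only [outer, dyad, Matrix.sub_apply, Matrix.add_apply, Matrix.of_apply, PiLp.add_apply]
    ring
  -- The terms in `m` and `h` give `2D`, the square of `h` gives `3/2 D²` by `ν ≤ Δ`, and `K -
  -- symmProd β` gives `4D`. The division by `s` comes from `s * ‖m‖ ≤ Δ` and from the bound on `K`.
  set ε := (6 * D + 2 * D ^ 2) * (Δ * ν) / s with hε
  have hJε : frobNorm (outer g - K - outer d) ≤ ε := by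
    rw [eJ, hε, le_div_iff₀ hs0]
    have h1 := frobNorm_sub_le (dyad m h + dyad h m + dyad h h) (K - symmProd β)
    have h2 := frobNorm_add_le (dyad m h + dyad h m) (dyad h h)
    have h3 := frobNorm_add_le (dyad m h) (dyad h m)
    rw [frobNorm_dyad] at h2
    rw [frobNorm_dyad, frobNorm_dyad] at h3
    set F := frobNorm (dyad m h + dyad h m + dyad h h - (K - symmProd β))
    have h4 : F ≤ 2 * (‖m‖ * ‖h‖) + ‖h‖ * ‖h‖ + frobNorm (K - symmProd β) := by
      linarith [mul_comm ‖h‖ ‖m‖]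
    have h5 : s * ‖m‖ * ‖h‖ ≤ Δ * (D * ν) := mul_le_mul hmn hg (norm_nonneg _) hΔ0.le
    have h6 : s * (‖h‖ * ‖h‖) ≤ 3 / 2 * (D * ν * (D * Δ)) := by
      have h7 : ‖h‖ ≤ D * Δ := hg.trans (by gcongr)
      gcongr
    have h8 : s * F ≤ s * (2 * (‖m‖ * ‖h‖) + ‖h‖ * ‖h‖ + frobNorm (K - symmProd β)) := by gcongr
    have h9 : 0 ≤ D * ν * (D * Δ) := by positivity
    linarith
  -- This is `10 ε / ‖d‖`; since `‖d‖ = Δ / 2`, the factor `Δ` cancels and the error no longer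
  -- depends on the size of the regressors.
  set X := 20 * ((6 * D + 2 * D ^ 2) * ν / s) with hX
  have hXε : ∀ a : ℝ, a * ‖d‖ ≤ 10 * ε → a ≤ X := by
    intro a ha
    have e1 : 10 * ε = X * ‖d‖ := by
      rw [hdn, hε, hX]
      ring
    rw [e1] at ha
    exact le_of_mul_le_mul_right ha (by rw [hdn]; positivity)
  have hfinal : 2 * (D * ν) + 2 * X ≤ (250 * D + 80 * D ^ 2) * (1 / s) * ν := by
    have h1 : 2 * (D * ν) ≤ 3 * D * (1 / s) * ν := by
      have : 1 ≤ 3 / 2 * (1 / s) := by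
        rw [mul_one_div, le_div_iff₀ hs0]
        linarith
      calc 2 * (D * ν) = 2 * (D * ν) * 1 := by ring
        _ ≤ 2 * (D * ν) * (3 / 2 * (1 / s)) := by gcongr
        _ = 3 * D * (1 / s) * ν := by ring
    have h2 : 2 * X = (240 * D + 80 * D ^ 2) * (1 / s) * ν := by
      rw [hX]
      ring
    have h3 : 0 ≤ D * (1 / s) * ν := by positivity
    linarith
  refine le_trans ?_ hfinal
  -- The sign of the eigenvector is undetermined; the two cases correspond to the two matchings in
  -- `pairDist`.
  rcases exists_sign_norm_sub_le hJs hJε hpair with hcase | hcase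
  · have hb := hXε _ hcase
    refine (min_le_left _ _).trans ?_
    have h1 : ‖θ 0 - β 0‖ ≤ ‖h‖ + ‖√lam • v - d‖ := by
      have : θ 0 - β 0 = h + (√lam • v - d) := by rw [hθ0, hβ0, hgm]; abel
      rw [this]
      exact norm_add_le _ _
    have h2 : ‖θ 1 - β 1‖ ≤ ‖h‖ + ‖√lam • v - d‖ := by
      have : θ 1 - β 1 = h - (√lam • v - d) := by rw [hθ1, hβ1, hgm]; abel
      rw [this]
      exact norm_sub_le _ _
    linarith
  · have hb := hXε _ hcase
    refine (min_le_right _ _).trans ?_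
    have h1 : ‖θ 0 - β 1‖ ≤ ‖h‖ + ‖√lam • v + d‖ := by
      have : θ 0 - β 1 = h + (√lam • v + d) := by rw [hθ0, hβ1, hgm]; abel
      rw [this]
      exact norm_add_le _ _
    have h2 : ‖θ 1 - β 0‖ ≤ ‖h‖ + ‖√lam • v + d‖ := by
      have : θ 1 - β 0 = h - (√lam • v + d) := by rw [hθ1, hβ0, hgm]; abel
      rw [this]
      exact norm_sub_le _ _
    linarith

end Deterministic

end MixedRegression

/-! ### Assembly of the theorem -/

namespace MixedRegression

theorem classSize_add_classSize {n : ℕ} (z : Fin n → Fin 2) :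
    classSize z 0 + classSize z 1 = n := by
  have h := Finset.card_filter_add_card_filter_not (s := (Finset.univ : Finset (Fin n)))
    (fun i => z i = 0)
  rw [Finset.card_univ, Fintype.card_fin] at h
  rw [classSize, classSize]
  convert h using 4 with i
  generalize z i = b
  fin_cases b <;> simp

/-- On well conditioned covariates, the method has an output and every output is accurate. -/
theorem exists_isEstimate_and_pairDist_le {n p : ℕ} {x : Fin n → EuclideanSpace ℝ (Fin p)}
    {z : Fin n → Fin 2} {β : Fin 2 → EuclideanSpace ℝ (Fin p)} {e : EuclideanSpace ℝ (Fin n)}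
    {η c τ C C' k c₅ : ℝ} (hreg : IsWellConditioned x z c τ C) (hc : 0 < c) (hτ : 0 < τ) (hn : 0 < n)
    (hp : 0 < p) (hα : 0 < separation β) (hk0 : 0 ≤ k) (hk : ∀ b, (n : ℝ) ≤ k * classSize z b)
    (hN : ∀ b, (68 / τ) ^ 2 * p ≤ separation β * classSize z b) (hc₅ : 2 ≤ c₅)
    (hc₅' : 32 * k * √C ≤ c * c₅) (hC' : 0 ≤ C')
    (he : ‖e‖ ≤ √(separation β) / c₅ * √n * (‖β 0‖ + ‖β 1‖))
    (hη : (√C + 1) * (√n * ‖e‖ * ‖β 0 - β 1‖) ≤ η) (hη' : η ≤ C' * (√n * ‖e‖ * ‖β 0 - β 1‖)) :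
    (∃ θ, IsEstimate x (response x z β e) η θ) ∧
      ∀ θ, IsEstimate x (response x z β e) η θ →
        pairDist θ β ≤ (250 * (16 * k * C' / c) + 80 * (16 * k * C' / c) ^ 2) *
          (1 / √(separation β)) * (‖e‖ / √n) := by
  set D := 16 * k * C' / c with hD
  have hD0 : 0 ≤ D := by positivity
  set ν := ‖e‖ / √n with hν
  set Δ := ‖β 0 - β 1‖ with hΔ
  have hΔ0 : 0 < Δ := norm_sub_pos hα
  have hn' : (0 : ℝ) < n := by exact_mod_cast hn
  have hsn : 0 < √(n : ℝ) := Real.sqrt_pos.2 hn'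
  have hν0 : 0 ≤ ν := by positivity
  have hs0 : 0 < √(separation β) := Real.sqrt_pos.2 hα
  have hc₅0 : 0 < c₅ := by linarith
  have hen : ‖e‖ = √n * ν := by
    rw [hν]
    field_simp
  have he2 : ‖e‖ ≤ 2 / c₅ * (√n * Δ) := by
    refine he.trans ?_
    calc √(separation β) / c₅ * √n * (‖β 0‖ + ‖β 1‖)
        = √n / c₅ * (√(separation β) * (‖β 0‖ + ‖β 1‖)) := by ring
      _ ≤ √n / c₅ * (2 * Δ) :=
          mul_le_mul_of_nonneg_left (sqrt_separation_mul_le hα) (by positivity)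
      _ = 2 / c₅ * (√n * Δ) := by ring
  have he1 : ‖e‖ ≤ √n * Δ := by
    refine he2.trans (mul_le_of_le_one_left (by positivity) ?_)
    rw [div_le_one hc₅0]
    exact hc₅
  have hνΔ : ν ≤ Δ := by
    rw [hν, div_le_iff₀ hsn, mul_comm]
    exact he1
  have hf₀ := isFeasible_symmProd (z := z) hreg.upper he1 hη
  -- Stated for every symmetric feasible point no heavier than the truth, not just for optimal ones:
  -- the same bound supplies the compactness behind existence and the accuracy of every output.
  have key : ∀ K g, IsFeasible x (response x z β e) η K g → K.IsSymm →
      nuclearNorm K ≤ nuclearNorm (symmProd β) → ‖g - midpt β‖ ≤ D * ν ∧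
        √(separation β) * frobNorm (K - symmProd β) ≤ 4 * D * (Δ * ν) := by
    intro K g hf hK hKn
    have h1 := residualSize_le hreg hc hτ hp hα hk hN hc₅ hc₅' he2 hη hf hK hKn
    set S := residualSize β (K - symmProd β) (g - midpt β)
    have h2 : S ≤ D * (Δ * ν) := by
      have h3 : c * (n * S) ≤ c * (n * (D * (Δ * ν))) := by
        refine h1.trans ?_
        calc 16 * (k * η) ≤ 16 * (k * (C' * (√n * ‖e‖ * Δ))) := by gcongr
          _ = 16 * k * C' * ((√n * √n) * (Δ * ν)) := by rw [hen]; ring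
          _ = 16 * k * C' * (n * (Δ * ν)) := by rw [Real.mul_self_sqrt hn'.le]
          _ = c * (n * (D * (Δ * ν))) := by
              rw [hD]
              field_simp
      exact le_of_mul_le_mul_left (le_of_mul_le_mul_left h3 hc) hn'
    refine ⟨?_, ?_⟩
    · have h3 := norm_mul_norm_le_residualSize β (K - symmProd β) (g - midpt β)
      refine le_of_mul_le_mul_left ?_ hΔ0
      calc Δ * ‖g - midpt β‖ ≤ S := h3
        _ ≤ D * (Δ * ν) := h2
        _ = Δ * (D * ν) := by ring
    · have h3 := frobNorm_le_residualSize hα (K - symmProd β) (g - midpt β)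
      linarith
  refine ⟨?_, ?_⟩
  · obtain ⟨K, g, hopt, hK⟩ := exists_isOptimal_isSymm hf₀ (symmProd_isSymm β)
      (B := max (frobNorm (symmProd β) + 4 * D * (Δ * ν) / √(separation β))
        (‖midpt β‖ + D * ν)) fun K g hf hK hKn => by
      obtain ⟨h1, h2⟩ := key K g hf hK hKn
      refine ⟨le_max_of_le_left ?_, le_max_of_le_right ?_⟩
      · have h3 := frobNorm_add_le (symmProd β) (K - symmProd β)
        rw [add_sub_cancel] at h3
        have h4 : frobNorm (K - symmProd β) ≤ 4 * D * (Δ * ν) / √(separation β) := by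
          rwa [le_div_iff₀ hs0, mul_comm]
        linarith
      · have h3 := norm_add_le (midpt β) (g - midpt β)
        rw [add_sub_cancel] at h3
        linarith
    obtain ⟨lam, v, hpair⟩ := exists_isFirstEigenpair (J := outer g - K) (by
      rw [Matrix.IsSymm, Matrix.transpose_sub, hK.eq, outer_eq_dyad, dyad_transpose]) hp
    exact ⟨![g + √lam • v, g - √lam • v], K, g, hopt, hK, lam, v, hpair, rfl, rfl⟩
  · rintro θ ⟨K, g, hopt, hK, hθ⟩
    obtain ⟨h1, h2⟩ := key K g hopt.1 hK (hopt.2 _ _ hf₀)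
    exact pairDist_le hα hD0 hν0 hνΔ hK h1 h2 hθ

end MixedRegression

open MixedRegression
theorem theorem2 (μ L κ : ℝ) (hμ : 1 < μ) :
    ∃ c₁ c₂ c₃ c₄ c₅ : ℝ, 0 < c₁ ∧ 0 < c₂ ∧ 0 < c₃ ∧ 0 < c₄ ∧ 0 < c₅ ∧
      ∀ C : ℝ, ∃ c₆ : ℝ, 0 < c₆ ∧
        ∀ (n p : ℕ) (z : Fin n → Fin 2) (β : Fin 2 → EuclideanSpace ℝ (Fin p))
          (Ω : Type*) [MeasurableSpace Ω] (P : Measure Ω) [IsProbabilityMeasure P]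
          (x : Fin n → Ω → EuclideanSpace ℝ (Fin p)),
          IsDesign P μ L x →
          (classSize z 0 : ℝ) ≤ κ * classSize z 1 →
          (classSize z 1 : ℝ) ≤ κ * classSize z 0 →
          0 < separation β →
          c₃ * (1 / separation β) * p ≤ (min (classSize z 0) (classSize z 1) : ℕ) →
          ∃ E : Set Ω, MeasurableSet E ∧ 1 - c₁ * Real.exp (-c₂ * n) ≤ P.real E ∧
            ∀ ω ∈ E, ∀ (e : EuclideanSpace ℝ (Fin n)) (η : ℝ),
              c₄ * (√n * ‖e‖ * ‖β 1 - β 0‖) ≤ η →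
              η ≤ C * (√n * ‖e‖ * ‖β 1 - β 0‖) →
              ‖e‖ ≤ √(separation β) / c₅ * √n * (‖β 0‖ + ‖β 1‖) →
              (∃ θ, IsEstimate (fun i => x i ω) (response (fun i => x i ω) z β e) η θ) ∧
              ∀ θ, IsEstimate (fun i => x i ω) (response (fun i => x i ω) z β e) η θ →
                pairDist θ β ≤ c₆ * (1 / √(separation β)) * (‖e‖ / √n) := by
  -- `L` may be nonpositive, so it is enlarged to `max L 1`; this only weakens the hypothesis on the
  -- design.
  obtain ⟨c, τ, C₀, γ, hc, hτ, hC₀, hγ, hev⟩ := IsDesign.exists_event_isWellConditioned (L := max L 1) hμ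
    (lt_max_of_lt_right one_pos)
  -- Balance of the classes gives `n ≤ (κ + 1) * classSize z b`; the maximum keeps `k` positive for
  -- every `κ`.
  set k := max κ 1 + 1 with hk
  have hk1 : 1 ≤ max κ 1 := le_max_right _ _
  have hk0 : 0 < k := by linarith
  -- The three events (one upper bound, two lower bounds) give `c₁ = 3`. In `c₃`, the `2` yields `p
  -- ≤ classSize z b` and `(68 / τ) ^ 2` makes the nuclear norm negligible; `c₄` makes the truth
  -- feasible, and `c₅` absorbs the noise term.
  refine ⟨3, γ / k, max 2 ((68 / τ) ^ 2), √C₀ + 1, 2 + 32 * k * √C₀ / c, by norm_num,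
    by positivity, by positivity, by positivity, by positivity, fun C => ?_⟩
  have hC1 : 1 ≤ max C 1 := le_max_right _ _
  refine ⟨250 * (16 * k * max C 1 / c) + 80 * (16 * k * max C 1 / c) ^ 2, by positivity, ?_⟩
  intro n p z β Ω _ P _ x hx hκ0 hκ1 hα hsize
  -- In dimension `0` the regressors coincide, contrary to positive separation.
  have hp : 0 < p := by
    rcases Nat.eq_zero_or_pos p with rfl | hp
    · have h1 := norm_sub_pos hα
      rw [Subsingleton.elim (β 0 - β 1) 0, norm_zero] at h1
      exact absurd h1 (lt_irrefl 0)
    · exact hp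
  have hp' : (0 : ℝ) < p := by exact_mod_cast hp
  have hmin : ∀ b, min (classSize z 0) (classSize z 1) ≤ classSize z b := by
    intro b
    fin_cases b
    · exact min_le_left _ _
    · exact min_le_right _ _
  have hsize' : max 2 ((68 / τ) ^ 2) * p ≤
      separation β * (min (classSize z 0) (classSize z 1) : ℕ) := by
    have := mul_le_mul_of_nonneg_left hsize hα.le
    refine le_trans (le_of_eq ?_) this
    field_simp
  have hN : ∀ b, max 2 ((68 / τ) ^ 2) * p ≤ separation β * classSize z b := fun b =>
    hsize'.trans (mul_le_mul_of_nonneg_left (by exact_mod_cast hmin b) hα.le)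
  have hpN : ∀ b, p ≤ classSize z b := by
    intro b
    have h1 := hN b
    have h2 : 2 * (p : ℝ) ≤ max 2 ((68 / τ) ^ 2) * p := by gcongr; exact le_max_left _ _
    have h3 : separation β * classSize z b ≤ 2 * classSize z b := by
      gcongr
      exact separation_le_two β
    have h4 : (p : ℝ) ≤ classSize z b := by linarith
    exact_mod_cast h4
  have hsum : (n : ℝ) = classSize z 0 + classSize z 1 := by
    exact_mod_cast (classSize_add_classSize z).symm
  have hkb : ∀ b, (n : ℝ) ≤ k * classSize z b := by
    have h0 : κ * classSize z 0 ≤ max κ 1 * classSize z 0 := by gcongr; exact le_max_left _ _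
    have h1 : κ * classSize z 1 ≤ max κ 1 * classSize z 1 := by gcongr; exact le_max_left _ _
    intro b
    fin_cases b
    · change (n : ℝ) ≤ k * classSize z 0
      rw [hsum, hk]
      linarith
    · change (n : ℝ) ≤ k * classSize z 1
      rw [hsum, hk]
      linarith
  have hn : 0 < n := hp.trans_le ((hpN 0).trans (classSize_le z 0))
  obtain ⟨E, hE, hEP, hreg⟩ := hev P n p x z (hx.mono (le_max_left _ _)) hp hpN
  refine ⟨E, hE, le_trans ?_ hEP, fun ω hω e η hη hη' he => ?_⟩
  · have h1 : (n : ℝ) ≤ k * (min (classSize z 0) (classSize z 1) : ℕ) := by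
      rcases min_choice (classSize z 0) (classSize z 1) with h | h
      · rw [h]; exact hkb 0
      · rw [h]; exact hkb 1
    have h2 : γ / k * n ≤ γ * (min (classSize z 0) (classSize z 1) : ℕ) := by
      rw [div_mul_eq_mul_div, div_le_iff₀ hk0]
      calc γ * n ≤ γ * (k * (min (classSize z 0) (classSize z 1) : ℕ)) := by gcongr
        _ = _ := by ring
    have h3 : Real.exp (-(γ * (min (classSize z 0) (classSize z 1) : ℕ))) ≤
        Real.exp (-(γ / k) * n) := Real.exp_le_exp.2 (by linarith)
    linarith
  · rw [norm_sub_rev (β 1)] at hη hη'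
    refine exists_isEstimate_and_pairDist_le (hreg ω hω) hc hτ hn hp hα hk0.le hkb
      (fun b => le_trans ?_ (hN b)) ?_ ?_ (by positivity) he hη (hη'.trans ?_)
    · gcongr
      exact le_max_right _ _
    · have : 0 ≤ 32 * k * √C₀ / c := by positivity
      linarith
    · have : c * (2 + 32 * k * √C₀ / c) = c * 2 + 32 * k * √C₀ := by field_simp
      rw [this]
      linarith
    · gcongr
      exact le_max_left _ _
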